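/- **Conventions.** Partitions are identified when they differ only by trailing zeros; $l(\lambda)$, $|\lambda|$, $\lambda'$ denote length, size and conjugate; $\langle a^b\rangle=(a,\dots,a)$ ($b$ parts); $\subset$ between partitions is containment of diagrams. We write $(i,j)\in\lambda$ if $i\le\lambda_j$, and by convention $(i,0)\in\lambda$ and $(0,j)\in\lambda$ for all $i,j\ge 0$. For finite sequences in a field, $\Delta(\mathcal X)=\prod_{i<j}(\mathcal X_i-\mathcal X_j)$, $\Delta(\mathcal X;\mathcal Y)=\prod_{x\in\mathcal X,\,y\in\mathcal Y}(x-y)$, $-\mathcal X$ is the elementwise negative and $\mathcal S\cup\mathcal T$ is concatenation. The Littlewood–Schur function is $$LS_\lambda(\mathcal X;\mathcal Y)=\sum_{\mu,\nu}c^\lambda_{\mu\nu}\,\mathfrak s_\mu(\mathcal X)\,\mathfrak s_{\nu'}(\mathcal Y),$$ where $\mathfrak s_\mu$ are the Schur functions and $c^\lambda_{\mu\nu}$ the Littlewood–Richardson coefficients, i.e. $\mathfrak s_\mu\mathfrak s_\nu=\sum_\lambda c^\lambda_{\mu\nu}\mathfrak s_\lambda$. Let $[N]=(1,\dots,N)$.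 For a partition $\lambda$ of length at most $N$ and a subsequence $M\subset[N]$ with $M_1<\dots<M_r$, $\mathrm{sub}_N(\lambda,M)$ is the partition $\mu$ of length at most $r$ given by $\mu_j+r-j=\lambda_{M_j}+N-M_j$ for $1\le j\le r$. For $K\subset[N]$, $C_N(K)\subset[N]$ is the increasing rearrangement of $(N-j+1: j\in[N],\ j\notin K)$. For $\lambda\subset\langle a^N\rangle$, $\tilde\lambda=(a-\lambda_N,\dots,a-\lambda_1)$ is the complement of $\lambda$ in $\langle a^N\rangle$, and $\tilde\lambda_{C}$ is the subsequence of $\tilde\lambda$ indexed by $C\subset[N]$, $|\tilde\lambda_C|$ the sum of its elements. **Statement.** Let $m,n,\tilde n,l,q$ be non-negative integers with $\tilde n\le q$. Let $\mathcal S,\mathcal T,\mathcal Y$ be sequences of elements of a field, of lengths $m$, $n+\tilde n$ and $q$, such that $\Delta(\mathcal Y)\ne0$ and $\Delta(\mathcal S;\mathcal T)\neq0$. Let $\kappa\subset\langle(m+n)^l\rangle$ be a partition with $(m+n,q-\tilde n)\in\kappa$. Then $$\begin{aligned} LS_{\kappa'}(-(\mathcal S\cup\mathcal T);\mathcal Y)={}&\sum_{p=0}^{\min\{m,q\}}\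 \sum_{\mathcal U,\mathcal V}\ \sum_{(\lambda,K)}\frac{\Delta(\mathcal V;\mathcal S)\,\Delta(\mathcal T;\mathcal U)}{\Delta(\mathcal V;\mathcal U)\,\Delta(\mathcal T;\mathcal S)}\,(-1)^{|\tilde\lambda_{C_{n+p+l}(K)}|}\\ &\times LS_{\lambda'-\langle(q-\tilde n)^{m-p}\rangle}(-\mathcal S;\mathcal U)\ LS_{\mathrm{sub}_{n+p+l}(\tilde\lambda,\,C_{n+p+l}(K))}(-\mathcal T;\mathcal V). \end{aligned}$$ Here the second sum is over all ways to split $\mathcal Y$ into a subsequence $\mathcal U$ of length $p$ and the complementary subsequence $\mathcal V$ of length $q-p$; the third sum is over all pairs $(\lambda,K)$ of a partition $\lambda\subset\langle(m-p)^{n+p+l}\rangle$ and a subsequence $K\subset[n+p+l]$ of length $l$ such that $\mathrm{sub}_{n+p+l}(\lambda,K)=\kappa$; and $\tilde\lambda$ is the complement of $\lambda$ in $\langle(m-p)^{n+p+l}\rangle$. In every term $\langle(q-\tilde n)^{m-p}\rangle\subset\lambda'$, so that the elementwise difference $\lambda'-\langle(q-\tilde n)^{m-p}\rangle$ is a partition.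 -/

import Mathlib

/-! Conventions.  A partition is a `YoungDiagram`; its parts are its row lengths, indexed from `0`:
the `(i+1)`-st part of `μ` is `μ.rowLen i`, its length is `μ.colLen 0`, its size is `μ.card`, its
conjugate is `μ.transpose`, and containment of diagrams is `≤`.  A sequence of `n` variables with
values in a ring `R` is a function `Fin n → R`. -/

namespace LSOverlap

open Finset

/-! ### Products of differences, subsequences -/

/-- `Δ(X) = ∏_{i < j} (X_i - X_j)`. -/
def delta {R : Type*} [CommRing R] {n : ℕ} (X : Fin n → R) : R :=
  ∏ i, ∏ j ∈ Ioi i, (X i - X j)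

/-- `Δ(X; Y) = ∏_{x ∈ X, y ∈ Y} (x - y)`. -/
def delta₂ {R : Type*} [CommRing R] {n m : ℕ} (X : Fin n → R) (Y : Fin m → R) : R :=
  ∏ i, ∏ j, (X i - Y j)

/-- The subsequence `X_K` of `X` picked out by a set `K` of indices (in increasing order). -/
def subseq {R : Type*} {n : ℕ} (X : Fin n → R) (K : Finset (Fin n)) : Fin K.card → R :=
  fun i => X (K.orderEmbOfFin rfl i)

/-! ### Partitions -/

/-- The partition `(f 0, f 1, …, f (N-1))` given by a non-increasing sequence. -/
def ofAntitone {N : ℕ} (f : Fin N → ℕ) (hf : Antitone f) : YoungDiagram :=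
  YoungDiagram.ofRowLens (List.ofFn f) (List.sortedGE_ofFn_iff.2 hf)

theorem rowLen_ofAntitone {N : ℕ} (f : Fin N → ℕ) (hf : Antitone f) (i : ℕ) :
    (ofAntitone f hf).rowLen i = if h : i < N then f ⟨i, h⟩ else 0 := by
  have key : ∀ j, j < (ofAntitone f hf).rowLen i ↔ j < if h : i < N then f ⟨i, h⟩ else 0 := by
    intro j
    rw [← YoungDiagram.mem_iff_lt_rowLen, ofAntitone, YoungDiagram.mem_ofRowLens]
    by_cases h : i < N <;> simp [h]
  exact le_antisymm (not_lt.1 fun h => lt_irrefl _ ((key _).1 h))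
    (not_lt.1 fun h => lt_irrefl _ ((key _).2 h))

theorem diagram_ext {μ ν : YoungDiagram} (h : ∀ i, μ.rowLen i = ν.rowLen i) : μ = ν := by
  ext ⟨i, j⟩
  rw [YoungDiagram.mem_cells, YoungDiagram.mem_cells, YoungDiagram.mem_iff_lt_rowLen,
    YoungDiagram.mem_iff_lt_rowLen, h]

theorem rowLen_eq_zero_of_colLen_le {μ : YoungDiagram} {N i : ℕ} (h : μ.colLen 0 ≤ N)
    (hi : N ≤ i) : μ.rowLen i = 0 := by
  by_contra hne
  have h1 : (i, 0) ∈ μ := YoungDiagram.mem_iff_lt_rowLen.2 (Nat.pos_of_ne_zero hne)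
  have h2 := YoungDiagram.mem_iff_lt_colLen.1 h1
  omega

/-- The rectangular partition `⟨a^b⟩ = (a, …, a)` of length `b`. -/
def rect (a b : ℕ) : YoungDiagram := ofAntitone (fun _ : Fin b => a) antitone_const

/-- `(i, j) ∈ μ` for non-negative integers `i`, `j`: either one of the two coordinates is `0`
(by convention) or `i ≤ μ_j`. -/
def InDiagram (i j : ℕ) (μ : YoungDiagram) : Prop :=
  i = 0 ∨ j = 0 ∨ i ≤ μ.rowLen (j - 1)

theorem finite_Iic (μ : YoungDiagram) : (Set.Iic μ).Finite := by
  refine Set.Finite.of_finite_image (f := YoungDiagram.cells)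
    (Set.Finite.subset (μ.cells.powerset.finite_toSet) ?_) ?_
  · rintro _ ⟨ν, hν, rfl⟩
    simpa using YoungDiagram.cells_subset_iff.2 hν
  · intro ν _ ν' _ h
    exact YoungDiagram.ext h

/-- The finite set of all partitions contained in `μ`. -/
noncomputable def subdiagrams (μ : YoungDiagram) : Finset YoungDiagram := (finite_Iic μ).toFinset

theorem mem_subdiagrams {μ ν : YoungDiagram} : ν ∈ subdiagrams μ ↔ ν ≤ μ := by
  simp [subdiagrams]

/-- The `(a, N)`-complement `(a - μ_N, …, a - μ_1)` of a partition `μ ⊆ ⟨a^N⟩`. -/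
def complement (a N : ℕ) (μ : YoungDiagram) : YoungDiagram :=
  ofAntitone (fun i : Fin N => a - μ.rowLen (Fin.rev i)) (by
    intro i j hij
    have h1 : ((Fin.rev j : Fin N) : ℕ) ≤ (Fin.rev i : Fin N) := Fin.rev_le_rev.2 hij
    have h2 := μ.rowLen_anti _ _ h1
    dsimp only
    omega)

/-- The difference `μ - ⟨a^b⟩ = (μ_1 - a, …, μ_b - a)`, for a partition `μ` of length at most `b`
all of whose first `b` parts are at least `a`. -/
def subRect (μ : YoungDiagram) (a b : ℕ) : YoungDiagram :=
  ofAntitone (fun i : Fin b => μ.rowLen i - a) (by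
    intro i j hij
    have h2 := μ.rowLen_anti _ _ (show (i : ℕ) ≤ j from hij)
    dsimp only
    omega)

/-- An increasing sequence of indices moves by at least one in each step. -/
theorem orderEmb_add_le {N m : ℕ} (e : Fin m ↪o Fin N) {i j : Fin m} (hij : i ≤ j) :
    (e i : ℕ) + (j - i : ℕ) ≤ e j := by
  obtain ⟨i, hi⟩ := i
  obtain ⟨j, hj⟩ := j
  simp only [Fin.mk_le_mk] at hij
  induction j, hij using Nat.le_induction with
  | base => simp
  | succ k hk ih =>
    have h1 := ih (by omega)
    have h2 : e ⟨k, by omega⟩ < e ⟨k + 1, hj⟩ := e.lt_iff_lt.2 (by simp)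
    have h3 : ((e ⟨k, by omega⟩ : Fin N) : ℕ) < e ⟨k + 1, hj⟩ := h2
    simp only at h1 ⊢
    omega

/-- The subpartition `sub_N(μ, M)` of a partition `μ` of length at most `N` that corresponds to a
subsequence `M` of `[N]`: with `m = l(M)`, its `j`-th part for `1 ≤ j ≤ m` is
`μ_{M_j} + (N - M_j) - (m - j)`, and it has length at most `m`. -/
def subpartition (N : ℕ) (μ : YoungDiagram) (M : Finset (Fin N)) : YoungDiagram :=
  ofAntitone (fun j : Fin M.card =>
      μ.rowLen (M.orderEmbOfFin rfl j) + (N - 1 - M.orderEmbOfFin rfl j) - (M.card - 1 - j)) (by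
    intro i j hij
    have h1 := orderEmb_add_le (M.orderEmbOfFin rfl) hij
    have h2 := μ.rowLen_anti (M.orderEmbOfFin rfl i) (M.orderEmbOfFin rfl j) (by omega)
    have h3 : (i : ℕ) ≤ j := hij
    have h4 := (M.orderEmbOfFin rfl j).2
    have h5 := j.2
    dsimp only
    omega)

/-- `C_N(K)`, the increasing rearrangement of `(N - j + 1 : j ∉ K)`.  With indices running from
`0` to `N - 1`, the map `j ↦ N - j + 1` is `Fin.rev`. -/
def coSubset {N : ℕ} (K : Finset (Fin N)) : Finset (Fin N) := Kᶜ.image Fin.rev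

open Classical in
/-- All pairs `(μ, K)` with `μ ⊆ ⟨a^N⟩`, `K ⊆ [N]`, `l(K) = l` and `sub_N(μ, K) = κ`. -/
noncomputable def subpartitionPairs (a N l : ℕ) (κ : YoungDiagram) :
    Finset (YoungDiagram × Finset (Fin N)) :=
  {x ∈ subdiagrams (rect a N) ×ˢ Finset.powersetCard l univ | subpartition N x.1 x.2 = κ}

/-! ### Schur functions -/

open MvPolynomial

/-- The alternant `det (x_i ^ {e_j})`. -/
noncomputable def alternant {n : ℕ} (e : Fin n → ℕ) : MvPolynomial (Fin n) ℤ :=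
  (Matrix.of fun i j : Fin n => (X i : MvPolynomial (Fin n) ℤ) ^ e j).det

/-- The sequence `μ + ρ_n`, that is, `μ_j + n - j` for `1 ≤ j ≤ n`. -/
def shifted (n : ℕ) (μ : YoungDiagram) : Fin n → ℕ := fun j => μ.rowLen j + (n - 1 - j)

theorem irreducible_X_sub_X {n : ℕ} {i j : Fin n} (h : i ≠ j) :
    Irreducible (X i - X j : MvPolynomial (Fin n) ℤ) := by
  have := MvPolynomial.irreducible_sumSMulX
    (Finsupp.single i (1 : ℤ) - Finsupp.single j 1) ⟨i, by simp [h]⟩ (by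
      intro r hr
      have := hr i
      simp [h] at this
      exact isUnit_of_dvd_one this)
  simpa [MvPolynomial.sumSMulX, map_sub] using this

theorem not_X_sub_X_dvd {n : ℕ} {i j k l : Fin n} (hij : i < j) (hkl : k < l)
    (h : (i, j) ≠ (k, l)) :
    ¬ (X i - X j : MvPolynomial (Fin n) ℤ) ∣ X k - X l := by
  intro hd
  have := map_dvd (aeval fun t : Fin n => if t = j then ((i : ℕ) : ℤ) else ((t : ℕ) : ℤ)) hd
  simp only [map_sub, aeval_X, if_neg hij.ne, if_true, sub_self, zero_dvd_iff] at this
  have h1 : (i : ℕ) < j := hij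
  have h2 : (k : ℕ) < l := hkl
  simp only [ne_eq, Prod.mk.injEq, Fin.ext_iff] at h this
  split_ifs at this <;> omega

theorem X_sub_X_dvd_alternant {n : ℕ} (e : Fin n → ℕ) {i j : Fin n} (h : i ≠ j) :
    (X i - X j : MvPolynomial (Fin n) ℤ) ∣ alternant e := by
  set M := Matrix.of fun i j : Fin n => (X i : MvPolynomial (Fin n) ℤ) ^ e j with hM
  have h1 := Matrix.det_updateRow_add_smul_self M h (-1)
  choose c hc using fun t : Fin n =>
    sub_dvd_pow_sub_pow (X i : MvPolynomial (Fin n) ℤ) (X j) (e t)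
  have h2 : M i + (-1 : MvPolynomial (Fin n) ℤ) • M j =
      (X i - X j : MvPolynomial (Fin n) ℤ) • c := by
    ext1 t
    simp only [hM, Pi.add_apply, Pi.smul_apply, Matrix.of_apply, smul_eq_mul, ← hc]
    ring
  rw [h2, Matrix.det_updateRow_smul] at h1
  exact ⟨_, h1.symm⟩

theorem delta_eq_prod {n : ℕ} :
    delta (X : Fin n → MvPolynomial (Fin n) ℤ) =
      ∏ p ∈ (univ : Finset (Fin n × Fin n)).filter (fun p => p.1 < p.2), (X p.1 - X p.2) := by
  rw [delta, Finset.prod_filter, ← Finset.univ_product_univ, Finset.prod_product]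
  refine Finset.prod_congr rfl fun i _ => ?_
  rw [← Finset.prod_filter]
  refine Finset.prod_congr ?_ fun _ _ => rfl
  ext j
  simp

/-- `Δ(X)` divides every alternant. -/
theorem delta_dvd_alternant {n : ℕ} (e : Fin n → ℕ) :
    delta (X : Fin n → MvPolynomial (Fin n) ℤ) ∣ alternant e := by
  rw [delta_eq_prod]
  refine Finset.prod_dvd_of_isRelPrime ?_ ?_
  · intro p hp p' hp' hne
    replace hp := (mem_filter.1 (mem_coe.1 hp)).2
    replace hp' := (mem_filter.1 (mem_coe.1 hp')).2
    exact (irreducible_X_sub_X hp.ne).isRelPrime_iff_not_dvd.2 (not_X_sub_X_dvd hp hp' hne)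
  · intro p hp
    simp only [mem_filter, mem_univ, true_and] at hp
    exact X_sub_X_dvd_alternant e hp.ne

/-- The Schur polynomial `s_μ(x_1, …, x_n)`: it is `0` if `μ` has more than `n` parts, and
otherwise it is the quotient of `det (x_i ^ {μ_j + n - j})` by `Δ(x_1, …, x_n)`. -/
noncomputable def schurPoly (n : ℕ) (μ : YoungDiagram) : MvPolynomial (Fin n) ℤ :=
  if μ.colLen 0 ≤ n then (delta_dvd_alternant (shifted n μ)).choose else 0

theorem delta_mul_schurPoly {n : ℕ} {μ : YoungDiagram} (h : μ.colLen 0 ≤ n) :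
    delta X * schurPoly n μ = alternant (shifted n μ) := by
  rw [schurPoly, if_pos h]
  exact (delta_dvd_alternant (shifted n μ)).choose_spec.symm

/-- The Schur function `s_μ(Z)` of a sequence `Z` of elements of a commutative ring. -/
noncomputable def schur {R : Type*} [CommRing R] {n : ℕ} (μ : YoungDiagram) (Z : Fin n → R) : R :=
  aeval Z (schurPoly n μ)

/-! ### Expansion of symmetric polynomials into Schur polynomials -/

/-- `f` is a linear combination of Schur polynomials `s_μ(x_1, …, x_n)` with `l(μ) ≤ n`, and the
coefficient of `s_μ` is `c μ`. -/
def IsSchurExpansion {n : ℕ} (f : MvPolynomial (Fin n) ℤ) (c : YoungDiagram →₀ ℤ) : Prop :=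
  (∀ μ ∈ c.support, μ.colLen 0 ≤ n) ∧ f = c.sum fun μ a => a • schurPoly n μ

theorem delta_ne_zero {n : ℕ} : delta (X : Fin n → MvPolynomial (Fin n) ℤ) ≠ 0 := by
  rw [delta_eq_prod, Finset.prod_ne_zero_iff]
  intro p hp
  simp only [mem_filter, mem_univ, true_and] at hp
  exact (irreducible_X_sub_X hp.ne).ne_zero

theorem rename_alternant {n : ℕ} (e : Fin n → ℕ) (σ : Equiv.Perm (Fin n)) :
    rename σ (alternant e) = (Equiv.Perm.sign σ : ℤ) • alternant e := by
  have h := Matrix.det_permute σ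
    (Matrix.of fun i j : Fin n => (X i : MvPolynomial (Fin n) ℤ) ^ e j)
  rw [alternant, AlgHom.map_det, zsmul_eq_mul, ← h]
  congr 1
  ext1 i j
  simp

theorem delta_eq_alternant {n : ℕ} :
    delta (X : Fin n → MvPolynomial (Fin n) ℤ) = alternant (shifted n ⊥) := by
  have h := Matrix.det_projVandermonde (fun _ : Fin n => (1 : MvPolynomial (Fin n) ℤ)) X
  have h0 : ∀ i, (⊥ : YoungDiagram).rowLen i = 0 := fun i => by
    by_contra hne
    exact YoungDiagram.notMem_bot (i, 0)
      (YoungDiagram.mem_iff_lt_rowLen.2 (Nat.pos_of_ne_zero hne))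
  rw [delta, alternant]
  simp only [one_mul] at h
  rw [← h]
  congr 1
  ext1 i j
  simp only [Matrix.projVandermonde_apply, Matrix.of_apply, one_pow, one_mul, shifted, h0,
    zero_add, Fin.val_rev]
  congr 1
  omega

theorem rename_delta {n : ℕ} (σ : Equiv.Perm (Fin n)) :
    rename σ (delta (X : Fin n → MvPolynomial (Fin n) ℤ)) =
      (Equiv.Perm.sign σ : ℤ) • delta (X : Fin n → MvPolynomial (Fin n) ℤ) := by
  rw [delta_eq_alternant, rename_alternant]

theorem schurPoly_isSymmetric (n : ℕ) (μ : YoungDiagram) : (schurPoly n μ).IsSymmetric := by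
  intro σ
  by_cases h : μ.colLen 0 ≤ n
  · have h1 := congrArg (rename σ) (delta_mul_schurPoly h)
    rw [map_mul, rename_delta, rename_alternant, ← delta_mul_schurPoly h, smul_mul_assoc] at h1
    have h2 : ((Equiv.Perm.sign σ : ℤ)) ≠ 0 := by simp
    exact mul_left_cancel₀ delta_ne_zero (smul_right_injective _ h2 h1)
  · simp [schurPoly, h]

theorem coeff_alternant {n : ℕ} {e : Fin n → ℕ} (he : StrictAnti e) {d : Fin n →₀ ℕ}
    (hd : StrictAnti d) : coeff d (alternant e) = if (d : Fin n → ℕ) = e then 1 else 0 := by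
  have hm : ∀ σ : Equiv.Perm (Fin n),
      ∏ i, (X (σ i) : MvPolynomial (Fin n) ℤ) ^ e i =
        monomial (Finsupp.equivFunOnFinite.symm fun i => e (σ.symm i)) 1 := by
    intro σ
    rw [monomial_eq, Finsupp.prod_fintype _ _ (by simp), C_1, one_mul]
    refine Fintype.prod_equiv σ _ _ fun i => ?_
    simp
  rw [alternant, Matrix.det_apply', coeff_sum]
  have hz : ∀ σ : Equiv.Perm (Fin n), σ ≠ 1 →
      (Finsupp.equivFunOnFinite.symm fun i => e (σ.symm i)) ≠ d := by
    rintro σ hσ rfl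
    apply hσ
    have h1 : StrictMono σ.symm := by
      intro i j hij
      have : e (σ.symm j) < e (σ.symm i) := hd hij
      exact he.lt_iff_gt.1 this
    have h2 : (h1.orderIsoOfSurjective _ σ.symm.surjective) = OrderIso.refl _ :=
      Subsingleton.elim _ _
    ext1 i
    have h3 := congrArg (fun f => f (σ i)) h2
    simp at h3
    simpa using h3.symm
  rw [Finset.sum_eq_single 1]
  · simp only [Matrix.of_apply, hm]
    simp only [Equiv.Perm.sign_one, Units.val_one, Int.cast_one, one_mul, coeff_monomial]
    have h4 : (Finsupp.equivFunOnFinite.symm fun i => e ((1 : Equiv.Perm (Fin n)).symm i)) = d ↔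
        (d : Fin n → ℕ) = e := by
      rw [Equiv.symm_apply_eq]
      constructor
      · intro h; exact h.symm
      · intro h; exact h.symm
    simp only [h4]
  · intro σ _ hσ
    simp only [Matrix.of_apply, hm]
    rw [← map_intCast (C : ℤ →+* MvPolynomial (Fin n) ℤ), coeff_C_mul, coeff_monomial,
      if_neg (hz σ hσ), mul_zero]
  · simp

theorem eq_zero_of_antisymmetric {n : ℕ} {g : MvPolynomial (Fin n) ℤ}
    (hg : ∀ σ : Equiv.Perm (Fin n), rename σ g = (Equiv.Perm.sign σ : ℤ) • g)
    (h0 : ∀ d : Fin n →₀ ℕ, StrictAnti d → coeff d g = 0) : g = 0 := by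
  have hc : ∀ (σ : Equiv.Perm (Fin n)) (d : Fin n →₀ ℕ),
      coeff d g = (Equiv.Perm.sign σ : ℤ) * coeff (d.mapDomain σ) g := by
    intro σ d
    rw [← coeff_rename_mapDomain σ σ.injective g d, hg, coeff_smul, smul_eq_mul]
  have hmap : ∀ (σ : Equiv.Perm (Fin n)) (d : Fin n →₀ ℕ) (i : Fin n),
      d.mapDomain σ i = d (σ.symm i) := by
    intro σ d i
    rw [Finsupp.mapDomain_equiv_apply]
  ext d
  rw [coeff_zero]
  by_cases hd : Function.Injective d
  · have hs := Tuple.monotone_sort (fun i => OrderDual.toDual (d i))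
    set τ := Tuple.sort (fun i => OrderDual.toDual (d i)) with hτ
    rw [hc τ.symm d, h0, mul_zero]
    have ha : Antitone (d.mapDomain τ.symm) := by
      intro i j hij
      rw [hmap, hmap]
      exact hs hij
    refine ha.strictAnti_of_injective fun i j hij => ?_
    rw [hmap, hmap] at hij
    simpa using hd hij
  · simp only [Function.Injective, not_forall] at hd
    obtain ⟨i, j, hij, hne⟩ := hd
    have h1 := hc (Equiv.swap i j) d
    have h2 : d.mapDomain (Equiv.swap i j) = d := by
      ext k
      rw [hmap, Equiv.symm_swap]
      by_cases hki : k = i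
      · rw [hki, Equiv.swap_apply_left, hij]
      · by_cases hkj : k = j
        · rw [hkj, Equiv.swap_apply_right, hij]
        · rw [Equiv.swap_apply_of_ne_of_ne hki hkj]
    rw [h2, Equiv.Perm.sign_swap hne] at h1
    simp at h1
    omega

theorem shifted_strictAnti (n : ℕ) (μ : YoungDiagram) : StrictAnti (shifted n μ) := by
  intro i j hij
  have h1 : (i : ℕ) < j := hij
  have h2 := μ.rowLen_anti i j h1.le
  have h3 := j.2
  simp only [shifted]
  omega

theorem shifted_injective {n : ℕ} {μ ν : YoungDiagram} (hμ : μ.colLen 0 ≤ n)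
    (hν : ν.colLen 0 ≤ n) (h : shifted n μ = shifted n ν) : μ = ν := by
  refine diagram_ext fun i => ?_
  by_cases hi : i < n
  · have := congrFun h ⟨i, hi⟩
    simp only [shifted] at this
    omega
  · rw [rowLen_eq_zero_of_colLen_le hμ (by omega), rowLen_eq_zero_of_colLen_le hν (by omega)]

theorem exists_shifted_eq {n : ℕ} {d : Fin n → ℕ} (hd : StrictAnti d) :
    ∃ μ : YoungDiagram, μ.colLen 0 ≤ n ∧ shifted n μ = d := by
  have key : ∀ i j : Fin n, i ≤ j → d j + (j - i : ℕ) ≤ d i := by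
    rintro ⟨i, hi⟩ ⟨j, hj⟩ hij
    simp only [Fin.mk_le_mk] at hij
    induction j, hij using Nat.le_induction with
    | base => simp
    | succ k hk ih =>
      have h1 := ih (by omega)
      have h2 : d ⟨k + 1, hj⟩ < d ⟨k, by omega⟩ := hd (by simp)
      simp only at h1 ⊢
      omega
  have hf : Antitone fun i : Fin n => d i - (n - 1 - i) := by
    intro i j hij
    have h1 := key i j hij
    have h2 : (i : ℕ) ≤ j := hij
    have h3 := j.2
    dsimp only
    omega
  refine ⟨ofAntitone _ hf, ?_, ?_⟩
  · by_contra hlt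
    have h1 := YoungDiagram.mem_iff_lt_rowLen.1 (YoungDiagram.mem_iff_lt_colLen.2 (not_le.1 hlt))
    simp [rowLen_ofAntitone] at h1
  · funext i
    have hi := i.2
    have h1 := key i ⟨n - 1, by omega⟩ (by rw [Fin.le_def]; simp only; omega)
    simp only [shifted, rowLen_ofAntitone, hi, dif_pos, Fin.eta]
    dsimp only at h1
    omega

/-- Every symmetric polynomial in `n` variables has exactly one expansion into Schur
polynomials. -/
theorem existsUnique_schurExpansion {n : ℕ} {f : MvPolynomial (Fin n) ℤ} (hf : f.IsSymmetric) :
    ∃! c : YoungDiagram →₀ ℤ, IsSchurExpansion f c := by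
  classical
  set g := delta X * f with hg
  have hcoeff : ∀ c : YoungDiagram →₀ ℤ, IsSchurExpansion f c → ∀ μ : YoungDiagram,
      μ.colLen 0 ≤ n → c μ = coeff (Finsupp.equivFunOnFinite.symm (shifted n μ)) g := by
    intro c hc μ hμ
    rw [hg, hc.2, Finsupp.sum, Finset.mul_sum, coeff_sum]
    rw [Finset.sum_congr rfl (g := fun ν => if ν = μ then c ν else 0)]
    · rw [Finset.sum_ite_eq']
      split_ifs with h
      · rfl
      · simpa using h
    · intro ν hν
      rw [mul_smul_comm, delta_mul_schurPoly (hc.1 ν hν), coeff_smul,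
        coeff_alternant (shifted_strictAnti n ν) (by simpa using shifted_strictAnti n μ)]
      by_cases h : ν = μ
      · simp [h]
      · have : shifted n μ ≠ shifted n ν := fun h' => h (shifted_injective (hc.1 ν hν) hμ h'.symm)
        simp [h, this]
  refine existsUnique_of_exists_of_unique ?_ ?_
  · choose! D hD1 hD2 using fun d : Fin n → ℕ => exists_shifted_eq (d := d)
    set A := g.support.filter (fun d : Fin n →₀ ℕ => StrictAnti d) with hA
    have hAs : ∀ d ∈ A, StrictAnti (d : Fin n → ℕ) := fun d hd => (Finset.mem_filter.1 hd).2
    have hzero : g - A.sum (fun d => coeff d g • alternant (d : Fin n → ℕ)) = 0 := by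
      apply eq_zero_of_antisymmetric
      · intro σ
        rw [map_sub, map_sum, hg, map_mul, rename_delta, hf σ, smul_sub, smul_mul_assoc,
          Finset.smul_sum]
        congr 1
        refine Finset.sum_congr rfl fun d _ => ?_
        rw [map_zsmul, rename_alternant, smul_comm]
      · intro d hd
        rw [coeff_sub, coeff_sum,
          Finset.sum_congr rfl (g := fun d' => if d = d' then coeff d' g else 0)]
        · rw [Finset.sum_ite_eq]
          split_ifs with h
          · simp
          · have : coeff d g = 0 := by
              by_contra hne
              exact h (Finset.mem_filter.2 ⟨mem_support_iff.2 hne, hd⟩)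
            simp [this]
        · intro d' hd'
          rw [coeff_smul, coeff_alternant (hAs d' hd') hd]
          simp [DFunLike.coe_fn_eq]
    refine ⟨A.sum fun d => Finsupp.single (D d) (coeff d g), ?_, ?_⟩
    · intro μ hμ
      have h1 := Finsupp.support_finsetSum hμ
      simp only [Finset.mem_biUnion] at h1
      obtain ⟨d, hd, hμd⟩ := h1
      have h2 := Finsupp.support_single_subset hμd
      rw [Finset.mem_singleton] at h2
      rw [h2]
      exact hD1 d (hAs d hd)
    · rw [← Finsupp.sum_finsetSum_index (by simp) (by intros; rw [add_smul])]
      apply mul_left_cancel₀ (delta_ne_zero (n := n))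
      rw [← hg, Finset.mul_sum]
      refine (sub_eq_zero.1 hzero).trans ?_
      refine Finset.sum_congr rfl fun d hd => ?_
      rw [Finsupp.sum_single_index (by simp), mul_smul_comm, delta_mul_schurPoly (hD1 d (hAs d hd)),
        hD2 d (hAs d hd)]
  · intro c c' hc hc'
    ext μ
    by_cases hμ : μ.colLen 0 ≤ n
    · rw [hcoeff c hc μ hμ, hcoeff c' hc' μ hμ]
    · rw [Finsupp.notMem_support_iff.1 fun h => hμ (hc.1 μ h),
        Finsupp.notMem_support_iff.1 fun h => hμ (hc'.1 μ h)]

/-! ### Littlewood-Richardson coefficients and Littlewood-Schur functions -/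

/-- The Littlewood-Richardson coefficient `c^κ_{μν}`: the coefficient of `s_κ` in the expansion of
`s_μ s_ν` into Schur functions.  As every `s_κ` in the expansion has degree `|μ| + |ν|`, it
suffices to consider `|μ| + |ν|` variables: no Schur function of that degree vanishes there. -/
noncomputable def littlewoodRichardson (κ μ ν : YoungDiagram) : ℤ :=
  (existsUnique_schurExpansion ((schurPoly_isSymmetric (μ.card + ν.card) μ).mul
    (schurPoly_isSymmetric (μ.card + ν.card) ν))).choose κ

theorem finite_pairs (k : ℕ) :
    {x : YoungDiagram × YoungDiagram | x.1.card + x.2.card = k}.Finite := by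
  have hle : ∀ μ : YoungDiagram, μ.card ≤ k → μ ≤ rect k k := by
    intro μ hμ
    rw [← YoungDiagram.cells_subset_iff]
    rintro ⟨i, j⟩ hij
    have hij' : (i, j) ∈ μ := hij
    have h1 : (Finset.range (i + 1) ×ˢ Finset.range (j + 1)) ⊆ μ.cells := by
      rintro ⟨a, b⟩ hab
      simp only [Finset.mem_product, Finset.mem_range] at hab
      exact μ.up_left_mem (by omega) (by omega) hij'
    have h2 := Finset.card_le_card h1
    rw [Finset.card_product, Finset.card_range, Finset.card_range] at h2
    have h3 : μ.cells.card ≤ k := hμ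
    have h4 : i < k := by nlinarith
    have h5 : j < k := by nlinarith
    change (i, j) ∈ rect k k
    rw [YoungDiagram.mem_iff_lt_rowLen, rect, rowLen_ofAntitone]
    simp [h4, h5]
  refine Set.Finite.subset ((finite_Iic (rect k k)).prod (finite_Iic (rect k k))) ?_
  rintro ⟨μ, ν⟩ h
  change μ.card + ν.card = k at h
  exact ⟨hle μ (by omega), hle ν (by omega)⟩

/-- The Littlewood-Schur function `LS_κ(X; Y) = ∑_{μ, ν} c^κ_{μν} s_μ(X) s_{ν'}(Y)`.  The sum is
over all pairs of partitions with `|μ| + |ν| = |κ|`; for other pairs `c^κ_{μν} = 0`, as Schur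
functions are homogeneous. -/
noncomputable def littlewoodSchur {R : Type*} [CommRing R] {n m : ℕ} (κ : YoungDiagram)
    (X : Fin n → R) (Y : Fin m → R) : R :=
  ∑ x ∈ (finite_pairs κ.card).toFinset,
    (littlewoodRichardson κ x.1 x.2 : R) * schur x.1 X * schur x.2.transpose Y

end LSOverlap

open LSOverlap

namespace LSOverlap

open Finset MvPolynomial

/-! ### Jacobi-Trudi determinants -/

/-! The plan is to expand the left side as a sum over assignments of nodes to rows, to sort the
assignments by the rows that receive a node from `S`, and to recognise each group as a product of
two expansions of the same kind.

A Littlewood-Schur function equals the Jacobi-Trudi determinant built on the coefficients of `∏ (1 +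
y t) / ∏ (1 - z t)` (`littlewoodSchur_eq_jacobiTrudi`). Its Littlewood-Richardson sum is what a
product of two generating functions produces (`jacobiTrudi_mul`), and the two factors give `s_μ(Z)`
and `s_{ν'}(Y)` by the two classical Jacobi-Trudi formulas. When the `z_k` are distinct, partial
fractions write each entry as a sum over the nodes `z_k` of a power of `z_k` times a residue,
provided that the powers are non-negative. Multilinearity in the rows then gives
`littlewoodSchur_eq_sum`: a sum over maps `f` from rows to nodes of `∏ z_{f(i)}^{a_i}` times a
weight that does not depend on the partition. For `κ'` with `m + n` rows and the `m + n + n'` nodes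
`-(S ∪ T)`, the exponents are `a_i = α_i - (q - n')` with `α = κ' + ρ`; the hypothesis `(m + n, q -
n') ∈ κ` makes them non-negative.

Only injective `f` contribute. Fix the set `B` of rows sent to `S`, with `m - p` elements. The
weight of `f` is the product of the weights of its two restrictions, up to the sign of the shuffle
and cross factors between `S`, `T` and `Y`. An interpolation identity, which writes a product of
differences `t - s` as a sum over splittings of `Y` into `U` and `V` (`sum_powersetCard_prod_sub`),
turns the cross factors into the coefficients of the theorem (`nodeWeight_append`). The sums over
the two restrictions are now independent, and each is a Littlewood-Schur function, with exponents
taken from `α` on `B` and on its complement.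

The sets `B` correspond to the pairs `(λ, K)`. The shifted parts of a conjugate partition and the
numbers `n + i - μ_i` partition an interval, so choosing a subset of `α` amounts to enlarging the
complementary set of `κ` to that of some `λ`, and `K` records the old elements
(`sum_subpartitionPairs`). The sign is the number of crossings of `B`
(`sum_complement_eq_crossings`).

All this needs `S ∪ T` to have distinct entries. After multiplication by `Δ(T; S)` both sides are
polynomial in `S` and `T`, so the identity for independent indeterminates specialises to the general
case. -/

/-- The determinant `det (c_{e_i - (N - 1 - j)})`, where `c` vanishes at negative integers. -/
def jacobiTrudi {R : Type*} [CommRing R] {N : ℕ} (c : ℕ → R) (e : Fin N → ℕ) : R :=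
  (Matrix.of fun i j : Fin N => if N - 1 - j ≤ e i then c (e i - (N - 1 - j)) else 0).det

theorem jacobiTrudi_congr {R : Type*} [CommRing R] {N : ℕ} {c c' : ℕ → R} {e : Fin N → ℕ}
    (h : ∀ i, ∀ k ≤ e i, c k = c' k) : jacobiTrudi c e = jacobiTrudi c' e := by
  unfold jacobiTrudi
  congr 1
  ext i j
  simp only [Matrix.of_apply]
  split_ifs
  · exact h i _ (Nat.sub_le _ _)
  · rfl

theorem jacobiTrudi_perm {R : Type*} [CommRing R] {N : ℕ} (c : ℕ → R) (e : Fin N → ℕ)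
    (σ : Equiv.Perm (Fin N)) :
    jacobiTrudi c (e ∘ σ) = (Equiv.Perm.sign σ : ℤ) * jacobiTrudi c e := by
  unfold jacobiTrudi
  rw [← Matrix.det_permute]
  rfl

theorem jacobiTrudi_eq_zero {R : Type*} [CommRing R] {N : ℕ} (c : ℕ → R) {e : Fin N → ℕ}
    (he : ¬ Function.Injective e) : jacobiTrudi c e = 0 := by
  simp only [Function.Injective, not_forall] at he
  obtain ⟨i, j, hij, hne⟩ := he
  refine Matrix.det_zero_of_row_eq hne ?_
  ext k
  simp [hij]

/-- An additional zero part contributes the last row `(0, …, 0, 1)`, because `c` is `1` at zero and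
vanishes at negative integers. -/
theorem jacobiTrudi_shifted_succ {R : Type*} [CommRing R] {N : ℕ} {c : ℕ → R} (hc : c 0 = 1)
    {μ : YoungDiagram} (hμ : μ.colLen 0 ≤ N) :
    jacobiTrudi c (shifted (N + 1) μ) = jacobiTrudi c (shifted N μ) := by
  have h0 : μ.rowLen N = 0 := rowLen_eq_zero_of_colLen_le hμ le_rfl
  unfold jacobiTrudi
  rw [Matrix.det_succ_row _ (Fin.last N), Finset.sum_eq_single (Fin.last N)]
  · have h1 : (Matrix.of fun i j : Fin (N + 1) =>
        if N + 1 - 1 - j ≤ shifted (N + 1) μ i then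
          c (shifted (N + 1) μ i - (N + 1 - 1 - j)) else 0) (Fin.last N) (Fin.last N) = 1 := by
      simp [shifted, h0, hc]
    rw [h1, ← two_mul, pow_mul, neg_one_sq, one_pow, one_mul, one_mul]
    congr 1
    ext i j
    have hi := i.2
    have hj := j.2
    simp only [Matrix.submatrix_apply, Fin.succAbove_last, Matrix.of_apply, Fin.val_castSucc,
      shifted]
    refine if_congr ?_ (congrArg c ?_) rfl <;> omega
  · intro j _ hj
    have hj' : (j : ℕ) < N := by
      have := Fin.val_ne_of_ne hj
      have h2 := j.2
      simp at this
      omega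
    rw [Matrix.of_apply, if_neg]
    · simp
    · simp [shifted, h0]
      omega
  · simp

theorem jacobiTrudi_shifted_eq {R : Type*} [CommRing R] {c : ℕ → R} (hc : c 0 = 1)
    {μ : YoungDiagram} {N M : ℕ} (hN : μ.colLen 0 ≤ N) (hM : μ.colLen 0 ≤ M) :
    jacobiTrudi c (shifted N μ) = jacobiTrudi c (shifted M μ) := by
  have key : ∀ k, μ.colLen 0 ≤ k →
      jacobiTrudi c (shifted k μ) = jacobiTrudi c (shifted (μ.colLen 0) μ) := by
    intro k hk
    induction k, hk using Nat.le_induction with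
    | base => rfl
    | succ k hk ih => rw [jacobiTrudi_shifted_succ hc hk, ih]
  rw [key N hN, key M hM]

/-- Sorting the entries reduces every injective vector to a strictly decreasing one. There the
coefficients of alternants are Kronecker deltas, so expansions into alternants can be checked on
such exponents alone. -/
theorem alternating_ext {R : Type*} [CommRing R] {N : ℕ} {φ ψ : (Fin N → ℕ) → R}
    (hφ : ∀ d (σ : Equiv.Perm (Fin N)), φ (d ∘ σ) = (Equiv.Perm.sign σ : ℤ) * φ d)
    (hψ : ∀ d (σ : Equiv.Perm (Fin N)), ψ (d ∘ σ) = (Equiv.Perm.sign σ : ℤ) * ψ d)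
    (hφ0 : ∀ d, ¬ Function.Injective d → φ d = 0) (hψ0 : ∀ d, ¬ Function.Injective d → ψ d = 0)
    (h : ∀ d, StrictAnti d → φ d = ψ d) (d : Fin N → ℕ) : φ d = ψ d := by
  by_cases hd : Function.Injective d
  · have hs := Tuple.monotone_sort (fun i => OrderDual.toDual (d i))
    set τ := Tuple.sort (fun i => OrderDual.toDual (d i)) with hτ
    have ha : StrictAnti (d ∘ τ) := by
      refine Antitone.strictAnti_of_injective (fun i j hij => hs hij) (hd.comp τ.injective)
    have hd' : d = (d ∘ τ) ∘ τ.symm := by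
      ext i; simp
    rw [hd', hφ, hψ, h _ ha]
  · rw [hφ0 d hd, hψ0 d hd]

theorem coeff_prod_aeval_X {R : Type*} [CommRing R] {N : ℕ} (f : Fin N → Polynomial R)
    (d : Fin N →₀ ℕ) :
    coeff d (∏ i, Polynomial.aeval (X i : MvPolynomial (Fin N) R) (f i)) =
      ∏ i, (f i).coeff (d i) := by
  classical
  -- A common bound on all degrees and on all `d i`: every factor is expanded over the same range,
  -- and `d` itself is one of the resulting index vectors.
  set D := (univ.sup fun i => (f i).natDegree + d i) + 1 with hD
  have hlt : ∀ i, (f i).natDegree + d i < D := fun i =>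
    Nat.lt_succ_of_le (Finset.le_sup (f := fun i => (f i).natDegree + d i) (mem_univ i))
  have h1 : ∀ i, Polynomial.aeval (X i : MvPolynomial (Fin N) R) (f i) =
      ∑ k ∈ range D, C ((f i).coeff k) * X i ^ k := by
    intro i
    rw [Polynomial.aeval_eq_sum_range' (lt_of_le_of_lt (Nat.le_add_right _ _) (hlt i))]
    simp [smul_eq_C_mul]
  simp only [h1]
  rw [Finset.prod_univ_sum, coeff_sum, Finset.sum_eq_single (d : Fin N → ℕ)]
  · rw [Finset.prod_mul_distrib, ← map_prod, coeff_C_mul]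
    have : (∏ i, X i ^ d i : MvPolynomial (Fin N) R) = monomial d 1 := by
      rw [monomial_eq, Finsupp.prod_fintype _ _ (by simp), C_1, one_mul]
    rw [this, coeff_monomial, if_pos rfl, mul_one]
  · intro k _ hk
    rw [Finset.prod_mul_distrib, ← map_prod, coeff_C_mul]
    have : (∏ i, X i ^ k i : MvPolynomial (Fin N) R) =
        monomial (Finsupp.equivFunOnFinite.symm k) 1 := by
      rw [monomial_eq, Finsupp.prod_fintype _ _ (by simp), C_1, one_mul]
      rfl
    rw [this, coeff_monomial, if_neg, mul_zero]
    rintro rfl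
    exact hk rfl
  · intro h
    exfalso
    apply h
    rw [Fintype.mem_piFinset]
    intro i
    have := hlt i
    rw [mem_range]
    omega

/-- Row `i` involves the variable `x_i` only, so the coefficient of a monomial is extracted row by
row. -/
theorem coeff_det_aeval_X {R : Type*} [CommRing R] {N : ℕ} (f : Fin N → Polynomial R)
    (d : Fin N →₀ ℕ) :
    coeff d (Matrix.of fun i j => Polynomial.aeval (X i : MvPolynomial (Fin N) R) (f j)).det =
      (Matrix.of fun i j => (f j).coeff (d i)).det := by
  rw [← Matrix.det_transpose, Matrix.det_apply', ← Matrix.det_transpose (Matrix.of _),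
    Matrix.det_apply', coeff_sum]
  refine Finset.sum_congr rfl fun σ _ => ?_
  rw [← map_intCast (C : R →+* MvPolynomial (Fin N) R), coeff_C_mul]
  congr 1
  exact coeff_prod_aeval_X (fun i => f (σ i)) d

end LSOverlap

namespace LSOverlap

open Finset MvPolynomial

/-! ### Littlewood-Richardson coefficients and products of generating functions -/

/-- The component of `p * f` in degree `r + i` is `p` times the component of `f` in degree `i`, and
`p` can be cancelled in a domain. -/
theorem isHomogeneous_of_mul_left {σ R : Type*} [CommRing R] [IsDomain R]
    {p f : MvPolynomial σ R} {r k : ℕ} (hp : p.IsHomogeneous r) (hp0 : p ≠ 0)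
    (h : (p * f).IsHomogeneous (r + k)) : f.IsHomogeneous k := by
  have key : ∀ i, homogeneousComponent (r + i) (p * f) = p * homogeneousComponent i f := by
    intro i
    conv_lhs => rw [← sum_homogeneousComponent f, Finset.mul_sum, map_sum]
    have h1 : ∀ j, homogeneousComponent (r + i) (p * homogeneousComponent j f) =
        if j = i then p * homogeneousComponent i f else 0 := by
      intro j
      rw [homogeneousComponent_of_mem (hp.mul (homogeneousComponent_isHomogeneous j f))]
      by_cases hj : j = i
      · simp [hj]
      · rw [if_neg (by omega), if_neg hj]
    simp only [h1, Finset.sum_ite_eq', mem_range]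
    split_ifs with hi
    · rfl
    · rw [homogeneousComponent_eq_zero _ _ (by omega), mul_zero]
  have h2 : ∀ i, i ≠ k → homogeneousComponent i f = 0 := by
    intro i hi
    have h3 := key i
    rw [homogeneousComponent_of_mem h, if_neg (by omega)] at h3
    exact (mul_eq_zero.1 h3.symm).resolve_left hp0
  rw [← sum_homogeneousComponent f]
  refine IsHomogeneous.sum _ _ _ fun i _ => ?_
  by_cases hi : i = k
  · rw [← hi]; exact homogeneousComponent_isHomogeneous i f
  · rw [h2 i hi]; exact isHomogeneous_zero _ _ _

theorem isHomogeneous_alternant {n : ℕ} (e : Fin n → ℕ) :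
    (alternant e).IsHomogeneous (∑ i, e i) := by
  rw [alternant, Matrix.det_apply']
  refine IsHomogeneous.sum _ _ _ fun σ _ => ?_
  rw [← map_intCast (C : ℤ →+* MvPolynomial (Fin n) ℤ)]
  refine IsHomogeneous.C_mul ?_ _
  exact IsHomogeneous.prod _ _ _ fun i _ => isHomogeneous_X_pow _ _

theorem card_eq_sum_rowLen {μ : YoungDiagram} {N : ℕ} (h : μ.colLen 0 ≤ N) :
    μ.card = ∑ i : Fin N, μ.rowLen i := by
  classical
  rw [Fin.sum_univ_eq_sum_range (fun i => μ.rowLen i), YoungDiagram.card,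
    Finset.card_eq_sum_card_fiberwise (f := Prod.fst) (t := range N)]
  · refine Finset.sum_congr rfl fun i _ => ?_
    rw [YoungDiagram.rowLen_eq_card, YoungDiagram.row]
  · rintro ⟨i, j⟩ hij
    have h1 : (i, 0) ∈ μ := μ.up_left_mem le_rfl (Nat.zero_le j) hij
    have h2 := YoungDiagram.mem_iff_lt_colLen.1 h1
    simp
    omega

theorem sum_shifted {μ : YoungDiagram} {N : ℕ} (h : μ.colLen 0 ≤ N) :
    ∑ i, shifted N μ i = μ.card + ∑ i : Fin N, (N - 1 - i) := by
  simp only [shifted, Finset.sum_add_distrib, card_eq_sum_rowLen h]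

theorem colLen_bot_le (n : ℕ) : (⊥ : YoungDiagram).colLen 0 ≤ n := by
  by_contra h
  exact YoungDiagram.notMem_bot _ (YoungDiagram.mem_iff_lt_colLen.2 (not_le.1 h))

theorem isHomogeneous_delta {n : ℕ} :
    (delta (X : Fin n → MvPolynomial (Fin n) ℤ)).IsHomogeneous (∑ i : Fin n, (n - 1 - i)) := by
  rw [delta_eq_alternant]
  have := isHomogeneous_alternant (shifted n ⊥)
  rw [sum_shifted (colLen_bot_le n)] at this
  simpa [YoungDiagram.card] using this

theorem isHomogeneous_schurPoly (n : ℕ) (μ : YoungDiagram) :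
    (schurPoly n μ).IsHomogeneous μ.card := by
  by_cases h : μ.colLen 0 ≤ n
  · refine isHomogeneous_of_mul_left isHomogeneous_delta delta_ne_zero ?_
    rw [delta_mul_schurPoly h]
    have := isHomogeneous_alternant (shifted n μ)
    rwa [sum_shifted h, add_comm] at this
  · rw [schurPoly, if_neg h]
    exact isHomogeneous_zero _ _ _

theorem colLen_le_card (μ : YoungDiagram) : μ.colLen 0 ≤ μ.card := by
  rw [YoungDiagram.colLen_eq_card]
  exact Finset.card_le_card (Finset.filter_subset _ _)

/-- Multiplication by `Δ` turns a Schur expansion into an expansion into alternants, and the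
exponent `κ + ρ` occurs only in the alternant of `κ`. The number of variables is the one used in the
definition of the coefficient. -/
theorem coeff_delta_mul_mul_schurPoly {κ μ ν : YoungDiagram} {N : ℕ}
    (hN : μ.card + ν.card = N) (hκ : κ.colLen 0 ≤ N) :
    coeff (Finsupp.equivFunOnFinite.symm (shifted N κ))
      (delta X * (schurPoly N μ * schurPoly N ν)) = littlewoodRichardson κ μ ν := by
  classical
  subst hN
  have hc := (existsUnique_schurExpansion ((schurPoly_isSymmetric (μ.card + ν.card) μ).mul
    (schurPoly_isSymmetric (μ.card + ν.card) ν))).choose_spec.1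
  rw [littlewoodRichardson]
  set c := (existsUnique_schurExpansion ((schurPoly_isSymmetric (μ.card + ν.card) μ).mul
    (schurPoly_isSymmetric (μ.card + ν.card) ν))).choose
  rw [hc.2, Finsupp.sum, Finset.mul_sum, coeff_sum,
    Finset.sum_congr rfl (g := fun η => if η = κ then c η else 0)]
  · rw [Finset.sum_ite_eq']
    split_ifs with h
    · rfl
    · simpa using Eq.symm (Finsupp.notMem_support_iff.1 h)
  · intro η hη
    rw [mul_smul_comm, delta_mul_schurPoly (hc.1 η hη), coeff_smul,
      coeff_alternant (shifted_strictAnti _ η) (by simpa using shifted_strictAnti _ κ)]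
    by_cases h : η = κ
    · simp [h]
    · have : shifted (μ.card + ν.card) κ ≠ shifted _ η :=
        fun h' => h (shifted_injective (hc.1 η hη) hκ h'.symm)
      simp [h, this]

/-- The product is homogeneous of degree `|ρ| + |μ| + |ν|`, whereas the monomial has degree `|ρ| +
|κ|`. -/
theorem coeff_delta_mul_mul_schurPoly_eq_zero {κ μ ν : YoungDiagram} {N : ℕ}
    (hN : μ.card + ν.card ≠ κ.card) (hκ : κ.colLen 0 ≤ N) :
    coeff (Finsupp.equivFunOnFinite.symm (shifted N κ))
      (delta X * (schurPoly N μ * schurPoly N ν)) = 0 := by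
  refine ((isHomogeneous_delta (n := N)).mul
    ((isHomogeneous_schurPoly N μ).mul (isHomogeneous_schurPoly N ν))).coeff_eq_zero ?_
  rw [Finsupp.degree_eq_sum]
  have := sum_shifted hκ
  simp only [Finsupp.equivFunOnFinite_symm_apply_apply, this]
  omega

theorem map_alternant {R : Type*} [CommRing R] {n : ℕ} (e : Fin n → ℕ) :
    MvPolynomial.map (Int.castRingHom R) (alternant e) =
      (Matrix.of fun i j : Fin n => (X i : MvPolynomial (Fin n) R) ^ e j).det := by
  rw [alternant, RingHom.map_det]
  congr 1
  ext1 i j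
  simp

theorem coeff_alternant_eq_det {n : ℕ} (e : Fin n → ℕ) (d : Fin n →₀ ℕ) :
    coeff d (alternant e) = (Matrix.of fun i j => if d i = e j then (1 : ℤ) else 0).det := by
  have h := coeff_det_aeval_X (R := ℤ) (fun j => Polynomial.X ^ e j) d
  simp only [map_pow, Polynomial.aeval_X, Polynomial.coeff_X_pow] at h
  exact h

theorem map_delta_mul_prod {R : Type*} [CommRing R] {N : ℕ} (g : Polynomial R) :
    MvPolynomial.map (Int.castRingHom R) (delta (X : Fin N → MvPolynomial (Fin N) ℤ)) *
        ∏ i, Polynomial.aeval (X i) g =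
      (Matrix.of fun i j : Fin N =>
        Polynomial.aeval (X i : MvPolynomial (Fin N) R) (Polynomial.X ^ (N - 1 - j : ℕ) * g)).det := by
  have h0 : shifted N ⊥ = fun j : Fin N => N - 1 - (j : ℕ) := by
    ext j
    have : (⊥ : YoungDiagram).rowLen j = 0 :=
      rowLen_eq_zero_of_colLen_le (colLen_bot_le 0) (Nat.zero_le _)
    simp [shifted, this]
  rw [delta_eq_alternant, map_alternant, mul_comm, ← Matrix.det_mul_column, h0]
  congr 1
  ext1 i j
  simp [mul_comm]

theorem coeff_map_delta_mul_prod {R : Type*} [CommRing R] {N : ℕ} (g : Polynomial R)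
    (d : Fin N →₀ ℕ) :
    coeff d (MvPolynomial.map (Int.castRingHom R) (delta (X : Fin N → MvPolynomial (Fin N) ℤ)) *
        ∏ i, Polynomial.aeval (X i) g) = jacobiTrudi g.coeff d := by
  rw [map_delta_mul_prod, coeff_det_aeval_X, jacobiTrudi]
  simp only [Polynomial.coeff_X_pow_mul']

theorem mem_subdiagrams_rect {μ : YoungDiagram} {a b : ℕ} :
    μ ∈ subdiagrams (rect a b) ↔ μ.colLen 0 ≤ b ∧ μ.rowLen 0 ≤ a := by
  rw [mem_subdiagrams]
  have hr : ∀ i j, (i, j) ∈ rect a b ↔ i < b ∧ j < a := by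
    intro i j
    rw [YoungDiagram.mem_iff_lt_rowLen, rect, rowLen_ofAntitone]
    by_cases h : i < b <;> simp [h]
  constructor
  · intro h
    constructor
    · by_contra hlt
      have h1 := h (YoungDiagram.mem_iff_lt_colLen.2 (not_le.1 hlt))
      exact absurd ((hr _ _).1 h1).1 (lt_irrefl _)
    · by_contra hlt
      have h1 := h (YoungDiagram.mem_iff_lt_rowLen.2 (not_le.1 hlt))
      exact absurd ((hr _ _).1 h1).2 (lt_irrefl _)
  · rintro ⟨h1, h2⟩ ⟨i, j⟩ hij
    change (i, j) ∈ μ at hij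
    have h3 := YoungDiagram.mem_iff_lt_colLen.1 (μ.up_left_mem le_rfl (Nat.zero_le j) hij)
    have h4 := YoungDiagram.mem_iff_lt_rowLen.1 (μ.up_left_mem (Nat.zero_le i) le_rfl hij)
    exact (hr i j).2 ⟨by omega, by omega⟩

/-- A Cauchy identity: both sides have alternating coefficients, and at a strictly decreasing
exponent `ν + ρ` only the summand of `ν` survives on the right. -/
theorem map_delta_mul_prod_eq_sum {R : Type*} [CommRing R] {N D : ℕ} {g : Polynomial R}
    (hg : g.natDegree ≤ D) :
    MvPolynomial.map (Int.castRingHom R) (delta (X : Fin N → MvPolynomial (Fin N) ℤ)) *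
        ∏ i, Polynomial.aeval (X i) g =
      ∑ μ ∈ subdiagrams (rect D N), C (jacobiTrudi g.coeff (shifted N μ)) *
        MvPolynomial.map (Int.castRingHom R) (alternant (shifted N μ)) := by
  ext d
  rw [coeff_map_delta_mul_prod, coeff_sum]
  simp only [coeff_C_mul, coeff_map, coeff_alternant_eq_det]
  refine alternating_ext (φ := fun d => jacobiTrudi g.coeff d) (ψ := fun d =>
      ∑ μ ∈ subdiagrams (rect D N), jacobiTrudi g.coeff (shifted N μ) * Int.castRingHom R
        (Matrix.of fun i j => if d i = shifted N μ j then (1 : ℤ) else 0).det)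
    (jacobiTrudi_perm _) ?_ (fun d hd => jacobiTrudi_eq_zero _ hd) ?_ ?_ d
  · intro d σ
    rw [Finset.mul_sum]
    refine Finset.sum_congr rfl fun μ _ => ?_
    have := Matrix.det_permute σ
      (Matrix.of fun i j => if d i = shifted N μ j then (1 : ℤ) else 0)
    have h2 : (Matrix.of fun i j => if d i = shifted N μ j then (1 : ℤ) else 0).submatrix σ id =
      Matrix.of fun i j => if (d ∘ σ) i = shifted N μ j then (1 : ℤ) else 0 := rfl
    rw [h2] at this
    rw [this]
    push_cast
    simp
    ring
  · intro d hd
    simp only [Function.Injective, not_forall] at hd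
    obtain ⟨i, j, hij, hne⟩ := hd
    refine Finset.sum_eq_zero fun μ _ => ?_
    rw [Matrix.det_zero_of_row_eq hne]
    · simp
    · ext k
      simp [hij]
  · intro e he
    obtain ⟨ν, hν, rfl⟩ := exists_shifted_eq he
    have h1 : ∀ μ, (Matrix.of fun i j => if shifted N ν i = shifted N μ j then (1 : ℤ) else 0).det =
        if shifted N ν = shifted N μ then 1 else 0 := by
      intro μ
      have := coeff_alternant (shifted_strictAnti N μ)
        (d := Finsupp.equivFunOnFinite.symm (shifted N ν)) (by simpa using shifted_strictAnti N ν)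
      rw [coeff_alternant_eq_det] at this
      convert this <;> rfl
    simp only [h1]
    by_cases hm : ν ∈ subdiagrams (rect D N)
    · rw [Finset.sum_eq_single ν]
      · simp
      · intro μ hμ hne
        rw [if_neg]
        · simp
        · intro h
          exact hne (shifted_injective (mem_subdiagrams_rect.1 hμ).1 hν h.symm)
      · exact fun h => absurd hm h
    -- If `ν` leaves the rectangle then `ν_1 > D`, and all entries of the first Jacobi-Trudi row lie
    -- beyond the degree of `g`.
    · rw [Finset.sum_eq_zero]
      · have h2 : D < ν.rowLen 0 := by
          by_contra hlt
          exact hm (mem_subdiagrams_rect.2 ⟨hν, not_lt.1 hlt⟩)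
        have hN : 0 < N := by
          by_contra hN
          rw [rowLen_eq_zero_of_colLen_le hν (by omega)] at h2
          omega
        refine Matrix.det_eq_zero_of_row_eq_zero ⟨0, hN⟩ fun j => ?_
        rw [Matrix.of_apply, ite_eq_right_iff]
        intro _
        refine Polynomial.coeff_eq_zero_of_natDegree_lt ?_
        simp only [shifted]
        omega
      · intro μ hμ
        rw [if_neg]
        · simp
        · intro h
          rw [shifted_injective hν (mem_subdiagrams_rect.1 hμ).1 h] at hm
          exact hm hμ

/-- Expand `Δ ∏ g(x_i)` and `Δ ∏ h(x_i)` into alternants, multiply, cancel one factor `Δ`, and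
compare the coefficients of `x^{κ + ρ}` with those of `Δ ∏ (g h)(x_i)`. With `|κ|` variables, the
products `s_μ s_ν` of the right degree are expanded in exactly the number of variables in which the
Littlewood-Richardson coefficients are defined. -/
theorem jacobiTrudi_mul {R : Type*} [CommRing R] [IsDomain R] (κ : YoungDiagram)
    (g h : Polynomial R) :
    jacobiTrudi (g * h).coeff (shifted κ.card κ) =
      ∑ x ∈ (finite_pairs κ.card).toFinset, (littlewoodRichardson κ x.1 x.2 : R) *
        jacobiTrudi g.coeff (shifted κ.card x.1) * jacobiTrudi h.coeff (shifted κ.card x.2) := by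
  classical
  set N := κ.card with hN
  -- At least both degrees, as the Cauchy identity requires, and at least `N`, so that every
  -- partition of size at most `N` fits into the rectangle.
  set D := max N (max g.natDegree h.natDegree) with hD
  set φ : MvPolynomial (Fin N) ℤ →+* MvPolynomial (Fin N) R :=
    MvPolynomial.map (Int.castRingHom R) with hφ
  have hκ : κ.colLen 0 ≤ N := colLen_le_card κ
  have hg := map_delta_mul_prod_eq_sum (N := N) (D := D) (g := g) (by omega)
  have hh := map_delta_mul_prod_eq_sum (N := N) (D := D) (g := h) (by omega)
  -- The coefficient of `x^ρ` in `Δ` is `1`, so `Δ` stays non-zero in every characteristic.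
  have hd0 : φ (delta X) ≠ 0 := by
    rw [hφ, delta_eq_alternant]
    intro h0
    have h1 := congrArg (coeff (Finsupp.equivFunOnFinite.symm (shifted N ⊥))) h0
    rw [coeff_map, coeff_alternant (shifted_strictAnti N ⊥)
      (by simpa using shifted_strictAnti N ⊥)] at h1
    simp at h1
  have hexp : φ (delta X) * ∏ i, Polynomial.aeval (X i) (g * h) =
      ∑ μ ∈ subdiagrams (rect D N), ∑ ν ∈ subdiagrams (rect D N),
        C (jacobiTrudi g.coeff (shifted N μ) * jacobiTrudi h.coeff (shifted N ν)) *
          φ (delta X * (schurPoly N μ * schurPoly N ν)) := by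
    apply mul_left_cancel₀ hd0
    have h1 : φ (delta X) * (φ (delta X) *
        ∏ i, Polynomial.aeval (X i : MvPolynomial (Fin N) R) (g * h)) =
      (φ (delta X) * ∏ i, Polynomial.aeval (X i) g) *
        (φ (delta X) * ∏ i, Polynomial.aeval (X i) h) := by
      simp only [map_mul, Finset.prod_mul_distrib]
      ring
    rw [h1, hg, hh, Finset.sum_mul_sum, Finset.mul_sum]
    refine Finset.sum_congr rfl fun μ hμ => ?_
    rw [Finset.mul_sum]
    refine Finset.sum_congr rfl fun ν hν => ?_
    rw [← delta_mul_schurPoly (mem_subdiagrams_rect.1 hμ).1,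
      ← delta_mul_schurPoly (mem_subdiagrams_rect.1 hν).1]
    simp only [map_mul, hφ]
    ring
  have hco := congrArg (coeff (Finsupp.equivFunOnFinite.symm (shifted N κ))) hexp
  rw [hφ, coeff_map_delta_mul_prod, coeff_sum] at hco
  simp only [coeff_sum, coeff_C_mul, coeff_map] at hco
  rw [← Finset.sum_product'] at hco
  refine hco.trans ?_
  symm
  -- The rectangle contains further pairs with `|μ| + |ν| ≠ |κ|`; homogeneity removes them.
  refine Finset.sum_subset_zero_on_sdiff ?_ ?_ ?_
  · rintro ⟨μ, ν⟩ hx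
    rw [Set.Finite.mem_toFinset] at hx
    change μ.card + ν.card = N at hx
    rw [Finset.mem_product]
    have key : ∀ η : YoungDiagram, η.card ≤ N → η ∈ subdiagrams (rect D N) := by
      intro η hη
      have h1 := colLen_le_card η
      have h2 := colLen_le_card η.transpose
      rw [YoungDiagram.colLen_transpose] at h2
      have h3 : η.transpose.card = η.card := by
        simp [YoungDiagram.card, YoungDiagram.transpose]
      exact mem_subdiagrams_rect.2 ⟨by omega, by omega⟩
    exact ⟨key μ (by omega), key ν (by omega)⟩
  · rintro ⟨μ, ν⟩ hx
    have h1 : μ.card + ν.card ≠ N := by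
      intro h1
      exact (Finset.mem_sdiff.1 hx).2 ((Set.Finite.mem_toFinset _).2 h1)
    rw [coeff_delta_mul_mul_schurPoly_eq_zero h1 hκ]
    simp
  · rintro ⟨μ, ν⟩ hx
    rw [Set.Finite.mem_toFinset] at hx
    change μ.card + ν.card = N at hx
    rw [coeff_delta_mul_mul_schurPoly hx hκ]
    simp
    ring

end LSOverlap

namespace LSOverlap

open Finset MvPolynomial

/-! ### Residues and Jacobi-Trudi determinants -/

theorem natDegree_X_add_C_le {R : Type*} [CommRing R] (r : R) :
    (Polynomial.X + Polynomial.C r).natDegree ≤ 1 := by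
  compute_degree

theorem reflect_prod_X_add_C {R ι : Type*} [CommRing R] (s : Finset ι) (y : ι → R) :
    Polynomial.reflect s.card (∏ i ∈ s, (Polynomial.X + Polynomial.C (y i))) =
      ∏ i ∈ s, (1 + Polynomial.C (y i) * Polynomial.X) := by
  classical
  induction s using Finset.induction_on with
  | empty => simp
  | insert a s ha ih =>
    rw [Finset.prod_insert ha, Finset.prod_insert ha, Finset.card_insert_of_notMem ha, ← ih,
      add_comm s.card, Polynomial.reflect_mul]
    · congr 1
      rw [Polynomial.reflect_add, Polynomial.reflect_C, pow_one, Polynomial.reflect_one_X]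
    · exact natDegree_X_add_C_le _
    · refine (Polynomial.natDegree_prod_le _ _).trans ?_
      refine (Finset.sum_le_card_nsmul _ _ 1 fun i _ => natDegree_X_add_C_le _).trans ?_
      simp

theorem coeff_prod_one_add {R ι : Type*} [CommRing R] (s : Finset ι) (y : ι → R) {k : ℕ}
    (hk : k ≤ s.card) :
    (∏ i ∈ s, (1 + Polynomial.C (y i) * Polynomial.X)).coeff k =
      (∏ i ∈ s, (Polynomial.X + Polynomial.C (y i))).coeff (s.card - k) := by
  rw [← reflect_prod_X_add_C, Polynomial.coeff_reflect, Polynomial.revAt_le hk]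

/-- The power series `∏ (1 + y t) / ∏ (1 - z t)`. -/
noncomputable def superSeries {K : Type*} [Field K] {M q : ℕ} (Z : Fin M → K) (Y : Fin q → K) :
    PowerSeries K :=
  ((∏ i, (1 + Polynomial.C (Y i) * Polynomial.X) : Polynomial K) : PowerSeries K) *
    ((∏ i, (1 + Polynomial.C (-Z i) * Polynomial.X) : Polynomial K) : PowerSeries K)⁻¹

theorem constantCoeff_prod_one_add {R ι : Type*} [CommRing R] (s : Finset ι) (y : ι → R) :
    PowerSeries.constantCoeff
      ((∏ i ∈ s, (1 + Polynomial.C (y i) * Polynomial.X) : Polynomial R) : PowerSeries R) = 1 := by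
  rw [← PowerSeries.coeff_zero_eq_constantCoeff_apply, Polynomial.coeff_coe,
    Polynomial.coeff_zero_eq_eval_zero, Polynomial.eval_prod]
  simp

/-- Partial fractions: with `w_k` the nodal weights, `∑ w_k / (1 - z_k t) = t^(M-1) / ∏ (1 - z_k
t)`, and the left side is the generating function of the sums in question. For `M = 0` both sides
vanish. -/
theorem sum_pow_mul_nodalWeight {K : Type*} [Field K] {M : ℕ} {Z : Fin M → K}
    (hZ : Function.Injective Z) (r : ℕ) :
    ∑ k, Z k ^ r * Lagrange.nodalWeight univ Z k = PowerSeries.coeff (r + 1) (PowerSeries.X ^ M *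
      ((∏ i, (1 + Polynomial.C (-Z i) * Polynomial.X) : Polynomial K) : PowerSeries K)⁻¹) := by
  classical
  rcases Nat.eq_zero_or_pos M with rfl | hM
  · simp [PowerSeries.coeff_one]
  set E : Polynomial K := ∏ i, (1 + Polynomial.C (-Z i) * Polynomial.X) with hE
  set S : PowerSeries K := PowerSeries.mk fun r => ∑ k, Z k ^ r * Lagrange.nodalWeight univ Z k
    with hS
  have hE0 : PowerSeries.constantCoeff (E : PowerSeries K) ≠ 0 := by
    rw [hE, constantCoeff_prod_one_add]; exact one_ne_zero
  have hgeom : ∀ z : K, PowerSeries.mk (fun r => z ^ r) *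
      ((1 + Polynomial.C (-z) * Polynomial.X : Polynomial K) : PowerSeries K) = 1 := by
    intro z
    ext n
    push_cast
    rw [mul_add, mul_one, mul_left_comm]
    cases n with
    | zero => simp
    | succ n =>
      rw [map_add, PowerSeries.coeff_C_mul, PowerSeries.coeff_succ_mul_X]
      simp [PowerSeries.coeff_one, pow_succ]
      ring
  -- The Lagrange basis polynomials of the nodes sum to `1`.
  have hone : ∑ k, Polynomial.C (Lagrange.nodalWeight univ Z k) *
      ∏ j ∈ univ.erase k, (Polynomial.X + Polynomial.C (-Z j)) = 1 := by
    have hne : (univ : Finset (Fin M)).Nonempty := ⟨⟨0, hM⟩, mem_univ _⟩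
    rw [← Lagrange.sum_basis (hZ.injOn) hne]
    refine Finset.sum_congr rfl fun k _ => ?_
    rw [Lagrange.basis]
    simp only [Lagrange.basisDivisor, Finset.prod_mul_distrib, Lagrange.nodalWeight, map_prod,
      map_neg, sub_eq_add_neg]
  -- Reversing the previous identity in degree `M - 1` sends each `t - z_j` to `1 - z_j t` and the
  -- constant `1` to `t^(M-1)`.
  have hrev : ∑ k, Polynomial.C (Lagrange.nodalWeight univ Z k) *
      ∏ j ∈ univ.erase k, (1 + Polynomial.C (-Z j) * Polynomial.X) =
        (Polynomial.X : Polynomial K) ^ (M - 1) := by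
    have h1 : ∀ k : Fin M, ∏ j ∈ univ.erase k, (1 + Polynomial.C (-Z j) * Polynomial.X) =
        Polynomial.reflect (M - 1)
          (∏ j ∈ univ.erase k, (Polynomial.X + Polynomial.C (-Z j))) := by
      intro k
      have := reflect_prod_X_add_C (univ.erase k) (fun j => -Z j)
      rw [Finset.card_erase_of_mem (mem_univ k), Finset.card_univ, Fintype.card_fin] at this
      exact this.symm
    simp only [h1, ← Polynomial.reflect_C_mul]
    have h2 : ∀ (s : Finset (Fin M)) (f : Fin M → Polynomial K),
        ∑ k ∈ s, Polynomial.reflect (M - 1) (f k) = Polynomial.reflect (M - 1) (∑ k ∈ s, f k) := by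
      intro s f
      ext n
      simp [Polynomial.coeff_reflect]
    rw [h2, hone, ← Polynomial.C_1, Polynomial.reflect_C]
    simp
  have hSE : S * (E : PowerSeries K) = PowerSeries.X ^ (M - 1) := by
    have h3 : S = ∑ k, PowerSeries.C (Lagrange.nodalWeight univ Z k) *
        PowerSeries.mk (fun r => Z k ^ r) := by
      ext n
      simp [hS, mul_comm]
    have h4 : ∀ k, PowerSeries.C (Lagrange.nodalWeight univ Z k) *
        PowerSeries.mk (fun r => Z k ^ r) * (E : PowerSeries K) =
        ((Polynomial.C (Lagrange.nodalWeight univ Z k) *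
          ∏ j ∈ univ.erase k, (1 + Polynomial.C (-Z j) * Polynomial.X) : Polynomial K) :
            PowerSeries K) := by
      intro k
      rw [hE, ← Finset.mul_prod_erase _ _ (mem_univ k), Polynomial.coe_mul, mul_assoc,
        ← mul_assoc (PowerSeries.mk _), hgeom, one_mul, Polynomial.coe_mul, Polynomial.coe_C]
    have h5 := congrArg (fun p : Polynomial K => (p : PowerSeries K)) hrev
    rw [h3, Finset.sum_mul, Finset.sum_congr rfl fun k _ => h4 k]
    rw [Polynomial.coe_pow, Polynomial.coe_X] at h5
    rw [← h5]
    exact (map_sum (Polynomial.coeToPowerSeries.ringHom (R := K)) _ _).symm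
  have hS' : PowerSeries.X ^ M * (E : PowerSeries K)⁻¹ = PowerSeries.X * S := by
    rw [eq_comm, PowerSeries.eq_mul_inv_iff_mul_eq hE0, mul_assoc, hSE, ← pow_succ']
    congr 1
    omega
  rw [hS', PowerSeries.coeff_succ_X_mul, hS, PowerSeries.coeff_mk]

/-- The left side is the sum of the residues of `z^r ∏ (z + y) / ∏ (z - z_k)` at its finite poles;
the right side is read off from the expansion at infinity. Algebraically, `∏ (z + y)` is expanded in
powers of `z`, and its coefficients are those of `∏ (1 + y t)` in reverse order. -/
theorem sum_residue {K : Type*} [Field K] {M q : ℕ} {Z : Fin M → K}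
    (hZ : Function.Injective Z) (Y : Fin q → K) (r : ℕ) :
    ∑ k, Z k ^ r * ((∏ j, (Z k + Y j)) * Lagrange.nodalWeight univ Z k) =
      PowerSeries.coeff (r + q + 1) (PowerSeries.X ^ M * superSeries Z Y) := by
  set P : Polynomial K := ∏ i, (Polynomial.X + Polynomial.C (Y i)) with hP
  set E : Polynomial K := ∏ i, (1 + Polynomial.C (Y i) * Polynomial.X) with hE
  have hPd : P.natDegree < q + 1 := by
    refine Nat.lt_succ_of_le ((Polynomial.natDegree_prod_le _ _).trans ?_)
    refine (Finset.sum_le_card_nsmul _ _ 1 fun i _ => natDegree_X_add_C_le _).trans ?_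
    simp
  have hEd : E.natDegree < q + 1 := by
    refine Nat.lt_succ_of_le ((Polynomial.natDegree_prod_le _ _).trans ?_)
    refine (Finset.sum_le_card_nsmul _ _ 1 fun i _ => ?_).trans (by simp)
    compute_degree
  have h1 : ∀ k, ∏ j, (Z k + Y j) = ∑ i ∈ range (q + 1), P.coeff i * Z k ^ i := by
    intro k
    rw [← Polynomial.eval_eq_sum_range' hPd, hP, Polynomial.eval_prod]
    simp
  have h2 : ∀ i ∈ range (q + 1), E.coeff i = P.coeff (q - i) := by
    intro i hi
    have := coeff_prod_one_add (univ : Finset (Fin q)) Y (k := i)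
      (by rw [Finset.card_univ, Fintype.card_fin]; exact Nat.lt_succ_iff.1 (mem_range.1 hi))
    rwa [Finset.card_univ, Fintype.card_fin] at this
  set A := PowerSeries.X ^ M *
      ((∏ i, (1 + Polynomial.C (-Z i) * Polynomial.X) : Polynomial K) : PowerSeries K)⁻¹ with hA
  have h3 : PowerSeries.X ^ M * superSeries Z Y = (E : PowerSeries K) * A := by
    rw [superSeries, hA, mul_left_comm]
  have h4 : (E : PowerSeries K) =
      ∑ i ∈ range (q + 1), PowerSeries.C (E.coeff i) * PowerSeries.X ^ i := by
    conv_lhs => rw [E.as_sum_range_C_mul_X_pow' hEd]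
    rw [← Polynomial.coeToPowerSeries.ringHom_apply, map_sum]
    simp
  rw [h3, h4, Finset.sum_mul, map_sum, ← Finset.sum_range_reflect]
  simp only [h1, Finset.sum_mul, Finset.mul_sum]
  rw [Finset.sum_comm]
  refine Finset.sum_congr rfl fun i hi => ?_
  have hi' := mem_range.1 hi
  rw [mul_assoc, PowerSeries.coeff_C_mul, PowerSeries.coeff_X_pow_mul', if_pos (by omega),
    h2 _ (mem_range.2 (by omega)), show q - (q + 1 - 1 - i) = i by omega,
    show r + q + 1 - (q + 1 - 1 - i) = r + i + 1 by omega, hA, ← sum_pow_mul_nodalWeight hZ,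
    Finset.mul_sum]
  refine Finset.sum_congr rfl fun k _ => ?_
  rw [pow_add]
  ring

/-- The relation between `a` and `e` matches the Jacobi-Trudi index with the index in the residue
formula. Since `a i` is a natural number, it also says that all powers of the nodes are
non-negative, without which the formula would fail. -/
theorem jacobiTrudi_entry {K : Type*} [Field K] {M q N : ℕ} {Z : Fin M → K}
    (hZ : Function.Injective Z) (Y : Fin q → K) {a e : Fin N → ℕ}
    (h : ∀ i, a i + N + q = e i + M) (i j : Fin N) :
    (if N - 1 - j ≤ e i then PowerSeries.coeff (e i - (N - 1 - j)) (superSeries Z Y) else 0) =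
      ∑ k, Z k ^ a i * ((∏ j, (Z k + Y j)) * Lagrange.nodalWeight univ Z k) * Z k ^ (j : ℕ) := by
  have h1 := sum_residue hZ Y (a i + j)
  have hi := h i
  have hj := j.2
  rw [PowerSeries.coeff_X_pow_mul'] at h1
  have h2 : (if N - 1 - j ≤ e i then PowerSeries.coeff (e i - (N - 1 - j)) (superSeries Z Y)
      else 0) = if M ≤ a i + j + q + 1 then
        PowerSeries.coeff (a i + j + q + 1 - M) (superSeries Z Y) else 0 := by
    refine if_congr (by omega) ?_ rfl
    rw [show e i - (N - 1 - j) = a i + j + q + 1 - M by omega]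
  rw [h2, ← h1]
  refine Finset.sum_congr rfl fun k _ => ?_
  rw [pow_add]
  ring

/-- `∏_{i < j} (x_j - x_i)`. -/
def vand {R : Type*} [CommRing R] {N : ℕ} (x : Fin N → R) : R :=
  ∏ i, ∏ j ∈ Ioi i, (x j - x i)

/-- The weight of a choice `f` of nodes in the expansion of a Littlewood-Schur function. -/
noncomputable def nodeWeight {K : Type*} [Field K] {M q N : ℕ} (Z : Fin M → K) (Y : Fin q → K)
    (f : Fin N → Fin M) : K :=
  (∏ i, ((∏ j, (Z (f i) + Y j)) * Lagrange.nodalWeight univ Z (f i))) * vand (Z ∘ f)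

/-- Each row is a sum over nodes of multiples of the geometric rows `(1, z, z², …)`. Multilinearity
yields one Vandermonde determinant for each choice of a node per row. -/
theorem jacobiTrudi_superSeries {K : Type*} [Field K] {M q N : ℕ} {Z : Fin M → K}
    (hZ : Function.Injective Z) (Y : Fin q → K) {a e : Fin N → ℕ}
    (h : ∀ i, a i + N + q = e i + M) :
    jacobiTrudi (fun k => PowerSeries.coeff k (superSeries Z Y)) e =
      ∑ f : Fin N → Fin M, (∏ i, Z (f i) ^ a i) * nodeWeight Z Y f := by
  classical
  unfold jacobiTrudi
  simp only [jacobiTrudi_entry hZ Y h]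
  have h1 := (Matrix.detRowAlternating (R := K) (n := Fin N)).toMultilinearMap.map_sum
    (fun (i : Fin N) (k : Fin M) => fun j : Fin N =>
      Z k ^ a i * ((∏ j, (Z k + Y j)) * Lagrange.nodalWeight univ Z k) * Z k ^ (j : ℕ))
  refine Eq.trans ?_ (h1.trans ?_)
  · change Matrix.det _ = Matrix.det _
    congr 1
    ext i j
    simp
  · refine Finset.sum_congr rfl fun f _ => ?_
    refine (Matrix.det_mul_column _ (Matrix.vandermonde (Z ∘ f))).trans ?_
    rw [Finset.prod_mul_distrib, mul_assoc, nodeWeight, Matrix.det_vandermonde, vand]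

end LSOverlap

namespace LSOverlap

open Finset MvPolynomial

/-! ### Schur functions as Jacobi-Trudi determinants -/

theorem map_delta {R S : Type*} [CommRing R] [CommRing S] (φ : R →+* S) {n : ℕ} (X : Fin n → R) :
    φ (delta X) = delta fun i => φ (X i) := by
  simp [delta, map_prod]

theorem delta_mul_schur {R : Type*} [CommRing R] {n : ℕ} {μ : YoungDiagram} (h : μ.colLen 0 ≤ n)
    (Z : Fin n → R) :
    delta Z * schur μ Z = (Matrix.of fun i j => Z i ^ shifted n μ j).det := by
  have h1 := congrArg (aeval Z : MvPolynomial (Fin n) ℤ →ₐ[ℤ] R) (delta_mul_schurPoly h)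
  rw [map_mul] at h1
  have h2 : (aeval Z : MvPolynomial (Fin n) ℤ →ₐ[ℤ] R) (delta X) = delta Z := by
    have := map_delta ((aeval Z : MvPolynomial (Fin n) ℤ →ₐ[ℤ] R) : MvPolynomial (Fin n) ℤ →+* R)
      (X : Fin n → MvPolynomial (Fin n) ℤ)
    simpa using this
  rw [h2] at h1
  rw [schur, h1, alternant, AlgHom.map_det]
  congr 1
  ext1 i j
  simp

theorem delta_ne_zero_iff {K : Type*} [Field K] {n : ℕ} {Z : Fin n → K} :
    delta Z ≠ 0 ↔ Function.Injective Z := by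
  simp only [delta, Finset.prod_ne_zero_iff, mem_univ, true_imp_iff, mem_Ioi, sub_ne_zero]
  constructor
  · intro h i j hij
    by_contra hne
    rcases lt_or_gt_of_ne hne with hlt | hlt
    · exact h i j hlt hij
    · exact h j i hlt hij.symm
  · exact fun h i j hij hZ => hij.ne (h hZ)

theorem prod_nodalWeight {K : Type*} [Field K] {n : ℕ} (Z : Fin n → K) :
    ∏ k, Lagrange.nodalWeight univ Z k = (vand Z * delta Z)⁻¹ := by
  classical
  have h1 : ∀ k : Fin n, univ.erase k = Ioi k ∪ Iio k := by
    intro k; ext j; simp [lt_or_lt_iff_ne, eq_comm]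
  have h2 : ∀ k : Fin n, Disjoint (Ioi k) (Iio k) := by
    intro k
    rw [Finset.disjoint_left]
    intro j hj hj'
    exact lt_asymm (mem_Ioi.1 hj) (mem_Iio.1 hj')
  simp only [Lagrange.nodalWeight, h1, Finset.prod_union (h2 _), Finset.prod_mul_distrib,
    Finset.prod_inv_distrib]
  rw [← mul_inv, mul_comm]
  congr 2
  rw [vand]
  exact Finset.prod_comm' (by simp)

theorem superSeries_of_isEmpty {K : Type*} [Field K] {M : ℕ} (Z : Fin M → K) (Y : Fin 0 → K) :
    superSeries Z Y =
      ((∏ i, (1 + Polynomial.C (-Z i) * Polynomial.X) : Polynomial K) : PowerSeries K)⁻¹ := by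
  simp [superSeries]

theorem constantCoeff_superSeries {K : Type*} [Field K] {M q : ℕ} (Z : Fin M → K) (Y : Fin q → K) :
    PowerSeries.coeff 0 (superSeries Z Y) = 1 := by
  rw [PowerSeries.coeff_zero_eq_constantCoeff_apply, superSeries, map_mul,
    PowerSeries.constantCoeff_inv, constantCoeff_prod_one_add, constantCoeff_prod_one_add]
  simp

theorem natDegree_prod_one_add_le {R ι : Type*} [CommRing R] (s : Finset ι) (y : ι → R) :
    (∏ i ∈ s, (1 + Polynomial.C (y i) * Polynomial.X)).natDegree ≤ s.card := by
  refine (Polynomial.natDegree_prod_le _ _).trans ?_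
  refine (Finset.sum_le_card_nsmul _ _ 1 fun i _ => ?_).trans (by simp)
  compute_degree

/-- If `μ` has at most `n` parts, the residue formula factors the Jacobi-Trudi matrix into the
alternant matrix of `μ` and a weighted Vandermonde matrix. If `μ` is longer, the matrix is singular,
since the series is the inverse of a polynomial of degree at most `n`. -/
theorem jacobiTrudi_eq_schur {K : Type*} [Field K] {n N : ℕ} {Z : Fin n → K}
    (hZ : Function.Injective Z) {μ : YoungDiagram} (hμ : μ.colLen 0 ≤ N) :
    jacobiTrudi (fun k => PowerSeries.coeff k (superSeries Z (Fin.elim0 : Fin 0 → K)))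
      (shifted N μ) = schur μ Z := by
  have h0 := constantCoeff_superSeries Z (Fin.elim0 : Fin 0 → K)
  by_cases hn : μ.colLen 0 ≤ n
  · rw [jacobiTrudi_shifted_eq h0 hμ hn]
    have hd : delta Z ≠ 0 := delta_ne_zero_iff.2 hZ
    have hv : vand Z ≠ 0 := by
      rw [vand, ← Matrix.det_vandermonde]
      exact Matrix.det_vandermonde_ne_zero_iff.2 hZ
    apply mul_left_cancel₀ hd
    rw [delta_mul_schur hn]
    have h1 : jacobiTrudi (fun k => PowerSeries.coeff k (superSeries Z (Fin.elim0 : Fin 0 → K)))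
        (shifted n μ) = ((Matrix.of fun i k => Z k ^ shifted n μ i) *
          (Matrix.of fun k j => Lagrange.nodalWeight univ Z k * Matrix.vandermonde Z k j)).det := by
      unfold jacobiTrudi
      congr 1
      ext1 i j
      rw [Matrix.of_apply, jacobiTrudi_entry hZ (Fin.elim0 : Fin 0 → K) (a := shifted n μ)
        (fun i => rfl) i j, Matrix.mul_apply]
      refine Finset.sum_congr rfl fun k _ => ?_
      simp [Matrix.vandermonde_apply, mul_assoc]
    rw [h1, Matrix.det_mul, Matrix.det_mul_column, prod_nodalWeight, Matrix.det_vandermonde,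
      ← Matrix.det_transpose (Matrix.of _)]
    change delta Z * (_ * (_ * vand Z)) = _
    field_simp
    rfl
  · rw [jacobiTrudi_shifted_eq h0 hμ le_rfl, schur, schurPoly, if_neg hn, map_zero]
    push Not at hn
    set N := μ.colLen 0 with hN
    set E : Polynomial K := ∏ i, (1 + Polynomial.C (-Z i) * Polynomial.X) with hE
    have hEd : E.natDegree < N := by
      refine lt_of_le_of_lt ?_ hn
      have := natDegree_prod_one_add_le univ (fun i => -Z i)
      rwa [Finset.card_univ, Fintype.card_fin] at this
    rw [superSeries_of_isEmpty, ← hE]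
    have hE0 : PowerSeries.constantCoeff (E : PowerSeries K) ≠ 0 := by
      rw [hE, constantCoeff_prod_one_add]; exact one_ne_zero
    have hE1 : E.coeff 0 = 1 := by
      have := constantCoeff_prod_one_add univ (fun i => -Z i)
      rwa [← hE, ← PowerSeries.coeff_zero_eq_constantCoeff_apply, Polynomial.coeff_coe] at this
    have hEs : (E : PowerSeries K) =
        ∑ j : Fin N, PowerSeries.C (E.coeff (N - 1 - j)) * PowerSeries.X ^ (N - 1 - j : ℕ) := by
      conv_lhs => rw [E.as_sum_range_C_mul_X_pow' hEd]
      rw [← Polynomial.coeToPowerSeries.ringHom_apply, map_sum, ← Finset.sum_range_reflect,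
        ← Fin.sum_univ_eq_sum_range]
      simp
    -- The reversed coefficients of `E` form a kernel vector: row `i` computes the coefficient of `E
    -- * E⁻¹ = 1` in degree `μ_i + N - 1 - i`, which is positive because all `N` parts of `μ` are.
    -- The last entry of the vector is `E_0 = 1`.
    refine Matrix.exists_mulVec_eq_zero_iff.1 ⟨fun j : Fin N => E.coeff (N - 1 - j), ?_, ?_⟩
    · intro h
      have := congrFun h ⟨N - 1, by omega⟩
      simp [hE1] at this
    · ext i
      simp only [Matrix.mulVec, dotProduct, Matrix.of_apply, Pi.zero_apply]
      have hpos : shifted N μ i ≠ 0 := by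
        have h2 : ((i : ℕ), 0) ∈ μ := YoungDiagram.mem_iff_lt_colLen.2 i.2
        have h3 := YoungDiagram.mem_iff_lt_rowLen.1 h2
        simp only [shifted]
        omega
      have h4 : PowerSeries.coeff (shifted N μ i) ((E : PowerSeries K) * (E : PowerSeries K)⁻¹) = 0 := by
        rw [PowerSeries.mul_inv_cancel _ hE0, PowerSeries.coeff_one, if_neg hpos]
      refine Eq.trans ?_ h4
      conv_rhs => arg 2; arg 1; rw [hEs]
      rw [Finset.sum_mul, map_sum]
      refine Finset.sum_congr rfl fun j _ => ?_
      rw [mul_assoc, PowerSeries.coeff_C_mul, PowerSeries.coeff_X_pow_mul', mul_comm]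

end LSOverlap

namespace LSOverlap

open Finset MvPolynomial

/-! ### Complementary sequences and the dual Jacobi-Trudi formula -/

/-- The sequence `n + i - μ_i`, indexed from `i = 0`, which lists the elements of
`{0, …, n + N - 1}` that are not shifted parts of the conjugate partition. -/
def coshifted (n N : ℕ) (μ : YoungDiagram) : Fin N → ℕ := fun i => n + i - μ.rowLen i

theorem rowLen_le_of_le {μ : YoungDiagram} {n : ℕ} (h : μ.rowLen 0 ≤ n) (i : ℕ) :
    μ.rowLen i ≤ n :=
  (μ.rowLen_anti 0 i (Nat.zero_le i)).trans h

theorem coshifted_strictMono {n N : ℕ} {μ : YoungDiagram} (h : μ.rowLen 0 ≤ n) :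
    StrictMono (coshifted n N μ) := by
  intro i j hij
  have h1 : (i : ℕ) < j := hij
  have h2 := μ.rowLen_anti i j h1.le
  have h3 := rowLen_le_of_le h i
  simp only [coshifted]
  omega

theorem coshifted_lt {n N : ℕ} {μ : YoungDiagram} (h : μ.rowLen 0 ≤ n) (i : Fin N) :
    coshifted n N μ i < n + N := by
  have := i.2
  simp only [coshifted]
  omega

theorem shifted_transpose_lt {n N : ℕ} {μ : YoungDiagram} (h : μ.colLen 0 ≤ N) (j : Fin n) :
    shifted n μ.transpose j < n + N := by
  have h1 := μ.colLen_anti 0 j (Nat.zero_le _)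
  have := j.2
  simp only [shifted, YoungDiagram.rowLen_transpose]
  omega

theorem shifted_add_coshifted {n N : ℕ} {μ : YoungDiagram} (h : μ.rowLen 0 ≤ n) (i : Fin N) :
    shifted N μ i + coshifted n N μ i = n + N - 1 := by
  have := rowLen_le_of_le h i
  have := i.2
  simp only [shifted, coshifted]
  omega

/-- The difference of the two numbers is `(μ'_j - i) + (μ_i - j) - 1`. Both brackets are positive if
the cell `(i, j)` lies in the diagram, and neither is positive otherwise; hence the difference is
also never zero. -/
theorem coshifted_lt_shifted_iff {n N : ℕ} {μ : YoungDiagram} (h : μ.rowLen 0 ≤ n)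
    (i : Fin N) (j : Fin n) :
    coshifted n N μ i < shifted n μ.transpose j ↔ (j : ℕ) < μ.rowLen i := by
  have h1 := rowLen_le_of_le h i
  have h2 : (j : ℕ) < μ.rowLen i ↔ (i : ℕ) < μ.colLen j := by
    rw [← YoungDiagram.mem_iff_lt_rowLen, YoungDiagram.mem_iff_lt_colLen]
  have := i.2
  have := j.2
  simp only [shifted, coshifted, YoungDiagram.rowLen_transpose]
  omega

theorem coshifted_ne_shifted {n N : ℕ} {μ : YoungDiagram} (h : μ.rowLen 0 ≤ n)
    (i : Fin N) (j : Fin n) : coshifted n N μ i ≠ shifted n μ.transpose j := by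
  have h1 := rowLen_le_of_le h i
  have h2 : (j : ℕ) < μ.rowLen i ↔ (i : ℕ) < μ.colLen j := by
    rw [← YoungDiagram.mem_iff_lt_rowLen, YoungDiagram.mem_iff_lt_colLen]
  have := i.2
  have := j.2
  simp only [shifted, coshifted, YoungDiagram.rowLen_transpose]
  omega

/-- The two complementary sequences attached to a partition, as a bijection. -/
noncomputable def betaEquiv {n N : ℕ} {μ : YoungDiagram} (h : μ.rowLen 0 ≤ n)
    (h' : μ.colLen 0 ≤ N) : Fin n ⊕ Fin N ≃ Fin (n + N) :=
  Equiv.ofBijective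
    (Sum.elim (fun j => ⟨shifted n μ.transpose j, shifted_transpose_lt h' j⟩)
      fun i => ⟨coshifted n N μ i, coshifted_lt h i⟩) (by
    rw [Fintype.bijective_iff_injective_and_card]
    refine ⟨?_, by simp⟩
    rintro (j | i) (j' | i') hij <;>
      simp only [Sum.elim_inl, Sum.elim_inr, Fin.mk.injEq] at hij
    · rw [(shifted_strictAnti n μ.transpose).injective hij]
    · exact absurd hij.symm (coshifted_ne_shifted h i' j)
    · exact absurd hij (coshifted_ne_shifted h i j')
    · rw [(coshifted_strictMono h).injective hij])

theorem betaEquiv_inl {n N : ℕ} {μ : YoungDiagram} (h : μ.rowLen 0 ≤ n)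
    (h' : μ.colLen 0 ≤ N) (j : Fin n) :
    (betaEquiv h h' (Sum.inl j) : ℕ) = shifted n μ.transpose j := rfl

theorem betaEquiv_inr {n N : ℕ} {μ : YoungDiagram} (h : μ.rowLen 0 ≤ n)
    (h' : μ.colLen 0 ≤ N) (i : Fin N) :
    (betaEquiv h h' (Sum.inr i) : ℕ) = coshifted n N μ i := rfl

/-- The values decrease along the first block and increase along the second. Thus no inversion
starts in the second block, and every value smaller than that at a position `j` of the first block
occurs after `j`; the inversions starting at `j` are as many as the value there. -/
theorem sign_betaEquiv {n N : ℕ} {μ : YoungDiagram} (h : μ.rowLen 0 ≤ n) (h' : μ.colLen 0 ≤ N) :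
    Equiv.Perm.sign (finSumFinEquiv.symm.trans (betaEquiv h h')) =
      (-1) ^ ∑ j, shifted n μ.transpose j := by
  classical
  set π := finSumFinEquiv.symm.trans (betaEquiv h h') with hπ
  have hl : ∀ j : Fin n, (π (Fin.castAdd N j) : ℕ) = shifted n μ.transpose j := by
    intro j
    rw [hπ, Equiv.trans_apply, finSumFinEquiv_symm_apply_castAdd, betaEquiv_inl]
  have hr : ∀ i : Fin N, (π (Fin.natAdd n i) : ℕ) = coshifted n N μ i := by
    intro i
    rw [hπ, Equiv.trans_apply, finSumFinEquiv_symm_apply_natAdd, betaEquiv_inr]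
  rw [Equiv.Perm.sign_eq_prod_prod_Ioi, Fin.prod_univ_add, ← Finset.prod_pow_eq_pow_sum]
  have h2 : ∀ i : Fin N, ∏ j ∈ Ioi (Fin.natAdd n i),
      (if π (Fin.natAdd n i) < π j then (1 : ℤˣ) else -1) = 1 := by
    intro i
    refine Finset.prod_eq_one fun x hx => if_pos ?_
    rw [mem_Ioi] at hx
    induction x using Fin.addCases with
    | left j => exact absurd hx (not_lt.2 (by rw [Fin.le_def]; simp; omega))
    | right i' =>
      rw [Fin.lt_def, hr, hr]
      refine coshifted_strictMono h ?_
      rw [Fin.lt_def] at hx ⊢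
      simpa using hx
  rw [Finset.prod_eq_one fun i _ => h2 i, mul_one]
  refine Finset.prod_congr rfl fun j _ => ?_
  rw [Finset.prod_ite, Finset.prod_const_one, one_mul, Finset.prod_const]
  congr 1
  have h3 : (Ioi (Fin.castAdd N j)).filter (fun x => ¬ π (Fin.castAdd N j) < π x) =
      univ.filter (fun x => π x < π (Fin.castAdd N j)) := by
    ext x
    simp only [mem_filter, mem_Ioi, mem_univ, true_and, not_lt]
    constructor
    · rintro ⟨h4, h5⟩
      exact lt_of_le_of_ne h5 fun h6 => h4.ne' (π.injective h6)
    · intro h4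
      refine ⟨?_, h4.le⟩
      induction x using Fin.addCases with
      | left j' =>
        rw [Fin.lt_def, hl, hl] at h4
        have := (shifted_strictAnti n μ.transpose).lt_iff_gt.1 h4
        rw [Fin.lt_def] at this ⊢
        simpa using this
      | right i' => rw [Fin.lt_def]; simp; omega
  rw [h3, ← hl j]
  have h4 : univ.filter (fun x => π x < π (Fin.castAdd N j)) =
      (Iio (π (Fin.castAdd N j))).map π.symm.toEmbedding := by
    ext x
    simp
  rw [h4, Finset.card_map, Fin.card_Iio]

theorem delta_neg_eq_vand {R : Type*} [CommRing R] {n : ℕ} (y : Fin n → R) :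
    vand (fun k => -y k) = delta y := by
  simp only [vand, delta]
  refine Finset.prod_congr rfl fun i _ => Finset.prod_congr rfl fun j _ => by ring

/-- This carries the dual Jacobi-Trudi formula. One square matrix `A`, consisting of evaluations at
the points `-y_k` and of coefficient extractions at the complementary exponents, has its determinant
computed twice: in the monomial basis ordered by `betaEquiv`, and in the basis `1, …, t^(n-1), P, t
P, …` with `P = ∏ (t + y_k)`. -/
theorem vand_neg_mul_det_coeff {R : Type*} [CommRing R] {n N : ℕ} {μ : YoungDiagram}
    (h : μ.rowLen 0 ≤ n) (h' : μ.colLen 0 ≤ N) (y : Fin n → R) :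
    (Matrix.of fun k j => (-y k) ^ shifted n μ.transpose j).det =
      (-1) ^ (∑ j, shifted n μ.transpose j) * ((Matrix.vandermonde fun k => -y k).det *
        (Matrix.of fun i i' : Fin N => (Polynomial.X ^ (i' : ℕ) *
          ∏ k, (Polynomial.X + Polynomial.C (y k))).coeff (coshifted n N μ i)).det) := by
  classical
  nontriviality R
  set P : Polynomial R := ∏ k, (Polynomial.X + Polynomial.C (y k)) with hP
  have hPm : P.Monic := Polynomial.monic_prod_of_monic _ _ fun k _ => Polynomial.monic_X_add_C _
  have hPd : P.natDegree = n := by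
    rw [hP, Polynomial.natDegree_prod_of_monic _ _ fun k _ => Polynomial.monic_X_add_C _]
    simp
  set β := betaEquiv h h' with hβ
  set A : Matrix (Fin n ⊕ Fin N) (Fin (n + N)) R := Matrix.of fun r v =>
    Sum.elim (fun k => (-y k) ^ (v : ℕ)) (fun i => if (v : ℕ) = coshifted n N μ i then 1 else 0) r
    with hA
  set T : Matrix (Fin (n + N)) (Fin n ⊕ Fin N) R := Matrix.of fun v s =>
    Sum.elim (fun j : Fin n => if (v : ℕ) = j then 1 else 0)
      (fun i' : Fin N => (Polynomial.X ^ (i' : ℕ) * P).coeff v) s with hT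
  -- The upper right block is zero because `P` vanishes at every `-y_k`.
  have hAT : A * T = Matrix.fromBlocks (Matrix.vandermonde fun k => -y k) 0
      (Matrix.of fun (i : Fin N) (j : Fin n) => if coshifted n N μ i = j then 1 else 0)
      (Matrix.of fun i i' : Fin N => (Polynomial.X ^ (i' : ℕ) * P).coeff (coshifted n N μ i)) := by
    ext r s
    rw [Matrix.mul_apply]
    rcases r with k | i
    · rcases s with j | i'
      · simp only [hA, hT, Matrix.of_apply, Sum.elim_inl, Matrix.fromBlocks_apply₁₁,
          Matrix.vandermonde_apply]
        rw [Finset.sum_eq_single (Fin.castAdd N j)]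
        · simp
        · intro v _ hv
          rw [if_neg, mul_zero]
          intro h2
          exact hv (Fin.ext h2)
        · simp
      · simp only [hA, hT, Matrix.of_apply, Sum.elim_inl, Sum.elim_inr, Matrix.fromBlocks_apply₁₂,
          Matrix.zero_apply]
        have hd : (Polynomial.X ^ (i' : ℕ) * P).natDegree < n + N := by
          rw [Polynomial.natDegree_mul' (by simp [hPm.leadingCoeff]), hPd, Polynomial.natDegree_X_pow]
          have := i'.2
          omega
        have h2 := Polynomial.eval_eq_sum_range' hd (-y k)
        have h3 := Fin.sum_univ_eq_sum_range
          (fun v => (Polynomial.X ^ (i' : ℕ) * P).coeff v * (-y k) ^ v) (n + N)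
        rw [Finset.sum_congr rfl fun v _ => mul_comm _ _, h3]
        rw [← h2, Polynomial.eval_mul, hP, Polynomial.eval_prod,
          Finset.prod_eq_zero (mem_univ k) (by simp), mul_zero]
    · have hc := coshifted_lt (N := N) h i
      have hs : ∀ s, ∑ v, A (Sum.inr i) v * T v s = T ⟨coshifted n N μ i, hc⟩ s := by
        intro s
        rw [Finset.sum_eq_single ⟨coshifted n N μ i, hc⟩]
        · simp [hA]
        · intro v _ hv
          simp only [hA, Matrix.of_apply, Sum.elim_inr]
          rw [if_neg, zero_mul]
          intro h2
          exact hv (Fin.ext h2)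
        · simp
      rw [hs]
      rcases s with j | i' <;> simp [hT]
  -- In this order of columns the coefficient extractions become the block row `(0, 1)`, which
  -- leaves the alternant.
  have hAβ : A.submatrix id β = Matrix.fromBlocks
      (Matrix.of fun k j => (-y k) ^ shifted n μ.transpose j)
      (Matrix.of fun (k : Fin n) (i : Fin N) => (-y k) ^ coshifted n N μ i) 0 1 := by
    ext r s
    rcases r with k | i <;> rcases s with j | i'
    · simp [hA, hβ, betaEquiv_inl]
    · simp [hA, hβ, betaEquiv_inr]
    · simp only [hA, hβ, Matrix.submatrix_apply, id, Matrix.of_apply, Sum.elim_inr, betaEquiv_inl,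
        Matrix.fromBlocks_apply₂₁, Matrix.zero_apply]
      exact if_neg (coshifted_ne_shifted h i j).symm
    · simp only [hA, hβ, Matrix.submatrix_apply, id, Matrix.of_apply, Sum.elim_inr, betaEquiv_inr,
        Matrix.fromBlocks_apply₂₂, Matrix.one_apply, (coshifted_strictMono h).injective.eq_iff,
        eq_comm]
  have hTε : T.submatrix finSumFinEquiv id = Matrix.fromBlocks 1
      (Matrix.of fun (j : Fin n) (i' : Fin N) => (Polynomial.X ^ (i' : ℕ) * P).coeff j) 0
      (Matrix.of fun i i' : Fin N => (Polynomial.X ^ (i' : ℕ) * P).coeff (n + i)) := by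
    ext r s
    rcases r with k | i <;> rcases s with j | i'
    · simp [hT, Matrix.one_apply, Fin.ext_iff]
    · simp [hT]
    · simp only [hT, Matrix.submatrix_apply, id, Matrix.of_apply, Sum.elim_inl,
        finSumFinEquiv_apply_right, Fin.val_natAdd, Matrix.fromBlocks_apply₂₁, Matrix.zero_apply]
      exact if_neg (by omega)
    · simp [hT]
  -- The change of basis is unitriangular, as `P` is monic of degree `n`.
  have hTdet : (T.submatrix finSumFinEquiv id).det = 1 := by
    rw [hTε, Matrix.det_fromBlocks_zero₂₁, Matrix.det_one, one_mul, Matrix.det_of_isUpperTriangular]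
    · refine Finset.prod_eq_one fun i _ => ?_
      rw [Matrix.of_apply, Polynomial.coeff_X_pow_mul', if_pos (Nat.le_add_left _ _),
        Nat.add_sub_cancel, ← hPd]
      exact hPm
    · intro i i' hi
      have hi' : (i' : ℕ) < i := hi
      rw [Matrix.of_apply, Polynomial.coeff_X_pow_mul', if_pos (by omega)]
      exact Polynomial.coeff_eq_zero_of_natDegree_lt (by omega)
  have h1 : (A * T).det = (A.submatrix id finSumFinEquiv).det := by
    rw [← mul_one (A.submatrix id _).det, ← hTdet, ← Matrix.det_mul,
      Matrix.submatrix_mul_equiv]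
    simp
  have h2 : (A.submatrix id β).det = (-1) ^ (∑ j, shifted n μ.transpose j) *
      (A.submatrix id finSumFinEquiv).det := by
    have h3 : A.submatrix id β = (A.submatrix id finSumFinEquiv).submatrix id
        (β.trans finSumFinEquiv.symm) := by
      ext r s; simp
    have h4 : Equiv.Perm.sign (β.trans finSumFinEquiv.symm) =
        (-1) ^ ∑ j, shifted n μ.transpose j := by
      rw [← sign_betaEquiv h h', ← hβ, ← Equiv.Perm.sign_permCongr finSumFinEquiv]
      congr 1
      ext x
      simp [Equiv.permCongr_apply]
    rw [h3, Matrix.det_permute', h4]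
    push_cast
    simp
  rw [hAβ, Matrix.det_fromBlocks_zero₂₁, Matrix.det_one, mul_one] at h2
  rw [h2, ← h1, hAT, Matrix.det_fromBlocks_zero₁₂]

/-- If `μ_1 ≤ n`, reversing the coefficients of `∏ (t + y)` turns the coefficient determinant of
`vand_neg_mul_det_coeff` into the Jacobi-Trudi determinant; the signs from `-y_k` cancel the sign of
the shuffle. If `μ_1 > n`, the first row is zero, and so is the Schur function. -/
theorem jacobiTrudi_eq_schur_transpose {K : Type*} [Field K] {n N : ℕ} {Y : Fin n → K}
    (hY : Function.Injective Y) {μ : YoungDiagram} (hμ : μ.colLen 0 ≤ N) :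
    jacobiTrudi (∏ i, (1 + Polynomial.C (Y i) * Polynomial.X)).coeff (shifted N μ) =
      schur μ.transpose Y := by
  set E : Polynomial K := ∏ i, (1 + Polynomial.C (Y i) * Polynomial.X) with hE
  have hEd : E.natDegree ≤ n := by
    simpa only [Finset.card_univ, Fintype.card_fin] using natDegree_prod_one_add_le univ Y
  by_cases h : μ.rowLen 0 ≤ n
  · have hd : delta Y ≠ 0 := delta_ne_zero_iff.2 hY
    have hcol : μ.transpose.colLen 0 ≤ n := by rwa [YoungDiagram.colLen_transpose]
    apply mul_left_cancel₀ hd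
    rw [delta_mul_schur hcol]
    have h1 := vand_neg_mul_det_coeff h hμ Y
    have h2 : (Matrix.of fun i i' : Fin N => (Polynomial.X ^ (i' : ℕ) *
          ∏ k, (Polynomial.X + Polynomial.C (Y k))).coeff (coshifted n N μ i)).det =
        jacobiTrudi E.coeff (shifted N μ) := by
      unfold jacobiTrudi
      congr 1
      ext1 i j
      rw [Matrix.of_apply, Matrix.of_apply, Polynomial.coeff_X_pow_mul']
      have h3 := shifted_add_coshifted (N := N) h i
      have hj := j.2
      have hc := coshifted_lt (N := N) h i
      have hcoeff := fun k hk => coeff_prod_one_add (univ : Finset (Fin n)) Y (k := k) hk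
      rw [Finset.card_univ, Fintype.card_fin, ← hE] at hcoeff
      by_cases hjc : (j : ℕ) ≤ coshifted n N μ i
      · rw [if_pos hjc]
        by_cases hj2 : N - 1 - j ≤ shifted N μ i
        · rw [if_pos hj2, hcoeff _ (by omega)]
          congr 1
          omega
        · rw [if_neg hj2]
          refine Polynomial.coeff_eq_zero_of_natDegree_lt (lt_of_le_of_lt (b := n) ?_ (by omega))
          refine (Polynomial.natDegree_prod_le _ _).trans ?_
          refine (Finset.sum_le_card_nsmul _ _ 1 fun i _ => natDegree_X_add_C_le _).trans ?_
          simp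
      · rw [if_neg hjc, if_pos (by omega)]
        symm
        exact Polynomial.coeff_eq_zero_of_natDegree_lt (by omega)
    have h4 : (Matrix.of fun k j => (-Y k) ^ shifted n μ.transpose j).det =
        (-1) ^ (∑ j, shifted n μ.transpose j) *
          (Matrix.of fun k j => Y k ^ shifted n μ.transpose j).det := by
      rw [← Finset.prod_pow_eq_pow_sum, ← Matrix.det_mul_row]
      congr 1
      ext1 k j
      simp only [Matrix.of_apply]
      exact neg_pow _ _
    rw [h2, h4, Matrix.det_vandermonde] at h1
    have h5 := mul_left_cancel₀ (pow_ne_zero _ (neg_ne_zero.2 one_ne_zero)) h1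
    rw [h5, ← delta_neg_eq_vand]
    rfl
  · rw [schur, schurPoly, if_neg (by rwa [YoungDiagram.colLen_transpose]), map_zero]
    have hN : 0 < N := by
      by_contra hN
      rw [rowLen_eq_zero_of_colLen_le hμ (by omega)] at h
      omega
    refine Matrix.det_eq_zero_of_row_eq_zero ⟨0, hN⟩ fun j => ?_
    rw [Matrix.of_apply, ite_eq_right_iff]
    intro _
    refine Polynomial.coeff_eq_zero_of_natDegree_lt ?_
    simp only [shifted]
    omega

/-- The Jacobi-Trudi formula for Littlewood-Schur functions. -/
theorem littlewoodSchur_eq_jacobiTrudi {K : Type*} [Field K] {M q N : ℕ} {Z : Fin M → K}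
    (hZ : Function.Injective Z) {Y : Fin q → K} (hY : Function.Injective Y) {κ : YoungDiagram}
    (hκ : κ.colLen 0 ≤ N) :
    littlewoodSchur κ Z Y =
      jacobiTrudi (fun k => PowerSeries.coeff k (superSeries Z Y)) (shifted N κ) := by
  rw [jacobiTrudi_shifted_eq (constantCoeff_superSeries Z Y) hκ (colLen_le_card κ)]
  -- `jacobiTrudi_mul` concerns polynomials, so the series `1 / ∏ (1 - z t)` is truncated beyond
  -- every index that occurs in any of the determinants.
  set D := (univ.sup fun i => shifted κ.card κ i) + 2 * κ.card + 1 with hD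
  set G := superSeries Z (Fin.elim0 : Fin 0 → K) with hG
  set E : Polynomial K := ∏ i, (1 + Polynomial.C (Y i) * Polynomial.X) with hE
  have h1 : superSeries Z Y = G * (E : PowerSeries K) := by
    rw [hG, superSeries_of_isEmpty, superSeries, mul_comm]
  have h2 : jacobiTrudi (fun k => PowerSeries.coeff k (superSeries Z Y)) (shifted κ.card κ) =
      jacobiTrudi (PowerSeries.trunc D G * E).coeff (shifted κ.card κ) := by
    refine jacobiTrudi_congr fun i k hk => ?_
    have hkD : k < D := by
      have := Finset.le_sup (f := fun i => shifted κ.card κ i) (mem_univ i)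
      omega
    rw [h1, ← Polynomial.coeff_coe, Polynomial.coe_mul, PowerSeries.coeff_mul,
      PowerSeries.coeff_mul]
    refine Finset.sum_congr rfl fun x hx => ?_
    rw [Finset.HasAntidiagonal.mem_antidiagonal] at hx
    rw [Polynomial.coeff_coe (PowerSeries.trunc D G), PowerSeries.coeff_trunc, if_pos (by omega)]
  rw [h2, jacobiTrudi_mul, littlewoodSchur]
  refine Finset.sum_congr rfl fun x hx => ?_
  rw [Set.Finite.mem_toFinset] at hx
  change x.1.card + x.2.card = κ.card at hx
  have hx1 : x.1.colLen 0 ≤ κ.card := (colLen_le_card _).trans (by omega)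
  have hx2 : x.2.colLen 0 ≤ κ.card := (colLen_le_card _).trans (by omega)
  rw [← jacobiTrudi_eq_schur_transpose hY hx2, ← jacobiTrudi_eq_schur hZ hx1]
  congr 2
  refine jacobiTrudi_congr fun i k hk => ?_
  have hle : shifted κ.card x.1 i ≤ 2 * κ.card := by
    have h3 : x.1.rowLen i ≤ x.1.card := by
      rw [YoungDiagram.rowLen_eq_card]
      exact Finset.card_le_card (Finset.filter_subset _ _)
    simp only [shifted]
    omega
  rw [PowerSeries.coeff_trunc, if_pos (by omega)]

/-- Expansion of a Littlewood-Schur function as a sum over the choices of nodes. -/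
theorem littlewoodSchur_eq_sum {K : Type*} [Field K] {M q N : ℕ} {Z : Fin M → K}
    (hZ : Function.Injective Z) {Y : Fin q → K} (hY : Function.Injective Y) {κ : YoungDiagram}
    (hκ : κ.colLen 0 ≤ N) {a : Fin N → ℕ} (ha : ∀ i, a i + N + q = shifted N κ i + M) :
    littlewoodSchur κ Z Y = ∑ f : Fin N → Fin M, (∏ i, Z (f i) ^ a i) * nodeWeight Z Y f := by
  rw [littlewoodSchur_eq_jacobiTrudi hZ hY hκ, jacobiTrudi_superSeries hZ Y ha]

end LSOverlap

namespace LSOverlap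

open Finset MvPolynomial

/-! ### Splitting the weights -/

theorem natDegree_C_mul_prod_C_sub_X_le {K ρ : Type*} [Field K] (A : Finset ρ) (w : ρ → K)
    (c : K) :
    (Polynomial.C c * ∏ v ∈ A, (Polynomial.C (w v) - Polynomial.X)).natDegree ≤ A.card := by
  refine (Polynomial.natDegree_C_mul_le _ _).trans ((Polynomial.natDegree_prod_le _ _).trans ?_)
  refine (Finset.sum_le_card_nsmul _ _ 1 fun i _ => ?_).trans (by simp)
  compute_degree

/-- Induction on `S`. As polynomials in the newly added `s_a`, both sides have degree less than
`|I|` by the cardinality hypothesis, so it is enough to compare them at the `|I|` distinct points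
`y_i`. At such a point the identity reduces to the one for the smaller `S` and `I` without `i`. -/
theorem sum_powersetCard_prod_sub {K ι σ τ : Type*} [Field K] [DecidableEq ι] {y : ι → K}
    (s : σ → K) (t : τ → K) (S : Finset σ) (T : Finset τ) {I : Finset ι} (hy : Set.InjOn y I)
    (h : S.card + T.card ≤ I.card) :
    ∑ U ∈ I.powersetCard S.card,
        (∏ v ∈ I \ U, ∏ i ∈ S, (y v - s i)) * (∏ u ∈ U, ∏ j ∈ T, (t j - y u)) /
          (∏ v ∈ I \ U, ∏ u ∈ U, (y v - y u)) =
      ∏ j ∈ T, ∏ i ∈ S, (t j - s i) := by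
  classical
  induction S using Finset.induction_on generalizing I with
  | empty => simp
  | insert a S ha ih =>
    rw [Finset.card_insert_of_notMem ha] at h ⊢
    -- `L` and `Q` are the two sides with `s_a` replaced by an indeterminate.
    set L : Polynomial K := ∑ U ∈ I.powersetCard (S.card + 1),
      Polynomial.C ((∏ v ∈ I \ U, ∏ i ∈ S, (y v - s i)) * (∏ u ∈ U, ∏ j ∈ T, (t j - y u)) /
          (∏ v ∈ I \ U, ∏ u ∈ U, (y v - y u))) *
        ∏ v ∈ I \ U, (Polynomial.C (y v) - Polynomial.X) with hL
    set Q : Polynomial K := Polynomial.C (∏ j ∈ T, ∏ i ∈ S, (t j - s i)) *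
        ∏ j ∈ T, (Polynomial.C (t j) - Polynomial.X) with hQ
    have hLQ : L = Q := by
      have hlt : ∀ {P : Polynomial K}, P.natDegree ≤ I.card - 1 → P.degree < I.card := by
        intro P hP
        refine lt_of_le_of_lt (Polynomial.degree_le_of_natDegree_le hP) ?_
        exact_mod_cast (by omega : I.card - 1 < I.card)
      refine Polynomial.eq_of_degrees_lt_of_eval_index_eq I hy (hlt ?_) (hlt ?_) ?_
      · refine Polynomial.natDegree_sum_le_of_forall_le _ _ fun U hU => ?_
        have hU' := Finset.mem_powersetCard.1 hU
        refine (natDegree_C_mul_prod_C_sub_X_le _ _ _).trans ?_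
        rw [Finset.card_sdiff_of_subset hU'.1]
        omega
      · exact (natDegree_C_mul_prod_C_sub_X_le _ _ _).trans (by omega)
      · intro i₀ hi₀
        set J := I.erase i₀ with hJ
        have hi₀J : i₀ ∉ J := Finset.notMem_erase _ _
        have hIJ : I = insert i₀ J := (Finset.insert_erase hi₀).symm
        have hcard : J.card + 1 = I.card := Finset.card_erase_add_one hi₀
        have hne : ∀ v ∈ J, y v - y i₀ ≠ 0 := fun v hv =>
          sub_ne_zero.2 fun h' => (Finset.ne_of_mem_erase hv) (hy (Finset.mem_of_mem_erase hv) hi₀ h')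
        rw [hL, hQ, Polynomial.eval_finsetSum]
        simp only [Polynomial.eval_mul, Polynomial.eval_C, Polynomial.eval_prod,
          Polynomial.eval_sub, Polynomial.eval_X]
        -- If `i₀` belongs to the complement of `U`, the factor `y_{i₀} - X` kills the term; only
        -- the sets `U` containing `i₀` survive.
        rw [hIJ, Finset.powersetCard_succ_insert hi₀J, Finset.sum_union, Finset.sum_eq_zero,
          zero_add, Finset.sum_image]
        · rw [← ih (I := J) (hy.mono (by rw [hIJ]; simp)) (by omega), Finset.sum_mul]
          refine Finset.sum_congr rfl fun U hU => ?_
          have hUJ := (Finset.mem_powersetCard.1 hU).1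
          have hiU : i₀ ∉ U := fun h' => hi₀J (hUJ h')
          have hsd : insert i₀ J \ insert i₀ U = J \ U := by
            ext v
            simp only [Finset.mem_sdiff, Finset.mem_insert]
            constructor
            · tauto
            · rintro ⟨h1, h2⟩
              refine ⟨Or.inr h1, ?_⟩
              rintro (rfl | h3)
              · exact hi₀J h1
              · exact h2 h3
          have hprod : ∏ v ∈ J \ U, (y v - y i₀) ≠ 0 :=
            Finset.prod_ne_zero_iff.2 fun v hv => hne v (Finset.mem_sdiff.1 hv).1
          rw [hsd, Finset.prod_insert hiU]
          simp only [Finset.prod_insert hiU, Finset.prod_mul_distrib]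
          field_simp
        · intro U hU U' hU' hUU
          have h1 : i₀ ∉ U := fun h' => hi₀J ((Finset.mem_powersetCard.1 hU).1 h')
          have h2 : i₀ ∉ U' := fun h' => hi₀J ((Finset.mem_powersetCard.1 hU').1 h')
          rw [← Finset.erase_insert h1, ← Finset.erase_insert h2]
          exact congrArg (fun s => Finset.erase s i₀) hUU
        · intro U hU
          have h1 : i₀ ∉ U := fun h' => hi₀J ((Finset.mem_powersetCard.1 hU).1 h')
          rw [Finset.prod_eq_zero (f := fun v => y v - y i₀) (i := i₀) (by simp [h1]) (sub_self _),
            mul_zero]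
        · rw [Finset.disjoint_left]
          intro U hU hU'
          obtain ⟨U', _, rfl⟩ := Finset.mem_image.1 hU'
          exact hi₀J ((Finset.mem_powersetCard.1 hU).1 (Finset.mem_insert_self _ _))
    have hev := congrArg (Polynomial.eval (s a)) hLQ
    rw [hL, hQ, Polynomial.eval_finsetSum] at hev
    simp only [Polynomial.eval_mul, Polynomial.eval_C, Polynomial.eval_prod,
      Polynomial.eval_sub, Polynomial.eval_X] at hev
    simp only [Finset.prod_insert ha, Finset.prod_mul_distrib]
    rw [mul_comm, ← hev]
    refine Finset.sum_congr rfl fun U _ => ?_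
    ring

/-- The number of pairs `i < j` with `i ∉ B` and `j ∈ B`. -/
def crossings {N : ℕ} (B : Finset (Fin N)) : ℕ := ∑ i ∈ Bᶜ, (B.filter fun j => i < j).card

theorem prod_orderEmbOfFin {R : Type*} [CommRing R] {N a : ℕ} {B : Finset (Fin N)}
    (hB : B.card = a) (φ : Fin N → R) : ∏ i ∈ B, φ i = ∏ i, φ (B.orderEmbOfFin hB i) := by
  have h1 : B = univ.map (B.orderEmbOfFin hB).toEmbedding := by
    rw [← Finset.coe_inj]
    simp
  conv_lhs => rw [h1]
  rw [Finset.prod_map]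
  rfl

theorem prod_filter_lt_sub_eq_vand {R : Type*} [CommRing R] {N a : ℕ} (x : Fin N → R)
    {B : Finset (Fin N)} (hB : B.card = a) :
    ∏ i ∈ B, ∏ j ∈ B with i < j, (x j - x i) = vand (x ∘ B.orderEmbOfFin hB) := by
  rw [prod_orderEmbOfFin hB, vand]
  refine Finset.prod_congr rfl fun i _ => ?_
  rw [Finset.prod_filter, prod_orderEmbOfFin hB, ← Finset.prod_filter]
  refine Finset.prod_congr ?_ fun _ _ => rfl
  ext j
  simp

/-- Every pair of indices lies in `B`, in its complement, or across. Orienting the pairs across from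
`B` to its complement costs one sign for each pair that occurs in the opposite order. -/
theorem vand_split {R : Type*} [CommRing R] {N a b : ℕ} (x : Fin N → R) {B : Finset (Fin N)}
    (hB : B.card = a) (hB' : Bᶜ.card = b) :
    vand x = (-1) ^ crossings B * vand (x ∘ B.orderEmbOfFin hB) *
      vand (x ∘ Bᶜ.orderEmbOfFin hB') * ∏ i ∈ B, ∏ j ∈ Bᶜ, (x j - x i) := by
  classical
  have h1 : vand x = (∏ i ∈ B, ∏ j ∈ B with i < j, (x j - x i)) *
      (∏ i ∈ B, ∏ j ∈ Bᶜ with i < j, (x j - x i)) *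
      ((∏ i ∈ Bᶜ, ∏ j ∈ B with i < j, (x j - x i)) *
      (∏ i ∈ Bᶜ, ∏ j ∈ Bᶜ with i < j, (x j - x i))) := by
    rw [vand, ← Finset.prod_mul_prod_compl B, ← Finset.prod_mul_distrib, ← Finset.prod_mul_distrib]
    have h2 : ∀ i : Fin N, ∏ j ∈ Ioi i, (x j - x i) =
        (∏ j ∈ B with i < j, (x j - x i)) * ∏ j ∈ Bᶜ with i < j, (x j - x i) := by
      intro i
      rw [Finset.prod_filter, Finset.prod_filter, Finset.prod_mul_prod_compl B
        (fun j => if i < j then x j - x i else 1), ← Finset.prod_filter]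
      refine Finset.prod_congr ?_ fun _ _ => rfl
      ext j
      simp
    congr 1 <;> exact Finset.prod_congr rfl fun i _ => h2 i
  have h3 : ∏ i ∈ Bᶜ, ∏ j ∈ B with i < j, (x j - x i) =
      (-1) ^ crossings B * ∏ j ∈ B, ∏ i ∈ Bᶜ with i < j, (x i - x j) := by
    rw [crossings, ← Finset.prod_pow_eq_pow_sum]
    have h4 : ∏ j ∈ B, ∏ i ∈ Bᶜ with i < j, (x i - x j) =
        ∏ i ∈ Bᶜ, ∏ j ∈ B with i < j, (x i - x j) := by
      refine Finset.prod_comm' fun i j => ?_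
      simp only [mem_filter]
      tauto
    rw [h4, ← Finset.prod_mul_distrib]
    refine Finset.prod_congr rfl fun i _ => ?_
    rw [← Finset.prod_const, ← Finset.prod_mul_distrib]
    refine Finset.prod_congr rfl fun j _ => by ring
  have h5 : ∏ i ∈ B, ∏ j ∈ Bᶜ, (x j - x i) =
      (∏ i ∈ B, ∏ j ∈ Bᶜ with i < j, (x j - x i)) *
        ∏ i ∈ B, ∏ j ∈ Bᶜ with j < i, (x j - x i) := by
    rw [← Finset.prod_mul_distrib]
    refine Finset.prod_congr rfl fun i hi => ?_
    rw [← Finset.prod_filter_mul_prod_filter_not Bᶜ (fun j => i < j)]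
    congr 1
    refine Finset.prod_congr ?_ fun _ _ => rfl
    ext j
    simp only [mem_filter, Finset.mem_compl, not_lt, and_congr_right_iff]
    intro hj
    exact ⟨fun h => lt_of_le_of_ne h fun h' => hj (h' ▸ hi), le_of_lt⟩
  rw [h1, h3, h5, prod_filter_lt_sub_eq_vand x hB, prod_filter_lt_sub_eq_vand x hB']
  ring

theorem prod_subseq {R : Type*} [CommRing R] {n : ℕ} (Y : Fin n → R) (A : Finset (Fin n))
    (φ : R → R) : ∏ i, φ (subseq Y A i) = ∏ i ∈ A, φ (Y i) :=
  (prod_orderEmbOfFin rfl fun i => φ (Y i)).symm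

theorem nodalWeight_append_left {K : Type*} [Field K] {m k : ℕ} (σ : Fin m → K) (τ : Fin k → K)
    (i : Fin m) :
    Lagrange.nodalWeight univ (Fin.append σ τ) (Fin.castAdd k i) =
      Lagrange.nodalWeight univ σ i * ∏ j, (σ i - τ j)⁻¹ := by
  classical
  simp only [Lagrange.nodalWeight]
  rw [← Finset.filter_ne', Finset.prod_filter, Fin.prod_univ_add, ← Finset.filter_ne',
    Finset.prod_filter]
  congr 1
  · refine Finset.prod_congr rfl fun j _ => ?_
    simp
  · refine Finset.prod_congr rfl fun j _ => ?_
    rw [if_pos]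
    · simp
    · intro h
      have := congrArg Fin.val h
      simp at this
      omega

theorem nodalWeight_append_right {K : Type*} [Field K] {m k : ℕ} (σ : Fin m → K) (τ : Fin k → K)
    (j : Fin k) :
    Lagrange.nodalWeight univ (Fin.append σ τ) (Fin.natAdd m j) =
      Lagrange.nodalWeight univ τ j * ∏ i, (τ j - σ i)⁻¹ := by
  classical
  simp only [Lagrange.nodalWeight]
  rw [← Finset.filter_ne', Finset.prod_filter, Fin.prod_univ_add, ← Finset.filter_ne',
    Finset.prod_filter, mul_comm]
  congr 1
  · refine Finset.prod_congr rfl fun j _ => ?_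
    simp
  · refine Finset.prod_congr rfl fun i _ => ?_
    rw [if_pos]
    · simp
    · intro h
      have := congrArg Fin.val h
      simp at this
      omega

end LSOverlap

/-! ### Weights of node choices as sums over the splittings of `Y` -/

namespace LSOverlap

open Finset MvPolynomial

/-- In each summand the factors that involve the chosen nodes `S₁` and `T₁` combine, up to sign,
into products over all of `Y`, independent of `A`. What remains is the interpolation identity for
the nodes that were not chosen; this is why the bound concerns the complements of `S₁` and `T₁`. -/
theorem sum_prod_sub_split {K : Type*} [Field K] {m k q p : ℕ} (S : Fin m → K) (T : Fin k → K)
    {Y : Fin q → K} (hY : Function.Injective Y) (hTS : ∀ j i, T j - S i ≠ 0)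
    (S₁ : Finset (Fin m)) (T₁ : Finset (Fin k)) (hp : S₁ᶜ.card = p) (hq : p + T₁ᶜ.card ≤ q) :
    (∏ i ∈ S₁, ∏ y, (Y y - S i)) * (∏ j ∈ T₁, ∏ y, (Y y - T j)) *
        (∏ i ∈ S₁, ∏ j, (T j - S i))⁻¹ * (∏ j ∈ T₁, ∏ i, (S i - T j))⁻¹ *
        (∏ i ∈ S₁, ∏ j ∈ T₁, (S i - T j)) =
      ∑ A ∈ Finset.powersetCard p (univ : Finset (Fin q)),
        (∏ v ∈ Aᶜ, ∏ i, (Y v - S i)) * (∏ j, ∏ u ∈ A, (T j - Y u)) /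
          ((∏ v ∈ Aᶜ, ∏ u ∈ A, (Y v - Y u)) * ∏ j, ∏ i, (T j - S i)) *
          (∏ i ∈ S₁, ∏ u ∈ A, (Y u - S i)) * (∏ j ∈ T₁, ∏ v ∈ Aᶜ, (Y v - T j)) := by
  classical
  have hkey := sum_powersetCard_prod_sub (y := Y) S T S₁ᶜ T₁ᶜ (I := univ) hY.injOn (by
    rw [hp, Finset.card_univ, Fintype.card_fin]; exact hq)
  rw [hp] at hkey
  set PS := ∏ i ∈ S₁, ∏ y, (Y y - S i) with hPS
  set PT := ∏ j ∈ T₁, ∏ y, (Y y - T j) with hPT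
  set D := ∏ j, ∏ i, (T j - S i) with hD
  -- The sign arises from replacing `t - u` by `u - t` for `t` in `T₁` and `u` in `U`.
  have hterm : ∀ A ∈ Finset.powersetCard p (univ : Finset (Fin q)),
      (∏ v ∈ Aᶜ, ∏ i, (Y v - S i)) * (∏ j, ∏ u ∈ A, (T j - Y u)) /
          ((∏ v ∈ Aᶜ, ∏ u ∈ A, (Y v - Y u)) * D) *
          (∏ i ∈ S₁, ∏ u ∈ A, (Y u - S i)) * (∏ j ∈ T₁, ∏ v ∈ Aᶜ, (Y v - T j)) =
        PS * PT * (-1) ^ (T₁.card * p) / D *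
        ((∏ v ∈ univ \ A, ∏ i ∈ S₁ᶜ, (Y v - S i)) * (∏ u ∈ A, ∏ j ∈ T₁ᶜ, (T j - Y u)) /
          (∏ v ∈ univ \ A, ∏ u ∈ A, (Y v - Y u))) := by
    intro A hA
    have hAc : A.card = p := (Finset.mem_powersetCard.1 hA).2
    rw [← Finset.compl_eq_univ_sdiff]
    have h1 : (∏ v ∈ Aᶜ, ∏ i, (Y v - S i)) * (∏ i ∈ S₁, ∏ u ∈ A, (Y u - S i)) =
        (∏ v ∈ Aᶜ, ∏ i ∈ S₁ᶜ, (Y v - S i)) * PS := by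
      have h2 : ∀ v, ∏ i, (Y v - S i) = (∏ i ∈ S₁, (Y v - S i)) * ∏ i ∈ S₁ᶜ, (Y v - S i) :=
        fun v => (Finset.prod_mul_prod_compl S₁ _).symm
      have h3 : PS = (∏ i ∈ S₁, ∏ u ∈ A, (Y u - S i)) * ∏ i ∈ S₁, ∏ u ∈ Aᶜ, (Y u - S i) := by
        rw [hPS, ← Finset.prod_mul_distrib]
        exact Finset.prod_congr rfl fun i _ => (Finset.prod_mul_prod_compl A _).symm
      simp only [h2, Finset.prod_mul_distrib]
      rw [h3, Finset.prod_comm (s := S₁) (t := Aᶜ)]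
      ring
    have h4 : (∏ j, ∏ u ∈ A, (T j - Y u)) * (∏ j ∈ T₁, ∏ v ∈ Aᶜ, (Y v - T j)) =
        (∏ u ∈ A, ∏ j ∈ T₁ᶜ, (T j - Y u)) * (PT * (-1) ^ (T₁.card * p)) := by
      have h5 : PT = (∏ j ∈ T₁, ∏ u ∈ A, (Y u - T j)) * ∏ j ∈ T₁, ∏ u ∈ Aᶜ, (Y u - T j) := by
        rw [hPT, ← Finset.prod_mul_distrib]
        exact Finset.prod_congr rfl fun i _ => (Finset.prod_mul_prod_compl A _).symm
      have h6 : ∏ j ∈ T₁, ∏ u ∈ A, (T j - Y u) =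
          (-1) ^ (T₁.card * p) * ∏ j ∈ T₁, ∏ u ∈ A, (Y u - T j) := by
        rw [mul_comm T₁.card, pow_mul, ← Finset.prod_const, ← Finset.prod_mul_distrib, ← hAc]
        refine Finset.prod_congr rfl fun j _ => ?_
        rw [← Finset.prod_const, ← Finset.prod_mul_distrib]
        exact Finset.prod_congr rfl fun u _ => by ring
      rw [← Finset.prod_mul_prod_compl T₁ (fun j => ∏ u ∈ A, (T j - Y u)), h6, h5,
        Finset.prod_comm (s := T₁ᶜ) (t := A)]
      ring
    calc _ = ((∏ v ∈ Aᶜ, ∏ i, (Y v - S i)) * (∏ i ∈ S₁, ∏ u ∈ A, (Y u - S i))) *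
          ((∏ j, ∏ u ∈ A, (T j - Y u)) * (∏ j ∈ T₁, ∏ v ∈ Aᶜ, (Y v - T j))) /
          ((∏ v ∈ Aᶜ, ∏ u ∈ A, (Y v - Y u)) * D) := by ring
      _ = _ := by rw [h1, h4]; ring
  rw [Finset.sum_congr rfl hterm, ← Finset.mul_sum, hkey]
  set D11 := ∏ j ∈ T₁, ∏ i ∈ S₁, (T j - S i) with hD11
  set D12 := ∏ j ∈ T₁, ∏ i ∈ S₁ᶜ, (T j - S i) with hD12
  set D21 := ∏ j ∈ T₁ᶜ, ∏ i ∈ S₁, (T j - S i) with hD21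
  set D22 := ∏ j ∈ T₁ᶜ, ∏ i ∈ S₁ᶜ, (T j - S i) with hD22
  have hne : ∀ (A : Finset (Fin k)) (B : Finset (Fin m)), ∏ j ∈ A, ∏ i ∈ B, (T j - S i) ≠ 0 :=
    fun A B => Finset.prod_ne_zero_iff.2 fun j _ => Finset.prod_ne_zero_iff.2 fun i _ => hTS j i
  have n11 : D11 ≠ 0 := hne _ _
  have n12 : D12 ≠ 0 := hne _ _
  have n21 : D21 ≠ 0 := hne _ _
  have n22 : D22 ≠ 0 := hne _ _
  have e1 : D = D11 * D12 * (D21 * D22) := by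
    rw [hD, ← Finset.prod_mul_prod_compl T₁, hD11, hD12, hD21, hD22, ← Finset.prod_mul_distrib,
      ← Finset.prod_mul_distrib]
    congr 1 <;> exact Finset.prod_congr rfl fun j _ => (Finset.prod_mul_prod_compl S₁ _).symm
  have e2 : ∏ i ∈ S₁, ∏ j, (T j - S i) = D11 * D21 := by
    rw [Finset.prod_comm, ← Finset.prod_mul_prod_compl T₁]
  have hsign : ∀ B : Finset (Fin m), ∏ j ∈ T₁, ∏ i ∈ B, (S i - T j) =
      (-1) ^ (B.card * T₁.card) * ∏ j ∈ T₁, ∏ i ∈ B, (T j - S i) := by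
    intro B
    rw [pow_mul, ← Finset.prod_const, ← Finset.prod_mul_distrib]
    refine Finset.prod_congr rfl fun j _ => ?_
    rw [← Finset.prod_const, ← Finset.prod_mul_distrib]
    exact Finset.prod_congr rfl fun u _ => by ring
  have e3 : ∏ j ∈ T₁, ∏ i, (S i - T j) =
      (-1) ^ (S₁.card * T₁.card) * (-1) ^ (T₁.card * p) * (D11 * D12) := by
    have h1 : ∏ j ∈ T₁, ∏ i, (S i - T j) =
        (∏ j ∈ T₁, ∏ i ∈ S₁, (S i - T j)) * ∏ j ∈ T₁, ∏ i ∈ S₁ᶜ, (S i - T j) := by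
      rw [← Finset.prod_mul_distrib]
      exact Finset.prod_congr rfl fun j _ => (Finset.prod_mul_prod_compl S₁ _).symm
    rw [h1, hsign, hsign, hp, mul_comm p]
    ring
  rw [e1, e2, e3, Finset.prod_comm (s := S₁) (t := T₁), hsign, ← hD11]
  rcases neg_one_pow_eq_or K (S₁.card * T₁.card) with h1 | h1 <;>
    rcases neg_one_pow_eq_or K (T₁.card * p) with h2 | h2 <;> rw [h1, h2] <;> field_simp

theorem vand_eq_zero {K : Type*} [Field K] {N : ℕ} {x : Fin N → K} (h : ¬ Function.Injective x) :
    vand x = 0 := by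
  rw [vand, ← Matrix.det_vandermonde]
  by_contra hne
  exact h (Matrix.det_vandermonde_ne_zero_iff.1 hne)

theorem nodeWeight_eq_zero {K : Type*} [Field K] {M q N : ℕ} (Z : Fin M → K) (Y : Fin q → K)
    {f : Fin N → Fin M} (hf : ¬ Function.Injective f) : nodeWeight Z Y f = 0 := by
  rw [nodeWeight, vand_eq_zero fun h => hf h.of_comp, mul_zero]

/-- The Vandermonde product and the nodal weights of `S ∪ T` split into those of `S`, those of `T`
and cross factors, and `sum_prod_sub_split` resolves the latter. If a restriction of `f` is not
injective, both sides are zero. -/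
theorem nodeWeight_append {K : Type*} [Field K] {m k q a b p N : ℕ} (S : Fin m → K) (T : Fin k → K)
    {Y : Fin q → K} (hY : Function.Injective Y) (hTS : ∀ j i, T j - S i ≠ 0)
    (hap : a + p = m) (hbk : p + (k - b) ≤ q) {B : Finset (Fin N)} (hB : B.card = a)
    (hB' : Bᶜ.card = b) {f : Fin N → Fin (m + k)} {f₁ : Fin a → Fin m} {f₂ : Fin b → Fin k}
    (h₁ : ∀ i, f (B.orderEmbOfFin hB i) = Fin.castAdd k (f₁ i))
    (h₂ : ∀ j, f (Bᶜ.orderEmbOfFin hB' j) = Fin.natAdd m (f₂ j)) :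
    nodeWeight (-Fin.append S T) Y f =
      ∑ A ∈ Finset.powersetCard p (univ : Finset (Fin q)),
        delta₂ (subseq Y Aᶜ) S * delta₂ T (subseq Y A) /
            (delta₂ (subseq Y Aᶜ) (subseq Y A) * delta₂ T S) * (-1) ^ crossings B *
          nodeWeight (-S) (subseq Y A) f₁ * nodeWeight (-T) (subseq Y Aᶜ) f₂ := by
  classical
  by_cases hf₁ : Function.Injective f₁
  swap
  · have hf : ¬ Function.Injective f := by
      intro hf
      apply hf₁
      intro i i' hii
      have : f (B.orderEmbOfFin hB i) = f (B.orderEmbOfFin hB i') := by rw [h₁, h₁, hii]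
      exact (B.orderEmbOfFin hB).injective (hf this)
    simp [nodeWeight_eq_zero _ _ hf, nodeWeight_eq_zero _ _ hf₁]
  by_cases hf₂ : Function.Injective f₂
  swap
  · have hf : ¬ Function.Injective f := by
      intro hf
      apply hf₂
      intro i i' hii
      have : f (Bᶜ.orderEmbOfFin hB' i) = f (Bᶜ.orderEmbOfFin hB' i') := by rw [h₂, h₂, hii]
      exact (Bᶜ.orderEmbOfFin hB').injective (hf this)
    simp [nodeWeight_eq_zero _ _ hf, nodeWeight_eq_zero _ _ hf₂]
  set S₁ := univ.image f₁ with hS₁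
  set T₁ := univ.image f₂ with hT₁
  have cS : S₁.card = a := by rw [hS₁, Finset.card_image_of_injective _ hf₁]; simp
  have cT : T₁.card = b := by rw [hT₁, Finset.card_image_of_injective _ hf₂]; simp
  have pS : ∀ φ : Fin m → K, ∏ i ∈ S₁, φ i = ∏ i, φ (f₁ i) := fun φ => by
    rw [hS₁, Finset.prod_image fun _ _ _ _ h => hf₁ h]
  have pT : ∀ φ : Fin k → K, ∏ i ∈ T₁, φ i = ∏ i, φ (f₂ i) := fun φ => by
    rw [hT₁, Finset.prod_image fun _ _ _ _ h => hf₂ h]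
  have hcore := sum_prod_sub_split S T hY hTS S₁ T₁ (p := p)
    (by rw [Finset.card_compl, cS, Fintype.card_fin]; omega)
    (by rw [Finset.card_compl T₁, cT, Fintype.card_fin]; exact hbk)
  have hneg : -Fin.append S T = Fin.append (-S) (-T) := by
    ext i
    induction i using Fin.addCases <;> simp
  have hZ1 : (-Fin.append S T) ∘ f ∘ B.orderEmbOfFin hB = (-S) ∘ f₁ := by
    ext i; simp [h₁]
  have hZ2 : (-Fin.append S T) ∘ f ∘ Bᶜ.orderEmbOfFin hB' = (-T) ∘ f₂ := by
    ext i; simp [h₂]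
  have hcross : ∏ i ∈ B, ∏ j ∈ Bᶜ, (((-Fin.append S T) ∘ f) j - ((-Fin.append S T) ∘ f) i) =
      ∏ i ∈ S₁, ∏ j ∈ T₁, (S i - T j) := by
    rw [prod_orderEmbOfFin hB, pS]
    refine Finset.prod_congr rfl fun i _ => ?_
    rw [prod_orderEmbOfFin hB', pT]
    refine Finset.prod_congr rfl fun j _ => ?_
    simp [h₁, h₂]
    ring
  have hL : nodeWeight (-Fin.append S T) Y f =
      (-1) ^ crossings B * (∏ i, Lagrange.nodalWeight univ (-S) (f₁ i)) * vand ((-S) ∘ f₁) *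
      (∏ i, Lagrange.nodalWeight univ (-T) (f₂ i)) * vand ((-T) ∘ f₂) *
      ((∏ i ∈ S₁, ∏ y, (Y y - S i)) * (∏ j ∈ T₁, ∏ y, (Y y - T j)) *
        (∏ i ∈ S₁, ∏ j, (T j - S i))⁻¹ * (∏ j ∈ T₁, ∏ i, (S i - T j))⁻¹ *
        (∏ i ∈ S₁, ∏ j ∈ T₁, (S i - T j))) := by
    rw [nodeWeight, vand_split _ hB hB', hcross, ← Finset.prod_mul_prod_compl B,
      prod_orderEmbOfFin hB, prod_orderEmbOfFin hB', Function.comp_assoc, Function.comp_assoc,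
      hZ1, hZ2, hneg]
    simp only [h₁, h₂, nodalWeight_append_left, nodalWeight_append_right, Fin.append_left,
      Fin.append_right, Finset.prod_mul_distrib, pS, pT, Finset.prod_inv_distrib, Pi.neg_apply,
      neg_add_eq_sub, neg_sub_neg]
    ring
  rw [hL, hcore, Finset.mul_sum]
  refine Finset.sum_congr rfl fun A _ => ?_
  have d1 : ∀ {r : ℕ} (W : Fin r → K) (C : Finset (Fin q)),
      delta₂ (subseq Y C) W = ∏ v ∈ C, ∏ i, (Y v - W i) := fun W C =>
    prod_subseq Y C fun y => ∏ i, (y - W i)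
  have d2 : ∀ (x : K) (C : Finset (Fin q)), ∏ j, (x - subseq Y C j) = ∏ u ∈ C, (x - Y u) :=
    fun x C => prod_subseq Y C fun y => x - y
  have d3 : ∀ (x : K) (C : Finset (Fin q)), ∏ j, (-x + subseq Y C j) = ∏ u ∈ C, (Y u - x) :=
    fun x C => by
      rw [prod_subseq Y C fun y => -x + y]
      exact Finset.prod_congr rfl fun u _ => neg_add_eq_sub _ _
  rw [d1, d1]
  simp only [nodeWeight, delta₂, d2, Pi.neg_apply, d3, Finset.prod_mul_distrib, pS, pT]
  ring

end LSOverlap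

namespace LSOverlap

open Finset MvPolynomial

/-! ### Subpartitions and splittings of index sets -/

theorem colLen_ofAntitone_le {N : ℕ} (f : Fin N → ℕ) (hf : Antitone f) :
    (ofAntitone f hf).colLen 0 ≤ N := by
  by_contra hlt
  have h1 := YoungDiagram.mem_iff_lt_rowLen.1 (YoungDiagram.mem_iff_lt_colLen.2 (not_le.1 hlt))
  simp [rowLen_ofAntitone] at h1

theorem rowLen_complement {a N : ℕ} (μ : YoungDiagram) (i : Fin N) :
    (complement a N μ).rowLen i = a - μ.rowLen (Fin.rev i : Fin N) :=
  (rowLen_ofAntitone _ _ _).trans (dif_pos i.2)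

theorem rowLen_subpartition {N : ℕ} (μ : YoungDiagram) (M : Finset (Fin N)) (j : Fin M.card) :
    (subpartition N μ M).rowLen j = μ.rowLen (M.orderEmbOfFin rfl j) +
      (N - 1 - M.orderEmbOfFin rfl j) - (M.card - 1 - j) :=
  (rowLen_ofAntitone _ _ _).trans (dif_pos j.2)

theorem shifted_subpartition {N r : ℕ} (μ : YoungDiagram) {M : Finset (Fin N)} (hM : M.card = r)
    (j : Fin r) :
    shifted r (subpartition N μ M) j = shifted N μ (M.orderEmbOfFin hM j) := by
  subst hM
  have hj := j.2
  -- At least `r - 1 - j` indices of `[N]` follow the `j`-th element of `M`, so the truncated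
  -- subtraction in the definition of the subpartition is exact.
  have h1 := orderEmb_add_le (M.orderEmbOfFin rfl)
    (show j ≤ ⟨M.card - 1, by omega⟩ by rw [Fin.le_def]; simp only; omega)
  have h2 := (M.orderEmbOfFin rfl ⟨M.card - 1, by omega⟩).2
  simp only [shifted, rowLen_subpartition] at h1 ⊢
  omega

theorem subpartition_eq_iff {N r : ℕ} {μ κ : YoungDiagram} {M : Finset (Fin N)} (hM : M.card = r)
    (hκ : κ.colLen 0 ≤ r) :
    subpartition N μ M = κ ↔ ∀ j, shifted r κ j = shifted N μ (M.orderEmbOfFin hM j) := by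
  constructor
  · rintro rfl j
    exact shifted_subpartition μ hM j
  · intro h
    refine shifted_injective ((colLen_ofAntitone_le _ _).trans hM.le) hκ ?_
    ext j
    rw [h, shifted_subpartition]

/-- The set of those indices `i` for which the `i`-th shifted part of `κ'` is a shifted part of
the conjugate of `μ`. -/
noncomputable def conjugateIndices (N a : ℕ) (κ μ : YoungDiagram) : Finset (Fin N) :=
  open Classical in {i | ∃ j : Fin a, shifted N κ.transpose i = shifted a μ.transpose j}

theorem mem_subpartitionPairs {a N l : ℕ} {κ : YoungDiagram} {x : YoungDiagram × Finset (Fin N)} :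
    x ∈ subpartitionPairs a N l κ ↔
      (x.1.colLen 0 ≤ N ∧ x.1.rowLen 0 ≤ a) ∧ x.2.card = l ∧ subpartition N x.1 x.2 = κ := by
  classical
  simp only [subpartitionPairs, mem_filter, Finset.mem_product, mem_subdiagrams_rect,
    Finset.mem_powersetCard, Finset.subset_univ, true_and, and_assoc]

theorem shifted_complement {a L : ℕ} {μ : YoungDiagram} (h : μ.rowLen 0 ≤ a) (c : Fin L) :
    shifted L (complement a L μ) c = coshifted a L μ (Fin.rev c) := by
  have h1 := rowLen_le_of_le h (Fin.rev c : Fin L)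
  have hc := c.2
  simp only [shifted, coshifted, rowLen_complement, Fin.val_rev] at h1 ⊢
  omega

variable {a b l N : ℕ} {κ : YoungDiagram} {x : YoungDiagram × Finset (Fin (b + l))}

/-- As `a + (b + l) = N + l`, the complementary sequences of `κ` and of `λ` live in the same
interval, and the reflection of this interval turns the subpartition condition into an inclusion of
these sequences. -/
theorem coshifted_eq_of_mem (hN : a + b = N) (hκ : κ.colLen 0 ≤ l) (hκ' : κ.rowLen 0 ≤ N)
    (hx : x ∈ subpartitionPairs a (b + l) l κ) (j : Fin l) :
    coshifted N l κ j =
      coshifted a (b + l) x.1 (x.2.orderEmbOfFin (mem_subpartitionPairs.1 hx).2.1 j) := by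
  obtain ⟨⟨h1, h2⟩, h3, h4⟩ := mem_subpartitionPairs.1 hx
  have h5 := (subpartition_eq_iff h3 hκ).1 h4 j
  have h6 := shifted_add_coshifted (N := l) hκ' j
  have h7 := shifted_add_coshifted (N := b + l) h2 (x.2.orderEmbOfFin h3 j)
  have h8 := j.2
  have h9 := coshifted_lt (N := l) hκ' j
  have h10 := coshifted_lt (N := b + l) h2 (x.2.orderEmbOfFin h3 j)
  omega

/-- In particular `K` is determined by `λ` and `κ`. -/
theorem mem_snd_iff (hN : a + b = N) (hκ : κ.colLen 0 ≤ l) (hκ' : κ.rowLen 0 ≤ N)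
    (hx : x ∈ subpartitionPairs a (b + l) l κ) (k : Fin (b + l)) :
    k ∈ x.2 ↔ ∃ j, coshifted N l κ j = coshifted a (b + l) x.1 k := by
  obtain ⟨⟨h1, h2⟩, h3, h4⟩ := mem_subpartitionPairs.1 hx
  constructor
  · intro hk
    have : k ∈ Set.range (x.2.orderEmbOfFin h3) := by simpa using hk
    obtain ⟨j, rfl⟩ := this
    exact ⟨j, coshifted_eq_of_mem hN hκ hκ' hx j⟩
  · rintro ⟨j, hj⟩
    rw [coshifted_eq_of_mem hN hκ hκ' hx j] at hj
    rw [← (coshifted_strictMono h2).injective hj]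
    exact Finset.orderEmbOfFin_mem _ _ _

theorem exists_shifted_or_coshifted (hκ : κ.colLen 0 ≤ l) (hκ' : κ.rowLen 0 ≤ N) {v : ℕ}
    (hv : v < N + l) :
    (∃ i, shifted N κ.transpose i = v) ∨ ∃ j, coshifted N l κ j = v := by
  obtain ⟨y, hy⟩ := (betaEquiv hκ' hκ).surjective ⟨v, hv⟩
  have hy' := congrArg Fin.val hy
  rcases y with i | j
  · exact Or.inl ⟨i, hy'⟩
  · exact Or.inr ⟨j, hy'⟩

/-- Passing to complements in the interval reverses the inclusion: a shifted part of `λ'` avoids the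
complementary sequence of `λ`, hence that of `κ`, and so is a shifted part of `κ'`. -/
theorem exists_conjugate_embedding (hN : a + b = N) (hκ : κ.colLen 0 ≤ l) (hκ' : κ.rowLen 0 ≤ N)
    (hx : x ∈ subpartitionPairs a (b + l) l κ) (j : Fin a) :
    ∃ i, shifted N κ.transpose i = shifted a x.1.transpose j := by
  obtain ⟨⟨h1, h2⟩, h3, h4⟩ := mem_subpartitionPairs.1 hx
  have hlt := shifted_transpose_lt h1 j
  refine (exists_shifted_or_coshifted hκ hκ' (by omega)).resolve_right ?_
  rintro ⟨i, hi⟩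
  rw [coshifted_eq_of_mem hN hκ hκ' hx i] at hi
  exact coshifted_ne_shifted h2 _ _ hi

theorem strictMono_of_shifted_eq {r : ℕ} {g : Fin r → Fin N} {d : Fin r → ℕ}
    {e : Fin N → ℕ} (he : StrictAnti e) (hd : StrictAnti d) (h : ∀ j, e (g j) = d j) :
    StrictMono g := by
  intro i j hij
  have := hd hij
  rw [← h, ← h] at this
  exact he.lt_iff_gt.1 this

theorem card_conjugateIndices (hN : a + b = N) (hκ : κ.colLen 0 ≤ l) (hκ' : κ.rowLen 0 ≤ N)
    (hx : x ∈ subpartitionPairs a (b + l) l κ) : (conjugateIndices N a κ x.1).card = a := by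
  classical
  choose g hg using exists_conjugate_embedding hN hκ hκ' hx
  have hm : StrictMono g := strictMono_of_shifted_eq (shifted_strictAnti N κ.transpose)
    (shifted_strictAnti a x.1.transpose) hg
  have : conjugateIndices N a κ x.1 = univ.image g := by
    ext i
    simp only [conjugateIndices, mem_filter, mem_univ, true_and, Finset.mem_image]
    constructor
    · rintro ⟨j, hj⟩
      exact ⟨j, (shifted_strictAnti N κ.transpose).injective ((hg j).trans hj.symm)⟩
    · rintro ⟨j, rfl⟩
      exact ⟨j, hg j⟩
  rw [this, Finset.card_image_of_injective _ hm.injective]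
  simp

theorem shifted_orderEmb_conjugateIndices (hN : a + b = N) (hκ : κ.colLen 0 ≤ l)
    (hκ' : κ.rowLen 0 ≤ N) (hx : x ∈ subpartitionPairs a (b + l) l κ)
    (hB : (conjugateIndices N a κ x.1).card = a) (j : Fin a) :
    shifted N κ.transpose ((conjugateIndices N a κ x.1).orderEmbOfFin hB j) =
      shifted a x.1.transpose j := by
  choose g hg using exists_conjugate_embedding hN hκ hκ' hx
  have hm : StrictMono g := strictMono_of_shifted_eq (shifted_strictAnti N κ.transpose)
    (shifted_strictAnti a x.1.transpose) hg
  rw [← Finset.orderEmbOfFin_unique hB (f := g) (fun j => ?_) hm, hg]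
  simp only [conjugateIndices, mem_filter, mem_univ, true_and]
  exact ⟨j, hg j⟩

theorem mem_coSubset {N : ℕ} {K : Finset (Fin N)} {c : Fin N} : c ∈ coSubset K ↔ Fin.rev c ∉ K := by
  simp only [coSubset, Finset.mem_image, Finset.mem_compl]
  constructor
  · rintro ⟨k, hk, rfl⟩
    rwa [Fin.rev_rev]
  · intro h
    exact ⟨_, h, Fin.rev_rev c⟩

theorem card_coSubset {N : ℕ} (K : Finset (Fin N)) : (coSubset K).card = N - K.card := by
  rw [coSubset, Finset.card_image_of_injective _ Fin.rev_injective, Finset.card_compl,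
    Fintype.card_fin]

/-- The shifted parts of `κ'` that are not shifted parts of `λ'` are the elements of the
complementary sequence of `λ` outside `K`. Reading that sequence backwards gives the shifted parts
of the complement of `λ`. -/
theorem shifted_orderEmb_compl_conjugateIndices (hN : a + b = N) (hκ : κ.colLen 0 ≤ l)
    (hκ' : κ.rowLen 0 ≤ N) (hx : x ∈ subpartitionPairs a (b + l) l κ)
    (hB : (conjugateIndices N a κ x.1)ᶜ.card = b) (hC : (coSubset x.2).card = b) (j : Fin b) :
    shifted N κ.transpose ((conjugateIndices N a κ x.1)ᶜ.orderEmbOfFin hB j) =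
      shifted (b + l) (complement a (b + l) x.1) ((coSubset x.2).orderEmbOfFin hC j) := by
  obtain ⟨⟨h1, h2⟩, h3, h4⟩ := mem_subpartitionPairs.1 hx
  have hex : ∀ j, ∃ i, shifted N κ.transpose i =
      shifted (b + l) (complement a (b + l) x.1) ((coSubset x.2).orderEmbOfFin hC j) := by
    intro j
    rw [shifted_complement h2]
    have hlt := coshifted_lt h2 (Fin.rev ((coSubset x.2).orderEmbOfFin hC j))
    refine (exists_shifted_or_coshifted hκ hκ' (by omega)).resolve_right fun h => ?_
    exact mem_coSubset.1 (Finset.orderEmbOfFin_mem (coSubset x.2) hC j)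
      ((mem_snd_iff hN hκ hκ' hx _).2 h)
  choose g hg using hex
  have hm : StrictMono g := strictMono_of_shifted_eq (shifted_strictAnti N κ.transpose)
    ((shifted_strictAnti (b + l) (complement a (b + l) x.1)).comp_strictMono
      ((coSubset x.2).orderEmbOfFin hC).strictMono) hg
  rw [← Finset.orderEmbOfFin_unique hB (f := g) (fun j => ?_) hm, hg]
  simp only [conjugateIndices, Finset.mem_compl, mem_filter, mem_univ, true_and, not_exists]
  intro t ht
  rw [hg, shifted_complement h2] at ht
  exact coshifted_ne_shifted h2 _ _ ht

theorem sum_orderEmbOfFin {n r : ℕ} {B : Finset (Fin n)} (hB : B.card = r) (φ : Fin n → ℕ) :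
    ∑ i ∈ B, φ i = ∑ i, φ (B.orderEmbOfFin hB i) := by
  have h1 : B = univ.map (B.orderEmbOfFin hB).toEmbedding := by
    rw [← Finset.coe_inj]
    simp
  conv_lhs => rw [h1]
  rw [Finset.sum_map]
  rfl

/-- The equality holds term by term. The index `i ∉ B` attached to a row `k ∉ K` of `λ` precedes the
`t`-th element of `B` exactly when the cell `(k, t)` is outside the diagram of `λ`, and there are `a
- λ_k` such `t`. -/
theorem sum_complement_eq_crossings (hN : a + b = N) (hκ : κ.colLen 0 ≤ l)
    (hκ' : κ.rowLen 0 ≤ N) (hx : x ∈ subpartitionPairs a (b + l) l κ) :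
    ∑ i ∈ coSubset x.2, (complement a (b + l) x.1).rowLen i =
      crossings (conjugateIndices N a κ x.1) := by
  classical
  obtain ⟨⟨h1, h2⟩, h3, h4⟩ := mem_subpartitionPairs.1 hx
  have hB := card_conjugateIndices hN hκ hκ' hx
  have hB' : (conjugateIndices N a κ x.1)ᶜ.card = b := by
    rw [Finset.card_compl, hB, Fintype.card_fin]; omega
  have hC : (coSubset x.2).card = b := by rw [card_coSubset, h3]; omega
  rw [crossings, sum_orderEmbOfFin hC, sum_orderEmbOfFin hB']
  refine Finset.sum_congr rfl fun j _ => ?_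
  have hj := shifted_orderEmb_compl_conjugateIndices hN hκ hκ' hx hB' hC j
  set i := (conjugateIndices N a κ x.1)ᶜ.orderEmbOfFin hB' j
  set c := (coSubset x.2).orderEmbOfFin hC j
  rw [shifted_complement h2] at hj
  have h6 := shifted_orderEmb_conjugateIndices hN hκ hκ' hx hB
  have h7 : (conjugateIndices N a κ x.1).filter (fun t => i < t) =
      (univ.filter fun t : Fin a => x.1.rowLen (Fin.rev c : Fin (b + l)) ≤ t).map
        ((conjugateIndices N a κ x.1).orderEmbOfFin hB).toEmbedding := by
    have hiff : ∀ t : Fin a, i < (conjugateIndices N a κ x.1).orderEmbOfFin hB t ↔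
        x.1.rowLen (Fin.rev c : Fin (b + l)) ≤ t := by
      intro t
      rw [← (shifted_strictAnti N κ.transpose).lt_iff_gt, h6, hj]
      have h8 := coshifted_lt_shifted_iff (N := b + l) h2 (Fin.rev c) t
      have h9 := coshifted_ne_shifted (N := b + l) h2 (Fin.rev c) t
      omega
    ext t
    simp only [mem_filter, Finset.mem_map, mem_univ, true_and]
    constructor
    · rintro ⟨ht, hit⟩
      have : t ∈ Set.range ((conjugateIndices N a κ x.1).orderEmbOfFin hB) := by simpa using ht
      obtain ⟨s, rfl⟩ := this
      exact ⟨s, (hiff s).1 hit, rfl⟩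
    · rintro ⟨s, hs, rfl⟩
      exact ⟨Finset.orderEmbOfFin_mem _ _ _, (hiff s).2 hs⟩
  rw [h7, Finset.card_map, rowLen_complement]
  have h10 := rowLen_le_of_le h2 (Fin.rev c : Fin (b + l))
  have h11 := Fin.card_filter_val_lt (n := a) (m := x.1.rowLen (Fin.rev c : Fin (b + l)))
  have h12 := Finset.card_filter_add_card_filter_not (s := (univ : Finset (Fin a)))
    (fun t : Fin a => (t : ℕ) < x.1.rowLen (Fin.rev c : Fin (b + l)))
  simp only [not_lt, Finset.card_univ, Fintype.card_fin] at h12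
  omega

/-- Let `λ'` be the partition whose shifted parts are those of `κ'` indexed by `B`. Its
complementary sequence contains that of `κ`, and the positions of the latter form `K`. -/
theorem exists_mem_subpartitionPairs (hN : a + b = N) (hκ : κ.colLen 0 ≤ l)
    (hκ' : κ.rowLen 0 ≤ N) {B : Finset (Fin N)} (hB : B.card = a) :
    ∃ x ∈ subpartitionPairs a (b + l) l κ, conjugateIndices N a κ x.1 = B := by
  classical
  obtain ⟨ν, hν, hνB⟩ := exists_shifted_eq (d := shifted N κ.transpose ∘ B.orderEmbOfFin hB)
    ((shifted_strictAnti N κ.transpose).comp_strictMono (B.orderEmbOfFin hB).strictMono)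
  have hνB' : ∀ j, shifted a ν j = shifted N κ.transpose (B.orderEmbOfFin hB j) :=
    fun j => congrFun hνB j
  have hrow : ν.transpose.rowLen 0 ≤ a := by rwa [YoungDiagram.rowLen_transpose]
  have hcol : ν.transpose.colLen 0 ≤ b + l := by
    rw [YoungDiagram.colLen_transpose]
    by_cases ha : a = 0
    · rw [rowLen_eq_zero_of_colLen_le hν (by omega)]
      exact Nat.zero_le _
    · have h1 := hνB' ⟨0, by omega⟩
      have h2 := shifted_transpose_lt hκ (B.orderEmbOfFin hB ⟨0, by omega⟩)
      rw [← h1] at h2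
      simp only [shifted] at h2
      omega
  have hex : ∀ j : Fin l, ∃ k : Fin (b + l), coshifted a (b + l) ν.transpose k =
      coshifted N l κ j := by
    intro j
    have hlt := coshifted_lt (N := l) hκ' j
    refine (exists_shifted_or_coshifted (N := a) hcol hrow (by omega)).resolve_left ?_
    rintro ⟨i, hi⟩
    rw [YoungDiagram.transpose_transpose, hνB'] at hi
    exact coshifted_ne_shifted hκ' _ _ hi.symm
  choose g hg using hex
  have hgm : StrictMono g := by
    intro i j hij
    have := coshifted_strictMono (N := l) hκ' hij
    rw [← hg, ← hg] at this
    exact (coshifted_strictMono hrow).lt_iff_lt.1 this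
  have hcard : (univ.image g).card = l := by
    rw [Finset.card_image_of_injective _ hgm.injective]; simp
  refine ⟨(ν.transpose, univ.image g), mem_subpartitionPairs.2 ⟨⟨hcol, hrow⟩, hcard, ?_⟩, ?_⟩
  · rw [subpartition_eq_iff hcard hκ]
    intro j
    rw [← Finset.orderEmbOfFin_unique hcard (f := g) (fun j => by simp) hgm]
    have h1 := shifted_add_coshifted (N := l) hκ' j
    have h2 := shifted_add_coshifted (N := b + l) hrow (g j)
    rw [hg] at h2
    dsimp only
    omega
  · ext i
    simp only [conjugateIndices, mem_filter, mem_univ, true_and, YoungDiagram.transpose_transpose,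
      hνB', (shifted_strictAnti N κ.transpose).injective.eq_iff]
    have : (∃ j, i = B.orderEmbOfFin hB j) ↔ i ∈ Set.range (B.orderEmbOfFin hB) := by
      simp only [Set.mem_range, eq_comm]
    rw [this]
    simp

/-- Pairs of a partition and an index set with given subpartition correspond to subsets. -/
theorem sum_subpartitionPairs {R : Type*} [CommRing R] (hN : a + b = N) (hκ : κ.colLen 0 ≤ l)
    (hκ' : κ.rowLen 0 ≤ N) (Φ : YoungDiagram × Finset (Fin (b + l)) → R)
    (Ψ : Finset (Fin N) → R)
    (h : ∀ x ∈ subpartitionPairs a (b + l) l κ, Φ x = Ψ (conjugateIndices N a κ x.1)) :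
    ∑ x ∈ subpartitionPairs a (b + l) l κ, Φ x =
      ∑ B ∈ Finset.powersetCard a (univ : Finset (Fin N)), Ψ B := by
  refine Finset.sum_bij (fun x _ => conjugateIndices N a κ x.1) ?_ ?_ ?_ h
  · intro x hx
    exact Finset.mem_powersetCard.2 ⟨Finset.subset_univ _, card_conjugateIndices hN hκ hκ' hx⟩
  · intro x hx y hy hxy
    have hBx := card_conjugateIndices hN hκ hκ' hx
    have hBy := card_conjugateIndices hN hκ hκ' hy
    have h1 := shifted_orderEmb_conjugateIndices hN hκ hκ' hx hBx
    have h2 := shifted_orderEmb_conjugateIndices hN hκ hκ' hy hBy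
    have h3 : x.1 = y.1 := by
      rw [← YoungDiagram.transpose_eq_iff]
      refine shifted_injective (n := a) ?_ ?_ ?_
      · rw [YoungDiagram.colLen_transpose]; exact (mem_subpartitionPairs.1 hx).1.2
      · rw [YoungDiagram.colLen_transpose]; exact (mem_subpartitionPairs.1 hy).1.2
      · ext j
        rw [← h1, ← h2]
        simp only [hxy]
    refine Prod.ext h3 ?_
    ext k
    rw [mem_snd_iff hN hκ hκ' hx, mem_snd_iff hN hκ hκ' hy, h3]
  · intro B hB
    obtain ⟨x, hx, hxB⟩ := exists_mem_subpartitionPairs hN hκ hκ' (Finset.mem_powersetCard.1 hB).2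
    exact ⟨x, hx, hxB⟩

end LSOverlap

namespace LSOverlap

open Finset MvPolynomial

/-! ### The overlap identity for distinct variables -/

/-- A map that sends exactly `B` into the first `m` nodes is the same as a pair of maps on `B` and
on its complement. -/
theorem sum_filter_preimage {R : Type*} [CommRing R] {m k a b N : ℕ} {B : Finset (Fin N)}
    (hB : B.card = a) (hB' : Bᶜ.card = b) (Φ : (Fin N → Fin (m + k)) → R)
    (Ψ : (Fin a → Fin m) → (Fin b → Fin k) → R)
    (h : ∀ f f₁ f₂, (∀ i, f (B.orderEmbOfFin hB i) = Fin.castAdd k (f₁ i)) →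
      (∀ j, f (Bᶜ.orderEmbOfFin hB' j) = Fin.natAdd m (f₂ j)) → Φ f = Ψ f₁ f₂) :
    ∑ f : Fin N → Fin (m + k) with (univ.filter fun i => (f i : ℕ) < m) = B, Φ f =
      ∑ f₁, ∑ f₂, Ψ f₁ f₂ := by
  classical
  set e := finSumEquivOfFinset hB hB' with he
  have hl : ∀ i, e (Sum.inl i) = B.orderEmbOfFin hB i := fun i => finSumEquivOfFinset_inl _ _ _
  have hr : ∀ i, e (Sum.inr i) = Bᶜ.orderEmbOfFin hB' i := fun i => finSumEquivOfFinset_inr _ _ _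
  set glue : (Fin a → Fin m) × (Fin b → Fin k) → Fin N → Fin (m + k) := fun x i =>
    Sum.elim (fun i => Fin.castAdd k (x.1 i)) (fun j => Fin.natAdd m (x.2 j)) (e.symm i) with hglue
  have g1 : ∀ x i, glue x (B.orderEmbOfFin hB i) = Fin.castAdd k (x.1 i) := by
    intro x i
    rw [hglue, ← hl]
    simp only [Equiv.symm_apply_apply, Sum.elim_inl]
  have g2 : ∀ x j, glue x (Bᶜ.orderEmbOfFin hB' j) = Fin.natAdd m (x.2 j) := by
    intro x j
    rw [hglue, ← hr]
    simp only [Equiv.symm_apply_apply, Sum.elim_inr]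
  rw [← Fintype.sum_prod_type' (f := Ψ)]
  symm
  refine Finset.sum_bij (fun x _ => glue x) ?_ ?_ ?_ ?_
  · intro x _
    simp only [mem_filter, mem_univ, true_and]
    ext i
    simp only [mem_filter, mem_univ, true_and]
    obtain ⟨s, rfl⟩ := e.surjective i
    rcases s with i | j
    · rw [hl, g1]
      simp
    · rw [hr, g2]
      have := Finset.orderEmbOfFin_mem Bᶜ hB' j
      rw [Finset.mem_compl] at this
      simp [this]
  · intro x _ y _ hxy
    refine Prod.ext (funext fun i => ?_) (funext fun j => ?_)
    · have := congrFun hxy (B.orderEmbOfFin hB i)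
      rw [g1, g1] at this
      exact Fin.castAdd_injective _ _ this
    · have := congrFun hxy (Bᶜ.orderEmbOfFin hB' j)
      rw [g2, g2] at this
      exact Fin.natAdd_injective _ _ this
  · intro f hf
    have hf' : ∀ i, (f i : ℕ) < m ↔ i ∈ B := by
      intro i
      rw [← (Finset.mem_filter.1 hf).2]
      simp
    have h1 : ∀ i : Fin a, (f (B.orderEmbOfFin hB i) : ℕ) < m := fun i =>
      (hf' _).2 (Finset.orderEmbOfFin_mem _ _ _)
    have h2 : ∀ j : Fin b, m ≤ (f (Bᶜ.orderEmbOfFin hB' j) : ℕ) := fun j =>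
      not_lt.1 fun hlt => Finset.mem_compl.1 (Finset.orderEmbOfFin_mem _ _ _) ((hf' _).1 hlt)
    refine ⟨(fun i => ⟨_, h1 i⟩, fun j => ⟨f (Bᶜ.orderEmbOfFin hB' j) - m, ?_⟩), mem_univ _, ?_⟩
    · have := (f (Bᶜ.orderEmbOfFin hB' j)).2
      have := h2 j
      omega
    · ext i
      obtain ⟨s, rfl⟩ := e.surjective i
      rcases s with i | j
      · rw [hl, g1]
        simp
      · rw [hr, g2]
        have := h2 j
        simp
        omega
  · intro x _
    exact (h _ _ _ (g1 x) (g2 x)).symm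

/-- For injective `f` the set `B` has at most `m` elements and its complement at most `n + n'`. So
`p = m - |B|` is at most `n'`, hence at most `q`, and it lies in the range of summation. -/
theorem sum_eq_sum_powersetCard {R : Type*} [CommRing R] {m n n' q : ℕ} (hn' : n' ≤ q)
    (Φ : (Fin (m + n) → Fin (m + (n + n'))) → R) (hΦ : ∀ f, ¬ Function.Injective f → Φ f = 0) :
    ∑ f, Φ f = ∑ p ∈ range (min m q + 1),
      ∑ B ∈ Finset.powersetCard (m - p) (univ : Finset (Fin (m + n))),
        ∑ f : Fin (m + n) → Fin (m + (n + n')) with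
          (univ.filter fun i => (f i : ℕ) < m) = B, Φ f := by
  classical
  have h1 : ∀ p, ∑ B ∈ Finset.powersetCard (m - p) (univ : Finset (Fin (m + n))),
      ∑ f : Fin (m + n) → Fin (m + (n + n')) with
        (univ.filter fun i => (f i : ℕ) < m) = B, Φ f =
      ∑ f, if (univ.filter fun i => (f i : ℕ) < m).card = m - p then Φ f else 0 := by
    intro p
    rw [← Finset.sum_filter]
    have h2 := Finset.sum_fiberwise_of_maps_to
      (s := univ.filter fun f : Fin (m + n) → Fin (m + (n + n')) =>
        (univ.filter fun i => (f i : ℕ) < m).card = m - p)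
      (t := Finset.powersetCard (m - p) (univ : Finset (Fin (m + n))))
      (g := fun f => univ.filter fun i => (f i : ℕ) < m)
      (fun f hf => Finset.mem_powersetCard.2 ⟨Finset.subset_univ _, (mem_filter.1 hf).2⟩) Φ
    rw [← h2]
    refine Finset.sum_congr rfl fun B hB => Finset.sum_congr ?_ fun _ _ => rfl
    ext f
    simp only [mem_filter, mem_univ, true_and]
    constructor
    · rintro rfl
      exact ⟨(Finset.mem_powersetCard.1 hB).2, rfl⟩
    · exact fun h => h.2
  simp only [h1]
  rw [Finset.sum_comm]
  refine Finset.sum_congr rfl fun f _ => ?_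
  by_cases hf : Function.Injective f
  · have hinj : Function.Injective fun i => (f i : ℕ) := Fin.val_injective.comp hf
    set B := univ.filter fun i => (f i : ℕ) < m with hB
    have hBm : B.card ≤ m := by
      have : (B.image fun i => (f i : ℕ)) ⊆ range m := by
        intro v hv
        obtain ⟨i, hi, rfl⟩ := Finset.mem_image.1 hv
        exact mem_range.2 (mem_filter.1 hi).2
      have h2 := Finset.card_le_card this
      rwa [Finset.card_image_of_injective _ hinj, Finset.card_range] at h2
    have hBc : Bᶜ.card ≤ n + n' := by
      have : (Bᶜ.image fun i => (f i : ℕ)) ⊆ Ico m (m + (n + n')) := by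
        intro v hv
        obtain ⟨i, hi, rfl⟩ := Finset.mem_image.1 hv
        rw [Finset.mem_compl, hB, mem_filter] at hi
        have := (f i).2
        simp at hi ⊢
        omega
      have h2 := Finset.card_le_card this
      rw [Finset.card_image_of_injective _ hinj, Nat.card_Ico] at h2
      omega
    rw [Finset.card_compl, Fintype.card_fin] at hBc
    rw [Finset.sum_eq_single (m - B.card)]
    · rw [if_pos (by omega)]
    · intro p hp hne
      have := mem_range.1 hp
      rw [if_neg (by omega)]
    · intro h2
      rw [mem_range] at h2
      omega
  · simp [hΦ f hf]

theorem le_rowLen_transpose {κ : YoungDiagram} {N r : ℕ} (h : InDiagram N r κ) (i : Fin N) :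
    r ≤ κ.transpose.rowLen i := by
  have hi := i.2
  rcases h with h | h | h
  · omega
  · omega
  · rw [YoungDiagram.rowLen_transpose]
    by_cases hr : r = 0
    · omega
    · have h1 : (r - 1, (i : ℕ)) ∈ κ := YoungDiagram.mem_iff_lt_rowLen.2 (by omega)
      have h2 := YoungDiagram.mem_iff_lt_colLen.1 h1
      omega

/-- The `j`-th part of `λ'` is the part of `κ'` at the `j`-th element of `B`, plus the number of
later indices outside `B`; already the part of `κ'` is at least `r`. -/
theorem le_rowLen_of_mem_subpartitionPairs {a b l N r : ℕ} {κ : YoungDiagram}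
    {x : YoungDiagram × Finset (Fin (b + l))} (hN : a + b = N) (hκ : κ.colLen 0 ≤ l)
    (hκ' : κ.rowLen 0 ≤ N) (hx : x ∈ subpartitionPairs a (b + l) l κ) (h : InDiagram N r κ)
    (j : Fin a) : r ≤ x.1.transpose.rowLen j := by
  have hB := card_conjugateIndices hN hκ hκ' hx
  have h1 := shifted_orderEmb_conjugateIndices hN hκ hκ' hx hB j
  have hj := j.2
  have h2 := orderEmb_add_le ((conjugateIndices N a κ x.1).orderEmbOfFin hB)
    (show j ≤ ⟨a - 1, by omega⟩ by rw [Fin.le_def]; simp only; omega)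
  have h3 := ((conjugateIndices N a κ x.1).orderEmbOfFin hB ⟨a - 1, by omega⟩).2
  have h4 := le_rowLen_transpose h ((conjugateIndices N a κ x.1).orderEmbOfFin hB j)
  simp only [shifted] at h1 h2
  omega

theorem rect_le_iff {a b : ℕ} {μ : YoungDiagram} :
    rect a b ≤ μ ↔ ∀ i : Fin b, a ≤ μ.rowLen i := by
  have hr : ∀ i j, (i, j) ∈ rect a b ↔ i < b ∧ j < a := by
    intro i j
    rw [YoungDiagram.mem_iff_lt_rowLen, rect, rowLen_ofAntitone]
    by_cases h : i < b <;> simp [h]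
  constructor
  · intro h i
    by_contra hlt
    exact hlt (not_lt.1 fun h1 => lt_irrefl _
      (YoungDiagram.mem_iff_lt_rowLen.1 (h ((hr i _).2 ⟨i.2, h1⟩))))
  · rintro h ⟨i, j⟩ hij
    have h1 := (hr i j).1 hij
    exact YoungDiagram.mem_iff_lt_rowLen.2 (lt_of_lt_of_le h1.2 (h ⟨i, h1.1⟩))

theorem subseq_injective {R : Type*} {n : ℕ} {Y : Fin n → R} (hY : Function.Injective Y)
    (A : Finset (Fin n)) : Function.Injective (subseq Y A) :=
  hY.comp (A.orderEmbOfFin rfl).injective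

theorem colLen_subRect_le (μ : YoungDiagram) (a b : ℕ) : (subRect μ a b).colLen 0 ≤ b :=
  colLen_ofAntitone_le _ _

theorem colLen_subpartition_le {N : ℕ} (μ : YoungDiagram) (M : Finset (Fin N)) :
    (subpartition N μ M).colLen 0 ≤ M.card :=
  colLen_ofAntitone_le _ _

/-- Here there are `a` rows and `a + p` nodes against `p` variables in `U`, so the node exponents
are the shifted parts themselves. Removing the rectangle lowers them by `r`, which makes them agree
with the exponents in the expansion for `κ'`. -/
theorem littlewoodSchur_subRect {K : Type*} [Field K] {a b l N m q r p : ℕ} {κ : YoungDiagram}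
    {x : YoungDiagram × Finset (Fin (b + l))} (hN : a + b = N) (hκ : κ.colLen 0 ≤ l)
    (hκ' : κ.rowLen 0 ≤ N) (hx : x ∈ subpartitionPairs a (b + l) l κ) (h : InDiagram N r κ)
    {Z : Fin m → K} (hZ : Function.Injective Z) {Y : Fin q → K} (hY : Function.Injective Y)
    (hap : a + p = m) {A : Finset (Fin q)} (hA : A.card = p)
    (hB : (conjugateIndices N a κ x.1).card = a) :
    littlewoodSchur (subRect x.1.transpose r a) Z (subseq Y A) =
      ∑ f : Fin a → Fin m, (∏ i, Z (f i) ^ (shifted N κ.transpose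
        ((conjugateIndices N a κ x.1).orderEmbOfFin hB i) - r)) *
          nodeWeight Z (subseq Y A) f := by
  refine littlewoodSchur_eq_sum hZ (subseq_injective hY A) (colLen_subRect_le _ _ _) fun i => ?_
  rw [shifted_orderEmb_conjugateIndices hN hκ hκ' hx hB]
  have h1 := le_rowLen_of_mem_subpartitionPairs hN hκ hκ' hx h i
  have h2 : (subRect x.1.transpose r a).rowLen i = x.1.transpose.rowLen i - r :=
    (rowLen_ofAntitone _ _ _).trans (dif_pos i.2)
  have := i.2
  simp only [shifted, h2]
  omega

/-- With `n'` as in `hq` and `hk`, the counts of rows, nodes and variables in `V` lower the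
exponents by `q - n' = r`. Thus no rectangle has to be removed here. -/
theorem littlewoodSchur_subpartition {K : Type*} [Field K] {a b l N k q r p n' : ℕ}
    {κ : YoungDiagram} {x : YoungDiagram × Finset (Fin (b + l))} (hN : a + b = N)
    (hκ : κ.colLen 0 ≤ l) (hκ' : κ.rowLen 0 ≤ N) (hx : x ∈ subpartitionPairs a (b + l) l κ)
    (h : InDiagram N r κ) {Z : Fin k → K} (hZ : Function.Injective Z) {Y : Fin q → K}
    (hY : Function.Injective Y) {A : Finset (Fin q)} (hA : A.card = p) (hq : n' + r = q)
    (hk : k + p = b + n') (hB : (conjugateIndices N a κ x.1)ᶜ.card = b) :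
    littlewoodSchur (subpartition (b + l) (complement a (b + l) x.1) (coSubset x.2)) Z
        (subseq Y Aᶜ) =
      ∑ f : Fin b → Fin k, (∏ i, Z (f i) ^ (shifted N κ.transpose
        ((conjugateIndices N a κ x.1)ᶜ.orderEmbOfFin hB i) - r)) *
          nodeWeight Z (subseq Y Aᶜ) f := by
  have hC : (coSubset x.2).card = b := by
    rw [card_coSubset, (mem_subpartitionPairs.1 hx).2.1]; omega
  refine littlewoodSchur_eq_sum hZ (subseq_injective hY _)
    ((colLen_subpartition_le _ _).trans hC.le) fun i => ?_
  rw [shifted_subpartition _ hC, ← shifted_orderEmb_compl_conjugateIndices hN hκ hκ' hx hB hC i]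
  have h1 := le_rowLen_transpose h ((conjugateIndices N a κ x.1)ᶜ.orderEmbOfFin hB i)
  have h2 : p ≤ q := by
    have := Finset.card_le_univ A
    rwa [hA, Fintype.card_fin] at this
  have h3 : Aᶜ.card = q - p := by rw [Finset.card_compl, hA, Fintype.card_fin]
  rw [h3]
  simp only [shifted]
  omega

theorem delta₂_ne_zero_iff {K : Type*} [Field K] {n m : ℕ} {X : Fin n → K} {Y : Fin m → K} :
    delta₂ X Y ≠ 0 ↔ ∀ i j, X i - Y j ≠ 0 := by
  simp [delta₂, Finset.prod_ne_zero_iff]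

theorem littlewoodSchur_append_of_injective {K : Type*} [Field K] {m n n' l q : ℕ} (hn' : n' ≤ q)
    {S : Fin m → K} {T : Fin (n + n') → K} {Y : Fin q → K} (hY : Function.Injective Y)
    (hST : Function.Injective (Fin.append S T)) {κ : YoungDiagram} (hκ : κ.colLen 0 ≤ l)
    (hκ' : κ.rowLen 0 ≤ m + n) (h : InDiagram (m + n) (q - n') κ) :
    littlewoodSchur κ.transpose (-(Fin.append S T)) Y =
      ∑ p ∈ Finset.range (min m q + 1),
        ∑ A ∈ Finset.powersetCard p (Finset.univ : Finset (Fin q)),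
          ∑ x ∈ subpartitionPairs (m - p) (n + p + l) l κ,
            delta₂ (subseq Y Aᶜ) S * delta₂ T (subseq Y A) /
                (delta₂ (subseq Y Aᶜ) (subseq Y A) * delta₂ T S) *
              (-1) ^ (∑ i ∈ coSubset x.2, (complement (m - p) (n + p + l) x.1).rowLen i) *
              littlewoodSchur (subRect x.1.transpose (q - n') (m - p)) (-S) (subseq Y A) *
              littlewoodSchur (subpartition (n + p + l) (complement (m - p) (n + p + l) x.1)
                (coSubset x.2)) (-T) (subseq Y Aᶜ) := by
  classical
  have hS : Function.Injective (-S) := fun i j hij => by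
    have : Fin.append S T (Fin.castAdd _ i) = Fin.append S T (Fin.castAdd _ j) := by
      simpa using hij
    exact Fin.castAdd_injective _ _ (hST this)
  have hT : Function.Injective (-T) := fun i j hij => by
    have : Fin.append S T (Fin.natAdd _ i) = Fin.append S T (Fin.natAdd _ j) := by
      simpa using hij
    exact Fin.natAdd_injective _ _ (hST this)
  have hTS : ∀ j i, T j - S i ≠ 0 := fun j i hij => by
    have : Fin.append S T (Fin.natAdd _ j) = Fin.append S T (Fin.castAdd _ i) := by
      simpa using sub_eq_zero.1 hij
    have := congrArg Fin.val (hST this)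
    simp at this
    omega
  set r := q - n' with hr
  set α := shifted (m + n) κ.transpose with hα
  have hZ : Function.Injective (-Fin.append S T) := neg_injective.comp hST
  rw [littlewoodSchur_eq_sum hZ hY (N := m + n) (a := fun i => α i - r)
    (by rwa [YoungDiagram.colLen_transpose]) (fun i => by
      have := le_rowLen_transpose h i
      simp only [hα, shifted]
      omega),
    sum_eq_sum_powersetCard hn' _ (fun f hf => by rw [nodeWeight_eq_zero _ _ hf, mul_zero])]
  refine Finset.sum_congr rfl fun p hp => ?_
  have hp' : p ≤ min m q := Nat.lt_succ_iff.1 (mem_range.1 hp)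
  have hap : m - p + p = m := by omega
  have hN : m - p + (n + p) = m + n := by omega
  -- The common value of both sides for fixed `B` and `A`. The case distinction only supplies the
  -- cardinalities on which the enumerations of `B` and its complement depend.
  set Ψ : Finset (Fin (m + n)) → Finset (Fin q) → K := fun B A =>
    if hB : B.card = m - p ∧ Bᶜ.card = n + p then
      delta₂ (subseq Y Aᶜ) S * delta₂ T (subseq Y A) /
        (delta₂ (subseq Y Aᶜ) (subseq Y A) * delta₂ T S) * (-1) ^ crossings B *
      (∑ f : Fin (m - p) → Fin m, (∏ i, (-S) (f i) ^ (α (B.orderEmbOfFin hB.1 i) - r)) *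
        nodeWeight (-S) (subseq Y A) f) *
      (∑ f : Fin (n + p) → Fin (n + n'), (∏ i, (-T) (f i) ^ (α (Bᶜ.orderEmbOfFin hB.2 i) - r)) *
        nodeWeight (-T) (subseq Y Aᶜ) f)
    else 0 with hΨ
  have hBc : ∀ {B : Finset (Fin (m + n))}, B.card = m - p → Bᶜ.card = n + p := by
    intro B hB
    rw [Finset.card_compl, hB, Fintype.card_fin]
    omega
  have hright : ∀ A ∈ Finset.powersetCard p (Finset.univ : Finset (Fin q)),
      ∑ x ∈ subpartitionPairs (m - p) (n + p + l) l κ,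
            delta₂ (subseq Y Aᶜ) S * delta₂ T (subseq Y A) /
                (delta₂ (subseq Y Aᶜ) (subseq Y A) * delta₂ T S) *
              (-1) ^ (∑ i ∈ coSubset x.2, (complement (m - p) (n + p + l) x.1).rowLen i) *
              littlewoodSchur (subRect x.1.transpose r (m - p)) (-S) (subseq Y A) *
              littlewoodSchur (subpartition (n + p + l) (complement (m - p) (n + p + l) x.1)
                (coSubset x.2)) (-T) (subseq Y Aᶜ) =
        ∑ B ∈ Finset.powersetCard (m - p) (univ : Finset (Fin (m + n))), Ψ B A := by
    intro A hA
    have hA' := (Finset.mem_powersetCard.1 hA).2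
    refine sum_subpartitionPairs hN hκ hκ' _ _ fun x hx => ?_
    have hB := card_conjugateIndices hN hκ hκ' hx
    rw [hΨ]
    dsimp only
    rw [dif_pos ⟨hB, hBc hB⟩, sum_complement_eq_crossings hN hκ hκ' hx,
      littlewoodSchur_subRect hN hκ hκ' hx h hS hY hap hA' hB,
      littlewoodSchur_subpartition hN hκ hκ' hx h hT hY hA' (n' := n') (by omega) (by omega)
        (hBc hB)]
  rw [Finset.sum_congr rfl hright, Finset.sum_comm]
  refine Finset.sum_congr rfl fun B hB => ?_
  have hB1 := (Finset.mem_powersetCard.1 hB).2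
  have hB2 := hBc hB1
  rw [sum_filter_preimage hB1 hB2 _ (fun f₁ f₂ =>
    (∏ i, (-S) (f₁ i) ^ (α (B.orderEmbOfFin hB1 i) - r)) *
    (∏ i, (-T) (f₂ i) ^ (α (Bᶜ.orderEmbOfFin hB2 i) - r)) *
      ∑ A ∈ Finset.powersetCard p (univ : Finset (Fin q)),
        delta₂ (subseq Y Aᶜ) S * delta₂ T (subseq Y A) /
            (delta₂ (subseq Y Aᶜ) (subseq Y A) * delta₂ T S) * (-1) ^ crossings B *
          nodeWeight (-S) (subseq Y A) f₁ * nodeWeight (-T) (subseq Y Aᶜ) f₂)]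
  · simp only [Finset.mul_sum]
    rw [Finset.sum_congr rfl fun f₁ _ => Finset.sum_comm, Finset.sum_comm]
    refine Finset.sum_congr rfl fun A _ => ?_
    rw [hΨ]
    dsimp only
    rw [dif_pos ⟨hB1, hB2⟩, mul_assoc, Finset.sum_mul_sum, Finset.mul_sum]
    refine Finset.sum_congr rfl fun f₁ _ => ?_
    rw [Finset.mul_sum]
    refine Finset.sum_congr rfl fun f₂ _ => by ring
  · intro f f₁ f₂ h₁ h₂
    -- The bound `p + ((n + n') - (n + p)) ≤ q` is met in two ways: the left side is `n'` if `p ≤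
    -- n'`, and it is `p` by truncation otherwise.
    rw [nodeWeight_append S T hY hTS hap (by omega) hB1 hB2 h₁ h₂, ← Finset.prod_mul_prod_compl B,
      prod_orderEmbOfFin hB1, prod_orderEmbOfFin hB2]
    congr 2
    · refine Finset.prod_congr rfl fun i _ => ?_
      simp [h₁]
    · refine Finset.prod_congr rfl fun i _ => ?_
      simp [h₂]

end LSOverlap

namespace LSOverlap

open Finset MvPolynomial

/-! ### Specialisation -/

theorem map_schur {R R' : Type*} [CommRing R] [CommRing R'] (φ : R →+* R') {n : ℕ}
    (μ : YoungDiagram) (Z : Fin n → R) : φ (schur μ Z) = schur μ (φ ∘ Z) := by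
  have := MvPolynomial.comp_aeval_apply Z φ.toIntAlgHom (schurPoly n μ)
  simpa [schur, Function.comp_def] using this

theorem map_littlewoodSchur {R R' : Type*} [CommRing R] [CommRing R'] (φ : R →+* R') {n m : ℕ}
    (κ : YoungDiagram) (Z : Fin n → R) (Y : Fin m → R) :
    φ (littlewoodSchur κ Z Y) = littlewoodSchur κ (φ ∘ Z) (φ ∘ Y) := by
  simp [littlewoodSchur, map_schur]

theorem map_delta₂ {R R' : Type*} [CommRing R] [CommRing R'] (φ : R →+* R') {n m : ℕ}
    (X : Fin n → R) (Y : Fin m → R) : φ (delta₂ X Y) = delta₂ (φ ∘ X) (φ ∘ Y) := by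
  simp [delta₂, map_prod]

theorem subseq_comp {R R' : Type*} (φ : R → R') {n : ℕ} (X : Fin n → R) (A : Finset (Fin n)) :
    φ ∘ subseq X A = subseq (φ ∘ X) A := rfl

theorem comp_neg {R R' : Type*} [CommRing R] [CommRing R'] (φ : R →+* R') {n : ℕ} (X : Fin n → R) :
    φ ∘ (-X) = -(φ ∘ X) := by
  ext i; simp

theorem comp_append {R R' : Type*} (φ : R → R') {m n : ℕ} (S : Fin m → R) (T : Fin n → R) :
    φ ∘ Fin.append S T = Fin.append (φ ∘ S) (φ ∘ T) := by
  ext i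
  induction i using Fin.addCases <;> simp

/-- The right-hand side of the overlap identity for variables `S`, `T` in an algebra over the
field of `Y`, multiplied by `Δ(T; S)`. -/
noncomputable def overlapSum {F R : Type*} [Field F] [CommRing R] [Algebra F R] {m n q : ℕ}
    (n' l : ℕ) (Y : Fin q → F) (κ : YoungDiagram) (S : Fin m → R) (T : Fin (n + n') → R) : R :=
  ∑ p ∈ Finset.range (min m q + 1),
    ∑ A ∈ Finset.powersetCard p (Finset.univ : Finset (Fin q)),
      ∑ x ∈ subpartitionPairs (m - p) (n + p + l) l κ,
        delta₂ (subseq (algebraMap F R ∘ Y) Aᶜ) S * delta₂ T (subseq (algebraMap F R ∘ Y) A) *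
          algebraMap F R (delta₂ (subseq Y Aᶜ) (subseq Y A))⁻¹ *
          (-1) ^ (∑ i ∈ coSubset x.2, (complement (m - p) (n + p + l) x.1).rowLen i) *
          littlewoodSchur (subRect x.1.transpose (q - n') (m - p)) (-S)
            (subseq (algebraMap F R ∘ Y) A) *
          littlewoodSchur (subpartition (n + p + l) (complement (m - p) (n + p + l) x.1)
            (coSubset x.2)) (-T) (subseq (algebraMap F R ∘ Y) Aᶜ)

theorem map_overlapSum {F R R' : Type*} [Field F] [CommRing R] [Algebra F R] [CommRing R']
    [Algebra F R'] (φ : R →ₐ[F] R') {m n q : ℕ} (n' l : ℕ) (Y : Fin q → F) (κ : YoungDiagram)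
    (S : Fin m → R) (T : Fin (n + n') → R) :
    φ (overlapSum n' l Y κ S T) = overlapSum n' l Y κ (φ ∘ S) (φ ∘ T) := by
  have hY : φ ∘ algebraMap F R ∘ Y = algebraMap F R' ∘ Y := by
    ext i; simp
  have h1 : ∀ {a b : ℕ} (X : Fin a → R) (Y : Fin b → R),
      φ (delta₂ X Y) = delta₂ (φ ∘ X) (φ ∘ Y) := fun X Y => map_delta₂ (φ : R →+* R') X Y
  have h2 : ∀ {a b : ℕ} (κ : YoungDiagram) (X : Fin a → R) (Y : Fin b → R),
      φ (littlewoodSchur κ X Y) = littlewoodSchur κ (φ ∘ X) (φ ∘ Y) :=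
    fun κ X Y => map_littlewoodSchur (φ : R →+* R') κ X Y
  have h3 : ∀ {a : ℕ} (X : Fin a → R), φ ∘ (-X) = -(φ ∘ X) := fun X => comp_neg (φ : R →+* R') X
  simp only [overlapSum, map_sum, map_mul, map_pow, map_neg, map_one, h1, h2, h3, subseq_comp, hY,
    AlgHom.commutes]

theorem delta₂_mul_littlewoodSchur_append_of_injective {F R : Type*} (K : Type*) [Field F]
    [CommRing R] [Algebra F R] [Field K] [Algebra R K] [Algebra F K] [IsScalarTower F R K]
    (hK : Function.Injective (algebraMap R K)) {m n n' l q : ℕ} (hn' : n' ≤ q) {S : Fin m → R}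
    {T : Fin (n + n') → R} (hST : Function.Injective (Fin.append S T)) {Y : Fin q → F}
    (hY : Function.Injective Y) {κ : YoungDiagram} (hκ : κ.colLen 0 ≤ l)
    (hκ' : κ.rowLen 0 ≤ m + n) (h : InDiagram (m + n) (q - n') κ) :
    delta₂ T S * littlewoodSchur κ.transpose (-(Fin.append S T)) (algebraMap F R ∘ Y) =
      overlapSum n' l Y κ S T := by
  apply hK
  have h1 := map_overlapSum (IsScalarTower.toAlgHom F R K) n' l Y κ S T
  rw [IsScalarTower.coe_toAlgHom'] at h1
  rw [h1, map_mul, map_delta₂, map_littlewoodSchur, comp_neg, comp_append]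
  have hYK : algebraMap R K ∘ algebraMap F R ∘ Y = algebraMap F K ∘ Y := by
    ext i
    simp [← IsScalarTower.algebraMap_apply F R K]
  have hYi : Function.Injective (algebraMap F K ∘ Y) := (algebraMap F K).injective.comp hY
  have hSTK : Function.Injective (Fin.append (algebraMap R K ∘ S) (algebraMap R K ∘ T)) := by
    rw [← comp_append]
    exact hK.comp hST
  have hD : delta₂ (algebraMap R K ∘ T) (algebraMap R K ∘ S) ≠ 0 := by
    rw [delta₂_ne_zero_iff]
    intro j i hij
    have h2 : Fin.append (algebraMap R K ∘ S) (algebraMap R K ∘ T) (Fin.natAdd _ j) =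
        Fin.append (algebraMap R K ∘ S) (algebraMap R K ∘ T) (Fin.castAdd _ i) := by
      simpa using sub_eq_zero.1 hij
    have := congrArg Fin.val (hSTK h2)
    simp only [Fin.val_natAdd, Fin.val_castAdd] at this
    omega
  rw [hYK, littlewoodSchur_append_of_injective hn' hYi hSTK hκ hκ' h, overlapSum]
  simp only [Finset.mul_sum]
  refine Finset.sum_congr rfl fun p _ => Finset.sum_congr rfl fun A _ =>
    Finset.sum_congr rfl fun x _ => ?_
  rw [map_inv₀, map_delta₂, subseq_comp, subseq_comp]
  field_simp

/-- Universal case: `S` and `T` consist of independent indeterminates, distinct in the fraction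
field of a polynomial ring over `F`. With `Δ(T; S)` cleared, the identity already holds in the
polynomial ring and can be evaluated anywhere. The entries of `Y` remain in `F`, so the inverses of
`Δ(V; U)` are constants that survive evaluation. -/
theorem delta₂_mul_littlewoodSchur_append {F R : Type*} [Field F] [CommRing R] [Algebra F R]
    {m n n' l q : ℕ} (hn' : n' ≤ q) (S : Fin m → R) (T : Fin (n + n') → R) {Y : Fin q → F}
    (hY : Function.Injective Y) {κ : YoungDiagram} (hκ : κ.colLen 0 ≤ l)
    (hκ' : κ.rowLen 0 ≤ m + n) (h : InDiagram (m + n) (q - n') κ) :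
    delta₂ T S * littlewoodSchur κ.transpose (-(Fin.append S T)) (algebraMap F R ∘ Y) =
      overlapSum n' l Y κ S T := by
  let P := MvPolynomial (Fin m ⊕ Fin (n + n')) F
  let S₀ : Fin m → P := fun i => X (Sum.inl i)
  let T₀ : Fin (n + n') → P := fun j => X (Sum.inr j)
  have hST : Function.Injective (Fin.append S₀ T₀) := by
    have h2 : Fin.append S₀ T₀ = fun i => X (finSumFinEquiv.symm i) := by
      ext1 i
      induction i using Fin.addCases <;> simp [S₀, T₀]
    rw [h2]
    exact (MvPolynomial.X_injective).comp finSumFinEquiv.symm.injective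
  have hgen := delta₂_mul_littlewoodSchur_append_of_injective (FractionRing P)
    (IsFractionRing.injective P (FractionRing P)) hn' hST hY hκ hκ' h
  have h1 := congrArg (aeval (Sum.elim S T) : P →ₐ[F] R) hgen
  rw [map_overlapSum] at h1
  have h2 := map_littlewoodSchur ((aeval (Sum.elim S T) : P →ₐ[F] R) : P →+* R) κ.transpose
    (-(Fin.append S₀ T₀)) (algebraMap F P ∘ Y)
  have h3 := map_delta₂ ((aeval (Sum.elim S T) : P →ₐ[F] R) : P →+* R) T₀ S₀
  rw [comp_neg, comp_append] at h2
  have e1 : (aeval (Sum.elim S T) : P →ₐ[F] R) ∘ S₀ = S := by ext i; simp [S₀]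
  have e2 : (aeval (Sum.elim S T) : P →ₐ[F] R) ∘ T₀ = T := by ext i; simp [T₀]
  have e3 : (aeval (Sum.elim S T) : P →ₐ[F] R) ∘ algebraMap F P ∘ Y = algebraMap F R ∘ Y := by
    ext i; exact (aeval (Sum.elim S T) : P →ₐ[F] R).commutes (Y i)
  simp only [RingHom.coe_coe, e1, e2, e3] at h1 h2 h3
  rw [← h1, map_mul, h2, h3]

end LSOverlap

/-! ### The overlap identity -/

open LSOverlap
theorem mainTheorem10 {F : Type*} [Field F] (m n n' l q : ℕ) (hn' : n' ≤ q)
    (S : Fin m → F) (T : Fin (n + n') → F) (Y : Fin q → F)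
    (hY : delta Y ≠ 0) (hST : delta₂ S T ≠ 0)
    (κ : YoungDiagram) (hκ : κ ≤ rect (m + n) l) (hmem : InDiagram (m + n) (q - n') κ) :
    (∀ p ≤ min m q, ∀ x ∈ subpartitionPairs (m - p) (n + p + l) l κ,
      rect (q - n') (m - p) ≤ x.1.transpose) ∧
    littlewoodSchur κ.transpose (-(Fin.append S T)) Y =
      ∑ p ∈ Finset.range (min m q + 1),
        ∑ A ∈ Finset.powersetCard p (Finset.univ : Finset (Fin q)),
          ∑ x ∈ subpartitionPairs (m - p) (n + p + l) l κ,
            delta₂ (subseq Y Aᶜ) S * delta₂ T (subseq Y A) /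
                (delta₂ (subseq Y Aᶜ) (subseq Y A) * delta₂ T S) *
              (-1) ^ (∑ i ∈ coSubset x.2, (complement (m - p) (n + p + l) x.1).rowLen i) *
              littlewoodSchur (subRect x.1.transpose (q - n') (m - p)) (-S) (subseq Y A) *
              littlewoodSchur (subpartition (n + p + l) (complement (m - p) (n + p + l) x.1)
                (coSubset x.2)) (-T) (subseq Y Aᶜ) := by
  obtain ⟨hκl, hκN⟩ := mem_subdiagrams_rect.1 (mem_subdiagrams.2 hκ)
  refine ⟨fun p hp x hx => rect_le_iff.2 fun j => ?_, ?_⟩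
  · exact le_rowLen_of_mem_subpartitionPairs (by omega) hκl hκN hx hmem j
  · have hD : delta₂ T S ≠ 0 := delta₂_ne_zero_iff.2 fun j i h =>
      delta₂_ne_zero_iff.1 hST i j (by rw [← neg_sub, h, neg_zero])
    have h := delta₂_mul_littlewoodSchur_append hn' S T (delta_ne_zero_iff.1 hY) hκl hκN hmem
    have hid : algebraMap F F ∘ Y = Y := rfl
    apply mul_left_cancel₀ hD
    rw [hid] at h
    rw [h, overlapSum]
    simp only [Finset.mul_sum, hid]
    simp only [Algebra.algebraMap_self, RingHom.id_apply]
    refine Finset.sum_congr rfl fun p _ => Finset.sum_congr rfl fun A _ =>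
      Finset.sum_congr rfl fun x _ => ?_
    rw [div_eq_mul_inv, mul_inv]
    field_simp
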